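/- Let $K$ be a local field of characteristic zero (a finite extension of some $\mathbb{Q}_p$) with ring of integers $\mathcal{O}_K$, let $B$ be an $\mathcal{O}_K$-algebra which is $\mathcal{O}_K$-isomorphic to $\mathcal{O}_K[[T]]$, and put $M=\operatorname{Frac} B$. For a Noetherian local ring $A$ and an $A$-module $N$ write $N^{\mathrm{sep}}=N/\bigcap_{n\ge1}\mathfrak{m}_A^nN$. For a height one prime $y$ of $B$ let $M_y$ be the completion of $M$ at the discrete valuation of $y$; its ring of integers is $\widehat{B_y}$. Let $k_y$ be the algebraic closure of $K$ in $M_y$, and put $\Omega^{\mathrm{cts}}_{M_y/K}=\Omega^{\mathrm{sep}}_{\widehat{B_y}/\mathcal{O}_K}\otimes_{\widehat{B_y}}M_y$. The residue map $\operatorname{Res}_{M_y}:\Omega^{\mathrm{cts}}_{M_y/K}\to k_y$ is defined as follows. (i) If the residue field of $M_y$ has characteristic zero, choose a $k_y$-isomorphism $M_y\cong k_y((t))$ of discrete valuation fields; then $\operatorname{Res}_{M_y}(f\,dt)$ is the coefficient of $t^{-1}$ in $f$. (ii) If the residue field of $M_y$ has positive characteristic (that is, $y=\pi_KB$ with $\pi_K$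 a uniformiser of $K$), choose a $k_y$-isomorphism $M_y\cong k_y\{\{t\}\}$ of discrete valuation fields, where $k_y\{\{t\}\}$ is the field of series $\sum_{i\in\mathbb{Z}}a_it^i$ with bounded coefficients $a_i\in k_y$ such that $a_i\to0$ as $i\to-\infty$; then $\operatorname{Res}_{M_y}(f\,dt)$ is minus the coefficient of $t^{-1}$ in $f$. For $\omega\in\Omega^{\mathrm{sep}}_{B/\mathcal{O}_K}\otimes_BM$, let $\operatorname{Res}_y(\omega)\in k_y$ be the residue $\operatorname{Res}_{M_y}$ of the image in $\Omega^{\mathrm{cts}}_{M_y/K}$ of any lift of $\omega$ to $\Omega_{B/\mathcal{O}_K}\otimes_BM$. Theorem. For every height one prime $y$ and every $\omega\in\Omega^{\mathrm{sep}}_{B/\mathcal{O}_K}\otimes_BM$, the residue $\operatorname{Res}_y(\omega)$ is well defined: such isomorphisms and expressions $f\,dt$ exist, and the value does not depend on the choices. For every $\omega\in\Omega^{\mathrm{sep}}_{B/\mathcal{O}_K}\otimes_BM$, $\operatorname{Res}_y(\omega)=0$ for all but finitely many height one primes $y$ of $B$, and $$\sum_{y}\operatorname{Tr}_{k_y/K}\bigl(\operatorname{Res}_y(\omega)\bigr)=0\quad\text{in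 }K,$$ where $y$ runs over all height one primes of $B$. -/

import Mathlib

open scoped TensorProduct
open IsLocalRing IsDedekindDomain

namespace Reciprocity

/-! ### Separated quotients and continuous differentials -/

/-- `N^sep = N / ⋂ₙ 𝔪_Aⁿ N`, the maximal Hausdorff quotient of `N` for the `𝔪_A`-adic topology. -/
abbrev Sep (A N : Type*) [CommRing A] [IsLocalRing A] [AddCommGroup N] [Module A N] : Type _ :=
  N ⧸ (⨅ n : ℕ, maximalIdeal A ^ n • (⊤ : Submodule A N))

/-- The separated differentials `Ω^sep_{R/O}` of a local `O`-algebra `R`. -/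
abbrev SepDiff (O R : Type*) [CommRing O] [CommRing R] [IsLocalRing R] [Algebra O R] : Type _ :=
  Sep R (Ω[R⁄O])

/-- Continuous differentials `Ω^cts = Ω^sep_{R/O} ⊗_R F`, where `F` is a complete discrete
valuation field with ring of integers `R`. -/
abbrev CtsDiff (O R F : Type*) [CommRing O] [CommRing R] [IsLocalRing R] [Algebra O R]
    [Field F] [Algebra R F] : Type _ :=
  F ⊗[R] SepDiff O R

/-- The class of `dx` in `Ω^cts`, for `x ∈ R`. -/
noncomputable def ctsD (O : Type*) {R : Type*} (F : Type*) [CommRing O] [CommRing R]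
    [IsLocalRing R] [Algebra O R] [Field F] [Algebra R F] (x : R) : CtsDiff O R F :=
  (1 : F) ⊗ₜ[R] (Submodule.Quotient.mk (KaehlerDifferential.D O R x) : SepDiff O R)

/-! ### Residues on a two-dimensional local field

`F` is a two-dimensional local field of characteristic zero with ring of integers `R`; it contains
the local field `K`, the fraction field of `O`. -/

/-- The coefficient field (equal characteristic), resp. constant field (mixed characteristic), of
`F` with respect to `K`: the algebraic closure of `K` in `F`. -/
noncomputable abbrev constField (K F : Type*) [Field K] [Field F] [Algebra K F] :
    IntermediateField K F :=
  algebraicClosure K F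

/-- An isomorphism `k_F((t)) ≅ F` over `k_F` carrying `k_F[[t]]` onto the ring of integers `R`;
the field `t` is the uniformiser which is the image of the variable. -/
structure LaurentCoordinate (K R F : Type*) [Field K] [CommRing R] [Field F] [Algebra K F]
    [Algebra R F] where
  equiv : LaurentSeries (constField K F) ≃ₐ[constField K F] F
  mem_integers_iff : ∀ f : LaurentSeries (constField K F),
    equiv f ∈ Set.range (algebraMap R F) ↔ ∀ n : ℤ, n < 0 → f.coeff n = 0
  t : R
  equiv_variable : equiv (HahnSeries.single (1 : ℤ) 1) = algebraMap R F t

section DoubleSeries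

variable (O : Type*) {k : Type*} [CommRing O] [Field k] [Algebra O k]

/-- For `k` algebraic over `Frac O`, with ring of integers `𝓞_k` the integral closure of `O` in
`k`, this says `x ∈ d 𝓞_k`. The sets `d 𝓞_k`, `0 ≠ d ∈ O`, form a basis of neighbourhoods of
zero for the valuation topology of `k`. -/
def MemMulIntegers (d : O) (x : k) : Prop :=
  ∃ b : k, IsIntegral O b ∧ x = algebraMap O k d * b

/-- The formal series `∑_{i ∈ ℤ} a_i t^i` belongs to `k{{t}}`: its coefficients are bounded, and
`a_i → 0` as `i → -∞`. -/
def IsDoubleSeries (a : ℤ → k) : Prop :=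
  (∃ d : O, d ≠ 0 ∧ ∀ i, IsIntegral O (algebraMap O k d * a i)) ∧
    ∀ d : O, d ≠ 0 → ∀ᶠ i in Filter.atBot, MemMulIntegers O d (a i)

/-- The series `∑_{r ∈ ℤ} u_r` converges (unconditionally) to `s` for the valuation topology
of `k`. -/
def ConvergesTo (u : ℤ → k) (s : k) : Prop :=
  ∀ d : O, d ≠ 0 → ∃ S : Finset ℤ, ∀ S' : Finset ℤ, S ⊆ S' →
    MemMulIntegers O d ((∑ r ∈ S', u r) - s)

end DoubleSeries

/-- An isomorphism `F ≅ k_F{{t}}` over `k_F` of discrete valuation fields, given by the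
coefficients `coeff x i` of the expansions `x = ∑_{i ∈ ℤ} (coeff x i) t^i`. Sums are formed
termwise, and products by the convergent sums `(xy)_i = ∑_r x_r y_{i-r}`. The field `t` is the first
local parameter corresponding to the variable. -/
structure DoubleCoordinate (O K R F : Type*) [CommRing O] [Field K] [CommRing R] [Field F]
    [Algebra O K] [Algebra O F] [Algebra K F] [IsScalarTower O K F] [Algebra R F] where
  coeff : F →ₗ[constField K F] (ℤ → constField K F)
  injective : Function.Injective coeff
  mem_range_iff : ∀ a : ℤ → constField K F, a ∈ Set.range coeff ↔ IsDoubleSeries O a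
  coeff_mul : ∀ (x y : F) (i : ℤ),
    ConvergesTo O (fun r => coeff x r * coeff y (i - r)) (coeff (x * y) i)
  mem_integers_iff : ∀ x : F,
    x ∈ Set.range (algebraMap R F) ↔ ∀ i, IsIntegral O (coeff x i)
  t : R
  coeff_variable : coeff (algebraMap R F t) = Pi.single (1 : ℤ) 1

/-- `r` is the residue of the continuous differential form `ω` of `F`, relative to `K`.
If the residue field of `F` has characteristic zero, then `F ≅ k_F((t))`, and the residue of `f dt`
is the coefficient of `t⁻¹` in `f`. If `F` is a standard field of mixed characteristic, then
`F ≅ k_F{{t}}`, and the residue of `f dt` is minus the coefficient of `t⁻¹` in `f`. -/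
def IsLocalResidue (O K R F : Type*) [CommRing O] [Field K] [CommRing R] [IsLocalRing R] [Field F]
    [Algebra O K] [Algebra O R] [Algebra O F] [Algebra K F] [IsScalarTower O K F] [Algebra R F]
    (ω : CtsDiff O R F) (r : constField K F) : Prop :=
  (CharZero (ResidueField R) ∧ ∃ (c : LaurentCoordinate K R F) (f : F),
      ω = f • ctsD O F c.t ∧ r = (c.equiv.symm f).coeff (-1)) ∨
  (¬ CharZero (ResidueField R) ∧ ∃ (c : DoubleCoordinate O K R F) (f : F),
      ω = f • ctsD O F c.t ∧ r = -c.coeff f (-1))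

/-! ### The local fields attached to the height one primes of a two-dimensional local ring -/

/-- The prime ideals of height one. -/
abbrev HeightOnePrime (B : Type*) [CommRing B] : Type _ :=
  {y : PrimeSpectrum B // y.asIdeal.height = 1}

section Completion

variable {B : Type*} (M : Type*) [CommRing B] [IsDomain B] [Field M] [Algebra B M]
  [IsFractionRing B M] (y : HeightOnePrime B)

/-- The localisation `B_y`, as a subring of `M = Frac B`. -/
noncomputable abbrev localRing : Subalgebra B M :=
  Localization.subalgebra.ofField M y.1.asIdeal.primeCompl
    y.1.asIdeal.primeCompl_le_nonZeroDivisors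

instance : IsLocalRing (localRing M y) :=
  IsLocalization.AtPrime.isLocalRing (localRing M y) y.1.asIdeal

theorem height_maximalIdeal_localRing : (maximalIdeal (localRing M y)).height = 1 := by
  have h := IsLocalization.AtPrime.ringKrullDim_eq_height y.1.asIdeal (localRing M y)
  rw [← IsLocalRing.maximalIdeal_height_eq_ringKrullDim, y.2] at h
  exact_mod_cast h

instance [IsNoetherianRing B] [IsIntegrallyClosed B] : IsDedekindDomain (localRing M y) := by
  have h1 : IsNoetherianRing (localRing M y) :=
    IsLocalization.isNoetherianRing y.1.asIdeal.primeCompl _ inferInstance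
  have h2 : IsIntegrallyClosed (localRing M y) :=
    isIntegrallyClosed_of_isLocalization _ y.1.asIdeal.primeCompl
      y.1.asIdeal.primeCompl_le_nonZeroDivisors
  have h3 : Ring.DimensionLEOne (localRing M y) := by
    refine ⟨fun {P} hP0 hP => ?_⟩
    by_contra hmax
    have hlt : P < maximalIdeal (localRing M y) :=
      lt_of_le_of_ne (le_maximalIdeal hP.ne_top) fun h => hmax (h ▸ maximalIdeal.isMaximal _)
    have h : P.height + 1 ≤ (maximalIdeal (localRing M y)).height :=
      Ideal.height_add_one_le_of_lt_of_isPrime hlt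
    have h0 : P.height ≠ 0 := fun h0 => hP0 (Ideal.height_eq_zero_iff_eq_bot.mp h0)
    rw [height_maximalIdeal_localRing M y] at h
    have h4 : (1 : ℕ∞) + 1 ≤ 1 := le_trans (by gcongr; exact Order.one_le_iff_ne_zero.mpr h0) h
    exact absurd h4 (by decide)
  exact { h1, h2, h3 with }

/-- The maximal ideal of `B_y`. -/
noncomputable def place [IsNoetherianRing B] [IsIntegrallyClosed B] :
    HeightOneSpectrum (localRing M y) where
  asIdeal := maximalIdeal (localRing M y)
  isPrime := (maximalIdeal.isMaximal _).isPrime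
  ne_bot := by
    intro h
    have := height_maximalIdeal_localRing M y
    rw [h] at this
    simp at this

variable [IsNoetherianRing B] [IsIntegrallyClosed B]

/-- The complete discrete valuation field `M_y`, the completion of `M` for the `y`-adic
valuation. -/
abbrev complField : Type _ := (place M y).adicCompletion M

/-- The ring of integers of `M_y`, which is the completion of the discrete valuation ring `B_y`. -/
noncomputable abbrev complRing : ValuationSubring (complField M y) := (place M y).adicCompletionIntegers M

section Algebras

variable (O : Type*) [CommRing O] [Algebra O B] [Algebra O M] [IsScalarTower O B M]

noncomputable instance algebraComplRing : Algebra O (complRing M y) :=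
  ((algebraMap (localRing M y) (complRing M y)).comp (algebraMap O (localRing M y))).toAlgebra

instance : IsScalarTower O (complRing M y) (complField M y) :=
  .of_algebraMap_eq fun _ => rfl

instance : IsScalarTower O B (complRing M y) :=
  .of_algebraMap_eq fun x => Subtype.ext (by
    change algebraMap O (complField M y) x = algebraMap B (complField M y) (algebraMap O B x)
    exact IsScalarTower.algebraMap_apply O B (complField M y) x)

end Algebras

end Completion

section Global

variable (O K B M : Type*) [CommRing O] [Field K] [Algebra O K]
  [CommRing B] [IsDomain B] [IsLocalRing B] [IsNoetherianRing B] [IsIntegrallyClosed B]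
  [Field M] [Algebra B M] [IsFractionRing B M] [Algebra O B] [Algebra O M] [IsScalarTower O B M]
  [Algebra K M] [IsScalarTower O K M]

/-- The space `Ω^sep_{B/O} ⊗_B M`. -/
abbrev GlobalDiff : Type _ := M ⊗[B] SepDiff O B

/-- The natural surjection `Ω_{B/O} ⊗_B M → Ω^sep_{B/O} ⊗_B M`. -/
noncomputable def toGlobalDiff : M ⊗[B] Ω[B⁄O] →ₗ[B] GlobalDiff O B M :=
  LinearMap.lTensor M (Submodule.mkQ _)

variable (y : HeightOnePrime B)

/-- The natural map `Ω_{B/O} ⊗_B M → Ω^cts_{M_y/K}`, `db ⊗ m ↦ m db`. -/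
noncomputable def toCtsDiff :
    M ⊗[B] Ω[B⁄O] →ₗ[B] CtsDiff O (complRing M y) (complField M y) :=
  TensorProduct.lift <| LinearMap.mk₂ B
    (fun m η => algebraMap M (complField M y) m ⊗ₜ[complRing M y]
      (Submodule.Quotient.mk (KaehlerDifferential.map O O B (complRing M y) η) :
        SepDiff O (complRing M y)))
    (fun m m' η => by rw [map_add, TensorProduct.add_tmul])
    (fun b m η => by
      rw [Algebra.smul_def, map_mul, TensorProduct.smul_tmul', Algebra.smul_def,
        ← IsScalarTower.algebraMap_apply])
    (fun m η η' => by rw [map_add, Submodule.Quotient.mk_add, TensorProduct.tmul_add])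
    (fun b m η => by
      rw [map_smul, ← algebraMap_smul (complRing M y) b, Submodule.Quotient.mk_smul,
        TensorProduct.tmul_smul, TensorProduct.smul_tmul', TensorProduct.smul_tmul',
        algebraMap_smul])

/-- `r ∈ k_y` is the residue at `y` of `ω ∈ Ω^sep_{B/O} ⊗_B M`: it is the residue of the image in
`Ω^cts_{M_y/K}` of a lift of `ω` to `Ω_{B/O} ⊗_B M`. -/
def IsResidueAt (ω : GlobalDiff O B M) (r : constField K (complField M y)) : Prop :=
  ∃ η : M ⊗[B] Ω[B⁄O], toGlobalDiff O B M η = ω ∧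
    IsLocalResidue O K (complRing M y) (complField M y) (toCtsDiff O B M y η) r

/-- The residue `Res_y ω ∈ k_y`. This is the element `r` singled out by `IsResidueAt`. -/
noncomputable def res (ω : GlobalDiff O B M) : constField K (complField M y) :=
  Classical.epsilon (IsResidueAt O K B M y ω)

/-- The residue `Tr_{k_y/K} (Res_y ω) ∈ K`. -/
noncomputable def traceRes (ω : GlobalDiff O B M) : K :=
  Algebra.trace K (constField K (complField M y)) (res O K B M y ω)

end Global

end Reciprocity

/-! Fix an isomorphism of `B` with O⟦T⟧. A form ω enters every residue only through g = `ctsLift M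
(paramDerivation e) ω`, so it may be treated as g dT, and each residue becomes an O-linear
functional of g in Frac O⟦T⟧ (`IsResidueFunctional`).

Local part. In both types of place Ω^cts is spanned by dt, because dt spans modulo the maximal ideal
and the differentials have been separated. A form is therefore known from its image under d/dt, and
independence of t is a change of variable formula. In residue characteristic zero, Hensel's lemma
gives a coefficient field and hence a Laurent coordinate. Exact forms have no residue, which lowers
poles to order one, and a dq/q has as residue the class of a for every uniformizer q.

At (π) the completion is the π-adic completion of O((T)) localized at (π), a ring of double series
whose field of constants is K. An isomorphism with k{{t}} is not assumed continuous for the topology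
in which the series converge, so two coordinates must first be compared. Artin–Schreier equations
show that they have the same order function modulo π (`mem_fil_zero_of_mem_fil_one`,
`hasOrder_t_one`). Writing power series modulo π in terms of high powers shows that they define the
same topology (`exists_t_pow_mul_mem_fil`). The residue may then be compared on the monomials t^i
dt, where everything with i ≠ -1 is exact and dt/t is a logarithmic derivative (`coeff_neg_one_eq`).

Global part. By Weierstrass preparation a denominator is, up to a unit, π^n times a product of
distinguished polynomials that are prime in B. The power of π is harmless by linearity. Since B/(Q)
is integral over O, coprime elements satisfy a Bézout identity with value a nonzero c in O, which
yields partial fractions; subtracting exact forms reduces powers of Q to Q itself. Weierstrass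
division leaves r dT/Q with r a polynomial and deg r < n = deg Q. This form is regular away from (Q)
and (π). At (Q) its residue is r(θ)/Q'(θ), where θ is a root of Q, and by Euler's formula the trace
is the coefficient of r of index n - 1. At (π) the coefficient of T^(-1) in r/Q is that same
coefficient, and the sign in the definition of the residue makes the two cancel
(`SumFormula.of_aeval_mul_eq`). -/

set_option linter.unusedSectionVars false

namespace Reciprocity

/-! ### Completeness, uniformizers and residue field of an adic completion. -/

section AdicCompletion

open HeightOneSpectrum WithZero

variable {A : Type*} [CommRing A] [IsDedekindDomain A] (K : Type*) [Field K] [Algebra A K]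
  [IsFractionRing A K] (v : HeightOneSpectrum A)

theorem algebraMap_mem_maximalIdeal_iff (a : A) :
    algebraMap A (v.adicCompletionIntegers K) a ∈ maximalIdeal (v.adicCompletionIntegers K) ↔
      a ∈ v.asIdeal := by
  rw [mem_maximalIdeal, mem_nonunits_iff, adicCompletionIntegers.isUnit_iff_valued_eq_one,
    algebraMap_adicCompletionIntegers_apply]
  have h := valuedAdicCompletion_eq_valuation' v (algebraMap A K a)
  rw [h, ← v.valuation_lt_one_iff_mem (K := K)]
  have := v.valuation_le_one (K := K) a
  exact ⟨fun h => lt_of_le_of_ne this h, fun h => h.ne⟩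

theorem exists_uniformizer_adicCompletionIntegers :
    ∃ ϖ : v.adicCompletionIntegers K, maximalIdeal (v.adicCompletionIntegers K) = Ideal.span {ϖ} ∧
      Valued.v (ϖ : v.adicCompletion K) = exp (-1 : ℤ) ∧
      ∃ a ∈ v.asIdeal, algebraMap A _ a = ϖ := by
  obtain ⟨ϖ, hϖ⟩ := v.intValuation_exists_uniformizer
  have hmem : ϖ ∈ v.asIdeal := by
    rw [← v.intValuation_lt_one_iff_mem, hϖ, ← exp_zero, exp_lt_exp]; simp
  refine ⟨algebraMap A _ ϖ, ?_, ?_, ϖ, hmem, rfl⟩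
  swap
  · rw [algebraMap_adicCompletionIntegers_apply]
    exact (valuedAdicCompletion_eq_valuation' v (algebraMap A K ϖ)).trans
      ((v.valuation_of_algebraMap ϖ).trans hϖ)
  · have hval : Valued.v ((algebraMap A (v.adicCompletionIntegers K) ϖ :) : v.adicCompletion K)
        = exp (-1 : ℤ) := (valuedAdicCompletion_eq_valuation' v (algebraMap A K ϖ)).trans
      ((v.valuation_of_algebraMap ϖ).trans hϖ)
    apply le_antisymm
    · intro x hx
      rw [Ideal.mem_span_singleton]
      apply (adicCompletionIntegers.integers K v).dvd_of_le
      change Valued.v (x : v.adicCompletion K) ≤ Valued.v ((algebraMap A (v.adicCompletionIntegers K) ϖ :) : v.adicCompletion K)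
      rw [hval]
      rw [mem_maximalIdeal, mem_nonunits_iff, adicCompletionIntegers.isUnit_iff_valued_eq_one] at hx
      have h1 : Valued.v (x : v.adicCompletion K) < 1 := lt_of_le_of_ne x.2 hx
      rw [← exp_zero] at h1
      by_cases h0 : Valued.v (x : v.adicCompletion K) = 0
      · rw [h0]; exact zero_le
      · rw [← exp_log h0, exp_lt_exp] at h1
        rw [← exp_log h0, exp_le_exp]; omega
    · rwa [Ideal.span_singleton_le_iff_mem, algebraMap_mem_maximalIdeal_iff]

theorem maximalIdeal_adicCompletionIntegers_eq_span {q : A} (hq : v.asIdeal = Ideal.span {q}) :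
    maximalIdeal (v.adicCompletionIntegers K) =
      Ideal.span {algebraMap A (v.adicCompletionIntegers K) q} := by
  obtain ⟨_, h1, -, a, ha, rfl⟩ := exists_uniformizer_adicCompletionIntegers K v
  apply le_antisymm
  · rw [h1, Ideal.span_singleton_le_span_singleton]
    rw [hq, Ideal.mem_span_singleton] at ha
    exact map_dvd _ ha
  · rw [Ideal.span_singleton_le_iff_mem, algebraMap_mem_maximalIdeal_iff, hq]
    exact Ideal.mem_span_singleton_self q

theorem mem_maximalIdeal_pow_iff_valued_le (n : ℕ) (x : v.adicCompletionIntegers K) :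
    x ∈ maximalIdeal (v.adicCompletionIntegers K) ^ n ↔
      Valued.v (x : v.adicCompletion K) ≤ exp (-n : ℤ) := by
  obtain ⟨ϖ, h1, h2, -⟩ := exists_uniformizer_adicCompletionIntegers K v
  have h3 : Valued.v ((ϖ ^ n : v.adicCompletionIntegers K) : v.adicCompletion K) = exp (-n : ℤ) := by
    rw [SubmonoidClass.coe_pow, map_pow, h2, ← exp_nsmul]; simp
  rw [h1, Ideal.span_singleton_pow, Ideal.mem_span_singleton, ← h3]
  exact ((adicCompletionIntegers.integers K v).le_iff_dvd (x := x) (y := ϖ ^ n)).symm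

open MonoidWithZeroHom.ValueGroup₀ in
-- Neighbourhoods of zero are indexed by the actual value group of the valuation, not by ℤᵐ⁰; this
-- makes the balls of radius `exp (-n)` usable for testing Cauchy sequences.
theorem exists_restrict_lt_of_valued_le
    (γ : (MonoidWithZeroHom.ValueGroup₀ (.ofClass (Valued.v : Valuation (v.adicCompletion K) ℤᵐ⁰)))ˣ) :
    ∃ n : ℕ, ∀ x : v.adicCompletion K, Valued.v x ≤ exp (-n : ℤ) → Valued.v.restrict x < γ.1 := by
  have h0 : embedding γ.1 ≠ 0 := by
    simp
  refine ⟨(log (embedding γ.1)).natAbs + 1, fun x hx => ?_⟩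
  rw [← embedding_strictMono.lt_iff_lt, Valuation.embedding_restrict]
  refine hx.trans_lt ?_
  rw [← exp_log h0, exp_lt_exp, log_exp]
  omega

theorem valued_restrict_lt_iff (x y : v.adicCompletion K) :
    (Valued.v : Valuation (v.adicCompletion K) ℤᵐ⁰).restrict x < Valued.v.restrict y ↔
      Valued.v x < Valued.v y := by
  rw [← MonoidWithZeroHom.ValueGroup₀.embedding_strictMono.lt_iff_lt,
    Valuation.embedding_restrict, Valuation.embedding_restrict]

theorem exists_valued_sub_le_of_dense {s : Set (v.adicCompletion K)} {L : v.adicCompletion K}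
    (h : L ∈ closure s) (n : ℕ) : ∃ x ∈ s, Valued.v (x - L) ≤ exp (-n : ℤ) := by
  obtain ⟨ϖ, -, h2, -⟩ := exists_uniformizer_adicCompletionIntegers K v
  have h3 : Valued.v ((ϖ : v.adicCompletion K) ^ n) = exp (-n : ℤ) := by
    rw [map_pow, h2, ← exp_nsmul]; simp
  have h4 : (Valued.v : Valuation (v.adicCompletion K) ℤᵐ⁰).restrict ((ϖ : v.adicCompletion K) ^ n) ≠ 0 := by
    intro h
    have : (ϖ : v.adicCompletion K) ^ n = 0 := by simpa using h
    rw [this, map_zero] at h3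
    exact exp_ne_zero h3.symm
  obtain ⟨x, hx, hxs⟩ := mem_closure_iff_nhds.mp h
    {x | (Valued.v : Valuation (v.adicCompletion K) ℤᵐ⁰).restrict (x - L) < (Units.mk0 _ h4).1} (Valued.mem_nhds.mpr ⟨Units.mk0 _ h4, subset_rfl⟩)
  refine ⟨x, hxs, ?_⟩
  rw [← h3]
  exact ((valued_restrict_lt_iff K v _ _).mp hx).le

/-- The powers of the maximal ideal are the balls of radius `exp (-n)`, so an adic Cauchy sequence
has a limit in the complete field. The limit lies in the closure of every tail, hence is integral
and satisfies the required congruences. -/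
instance isAdicComplete_adicCompletionIntegers :
    IsAdicComplete (maximalIdeal (v.adicCompletionIntegers K)) (v.adicCompletionIntegers K) where
  haus' x hx := by
    have h : ∀ n : ℕ, x ∈ maximalIdeal (v.adicCompletionIntegers K) ^ n := fun n => by
      have := hx n
      rwa [SModEq.zero, smul_eq_mul, Ideal.mul_top] at this
    by_contra h0
    have h0' : Valued.v (x : v.adicCompletion K) ≠ 0 := by
      intro h
      exact h0 (Subtype.ext ((map_eq_zero _).mp h))
    have := (mem_maximalIdeal_pow_iff_valued_le K v _ x).mp
      (h ((log (Valued.v (x : v.adicCompletion K))).natAbs + 1))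
    rw [← exp_log h0', exp_le_exp, log_exp] at this
    omega
  prec' f hf := by
    have hf' : ∀ {m n : ℕ}, m ≤ n →
        Valued.v ((f m : v.adicCompletion K) - f n) ≤ exp (-m : ℤ) := fun {m n} h => by
      have := hf h
      rw [SModEq.sub_mem, smul_eq_mul, Ideal.mul_top, mem_maximalIdeal_pow_iff_valued_le] at this
      exact this
    have hc : CauchySeq (fun n => (f n : v.adicCompletion K)) := by
      rw [(Valued.hasBasis_uniformity (v.adicCompletion K) ℤᵐ⁰).cauchySeq_iff]
      intro γ _
      obtain ⟨N, hN⟩ := exists_restrict_lt_of_valued_le K v γ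
      refine ⟨N, fun m hm n hn => hN _ ?_⟩
      have h2 : (f n : v.adicCompletion K) - f m = (f N - f m) - (f N - f n) := by ring
      rw [h2]
      exact Valuation.map_sub_le (v := Valued.v) (hf' hm) (hf' hn)
    obtain ⟨L, hL⟩ := cauchySeq_tendsto_of_complete hc
    have hLn : ∀ n, Valued.v ((f n : v.adicCompletion K) - L) ≤ exp (-n : ℤ) := by
      intro n
      have h1 : L ∈ closure ((fun n => (f n : v.adicCompletion K)) '' Set.Ici n) :=
        mem_closure_of_tendsto hL (Filter.eventually_atTop.mpr ⟨n, fun m hm => ⟨m, hm, rfl⟩⟩)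
      obtain ⟨_, ⟨m, hm, rfl⟩, h2⟩ := exists_valued_sub_le_of_dense K v h1 n
      have h3 : (f n : v.adicCompletion K) - L = (f n - f m) + (f m - L) := by ring
      rw [h3]
      exact Valuation.map_add_le _ (hf' hm) h2
    have hL1 : L ∈ v.adicCompletionIntegers K := by
      have := hLn 0
      rw [mem_adicCompletionIntegers]
      have h2 : L = f 0 - (f 0 - L) := by ring
      rw [h2]
      exact Valuation.map_sub_le (v := Valued.v) (f 0).2 (this.trans (by simp))
    refine ⟨⟨L, hL1⟩, fun n => ?_⟩
    rw [SModEq.sub_mem, smul_eq_mul, Ideal.mul_top, mem_maximalIdeal_pow_iff_valued_le]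
    exact hLn n

/-- Completion does not enlarge the residue field: by density x is close to an element of K, which
is then integral at `v` and so congruent to an element of A. -/
theorem exists_sub_algebraMap_mem_maximalIdeal (x : v.adicCompletionIntegers K) :
    ∃ a : A, x - algebraMap A _ a ∈ maximalIdeal (v.adicCompletionIntegers K) := by
  obtain ⟨_, ⟨y, rfl⟩, hy⟩ := exists_valued_sub_le_of_dense K v
    (denseRange_algebraMap K v (x : v.adicCompletion K)) 1
  have h1 : Valued.v (algebraMap K (v.adicCompletion K) y) ≤ 1 := by
    have h2 : algebraMap K (v.adicCompletion K) y = (algebraMap K (v.adicCompletion K) y - x) + x := by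
      ring
    rw [h2]
    exact Valuation.map_add_le _ (hy.trans (by rw [← exp_zero, exp_le_exp]; simp)) x.2
  have h1' : v.valuation K y ≤ 1 := by
    rw [← valuedAdicCompletion_eq_valuation']; exact h1
  obtain ⟨a, ha⟩ := v.exists_valuation_sub_lt_of_integer h1' (Units.mk0 (exp (-1 : ℤ)) exp_ne_zero)
  refine ⟨a, ?_⟩
  rw [← pow_one (maximalIdeal _), mem_maximalIdeal_pow_iff_valued_le]
  have h3 : ((x - algebraMap A _ a : v.adicCompletionIntegers K) : v.adicCompletion K) =
    (x - algebraMap K (v.adicCompletion K) y) - (algebraMap K (v.adicCompletion K) (algebraMap A K a - y)) := by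
    rw [map_sub]
    change (x : v.adicCompletion K) - algebraMap K (v.adicCompletion K) (algebraMap A K a) = _
    ring
  rw [h3]
  refine Valuation.map_sub_le (v := Valued.v) (by rw [Valuation.map_sub_swap]; exact hy) ?_
  have := valuedAdicCompletion_eq_valuation' v (algebraMap A K a - y)
  exact (this.trans_lt ha).le

end AdicCompletion

/-! ### The completions of `B` at height one primes. -/

section Places

variable {B : Type*} (M : Type*) [CommRing B] [IsDomain B] [Field M] [Algebra B M]
  [IsFractionRing B M] (y : HeightOnePrime B) [IsNoetherianRing B] [IsIntegrallyClosed B]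

theorem algebraMap_complRing_mem_maximalIdeal_iff (b : B) :
    algebraMap B (complRing M y) b ∈ maximalIdeal (complRing M y) ↔ b ∈ y.1.asIdeal := by
  refine (algebraMap_mem_maximalIdeal_iff M (place M y) (algebraMap B (localRing M y) b)).trans ?_
  change algebraMap B (localRing M y) b ∈ maximalIdeal (localRing M y) ↔ _
  exact IsLocalization.AtPrime.to_map_mem_maximal_iff (localRing M y) y.1.asIdeal b

/-- The residue field of the completion is the fraction field of B/y; the denominator `s` has been
cleared. -/
theorem exists_mul_sub_algebraMap_mem_maximalIdeal (x : complRing M y) :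
    ∃ b s : B, s ∉ y.1.asIdeal ∧
      algebraMap B (complRing M y) s * x - algebraMap B (complRing M y) b ∈
        maximalIdeal (complRing M y) := by
  obtain ⟨a, ha⟩ := exists_sub_algebraMap_mem_maximalIdeal M (place M y) x
  obtain ⟨⟨b, s⟩, hbs⟩ := IsLocalization.surj y.1.asIdeal.primeCompl a
  refine ⟨b, s, s.2, ?_⟩
  have h1 : algebraMap B (complRing M y) b = algebraMap B (complRing M y) s *
      algebraMap (localRing M y) (complRing M y) a := by
    have := congrArg (algebraMap (localRing M y) (complRing M y)) hbs
    rw [map_mul, mul_comm] at this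
    exact this.symm
  rw [h1, ← mul_sub]
  exact Ideal.mul_mem_left _ _ ha

theorem maximalIdeal_complRing_eq_span {q : B} (hq : y.1.asIdeal = Ideal.span {q}) :
    maximalIdeal (complRing M y) = Ideal.span {algebraMap B (complRing M y) q} := by
  refine maximalIdeal_adicCompletionIntegers_eq_span M (place M y)
    (q := algebraMap B (localRing M y) q) ?_
  have := IsLocalization.AtPrime.map_eq_maximalIdeal y.1.asIdeal (localRing M y)
  rw [hq, Ideal.map_span, Set.image_singleton] at this
  exact this.symm

end Places
end Reciprocity

namespace Reciprocity

/-! ### Separated differentials and the functionals given by derivations. -/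

section Differentials

variable {O R : Type*} [CommRing O] [CommRing R] [IsLocalRing R] [Algebra O R]

theorem liftKaehlerDifferential_mem_of_mem_smul_top (D : Derivation O R R) {I : Ideal R}
    {η : Ω[R⁄O]} (h : η ∈ I • (⊤ : Submodule R (Ω[R⁄O]))) : D.liftKaehlerDifferential η ∈ I := by
  have h1 := Submodule.mem_map_of_mem (f := D.liftKaehlerDifferential) h
  rw [Submodule.map_smul''] at h1
  exact Ideal.mul_le_left (I := I) (J := Submodule.map D.liftKaehlerDifferential ⊤) h1

/-- The functional on separated differentials induced by a derivation. -/
noncomputable def sepLift [IsNoetherianRing R] (D : Derivation O R R) : SepDiff O R →ₗ[R] R :=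
  Submodule.liftQ _ D.liftKaehlerDifferential fun η hη => by
    have h2 : D.liftKaehlerDifferential η ∈ ⨅ n : ℕ, maximalIdeal R ^ n := by
      rw [Submodule.mem_iInf] at hη ⊢
      exact fun n => liftKaehlerDifferential_mem_of_mem_smul_top D (hη n)
    rwa [Ideal.iInf_pow_eq_bot_of_isLocalRing _ (maximalIdeal.isMaximal R).ne_top] at h2

@[simp]
theorem sepLift_mk [IsNoetherianRing R] (D : Derivation O R R) (η : Ω[R⁄O]) :
    sepLift D (Submodule.Quotient.mk η) = D.liftKaehlerDifferential η := rfl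

variable (F : Type*) [Field F] [Algebra R F]

/-- The functional on continuous differentials induced by a derivation. -/
noncomputable def ctsLift [IsNoetherianRing R] (D : Derivation O R R) : CtsDiff O R F →ₗ[F] F :=
  LinearMap.liftBaseChange F ((Algebra.linearMap R F).comp (sepLift D))

@[simp]
theorem ctsLift_tmul [IsNoetherianRing R] (D : Derivation O R R) (f : F) (η : Ω[R⁄O]) :
    ctsLift F D (f ⊗ₜ (Submodule.Quotient.mk η : SepDiff O R)) =
      f * algebraMap R F (D.liftKaehlerDifferential η) := by
  simp [ctsLift]

@[simp]
theorem ctsLift_ctsD [IsNoetherianRing R] (D : Derivation O R R) (x : R) :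
    ctsLift F D (ctsD O F x) = algebraMap R F (D x) := by
  simp [ctsD]

/-- Substituting Ω = R dt + 𝔪Ω into 𝔪ⁿΩ turns the error term into 𝔪ⁿ⁺¹Ω. This replaces Nakayama's
lemma, as Ω need not be finitely generated. -/
theorem sub_smul_mem_smul_top_of_mem_span {t : R}
    (ht : ∀ x : R, KaehlerDifferential.D O R x ∈
      (R ∙ KaehlerDifferential.D O R t) ⊔ maximalIdeal R • (⊤ : Submodule R (Ω[R⁄O]))) (n : ℕ) :
    (R ∙ KaehlerDifferential.D O R t) ⊔ maximalIdeal R ^ n • (⊤ : Submodule R (Ω[R⁄O])) = ⊤ := by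
  have h1 : (R ∙ KaehlerDifferential.D O R t) ⊔ maximalIdeal R • (⊤ : Submodule R (Ω[R⁄O])) = ⊤ := by
    rw [eq_top_iff, ← KaehlerDifferential.span_range_derivation, Submodule.span_le]
    rintro _ ⟨x, rfl⟩
    rw [KaehlerDifferential.span_range_derivation]
    exact ht x
  induction n with
  | zero => simp
  | succ n ih =>
    rw [eq_top_iff]
    calc ⊤ = (R ∙ KaehlerDifferential.D O R t) ⊔ maximalIdeal R ^ n • (⊤ : Submodule R (Ω[R⁄O])) :=
        ih.symm
      _ = (R ∙ KaehlerDifferential.D O R t) ⊔ maximalIdeal R ^ n •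
          ((R ∙ KaehlerDifferential.D O R t) ⊔ maximalIdeal R • (⊤ : Submodule R (Ω[R⁄O]))) := by
        rw [h1]
      _ ≤ _ := by
        rw [Submodule.smul_sup, ← Submodule.mul_smul, ← pow_succ]
        refine sup_le le_sup_left (sup_le (Submodule.smul_le_right.trans le_sup_left) le_sup_right)

/-- If η = a dt + μ with μ ∈ 𝔪ⁿΩ, then applying `D` gives D(η) ≡ a modulo 𝔪ⁿ. Hence η - D(η) dt lies
in every 𝔪ⁿΩ and vanishes in the separated quotient. -/
theorem mk_eq_smul_of_mem_span {D : Derivation O R R} {t : R} (hD : D t = 1)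
    (ht : ∀ x : R, KaehlerDifferential.D O R x ∈
      (R ∙ KaehlerDifferential.D O R t) ⊔ maximalIdeal R • (⊤ : Submodule R (Ω[R⁄O])))
    (η : Ω[R⁄O]) :
    (Submodule.Quotient.mk η : SepDiff O R) = D.liftKaehlerDifferential η •
      (Submodule.Quotient.mk (KaehlerDifferential.D O R t) : SepDiff O R) := by
  rw [← Submodule.Quotient.mk_smul, Submodule.Quotient.eq, Submodule.mem_iInf]
  intro n
  have h1 : η ∈ (R ∙ KaehlerDifferential.D O R t) ⊔ maximalIdeal R ^ n • (⊤ : Submodule R (Ω[R⁄O])) := by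
    rw [sub_smul_mem_smul_top_of_mem_span ht n]; trivial
  obtain ⟨_, ha, μ, hμ, rfl⟩ := Submodule.mem_sup.mp h1
  obtain ⟨a, rfl⟩ := Submodule.mem_span_singleton.mp ha
  have h2 := liftKaehlerDifferential_mem_of_mem_smul_top D hμ
  rw [map_add, map_smul, Derivation.liftKaehlerDifferential_comp_D, hD, smul_eq_mul, mul_one,
    add_smul, add_sub_add_left_eq_sub]
  exact Submodule.sub_mem _ hμ (Submodule.smul_mem_smul h2 trivial)

/-- If `dt` generates the differentials modulo the maximal ideal, then it generates `Ω^cts`. -/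
theorem eq_ctsLift_smul_ctsD [IsNoetherianRing R] {D : Derivation O R R} {t : R} (hD : D t = 1)
    (ht : ∀ x : R, KaehlerDifferential.D O R x ∈
      (R ∙ KaehlerDifferential.D O R t) ⊔ maximalIdeal R • (⊤ : Submodule R (Ω[R⁄O])))
    (ω : CtsDiff O R F) : ω = ctsLift F D ω • ctsD O F t := by
  induction ω using TensorProduct.induction_on with
  | zero => simp only [map_zero, zero_smul]
  | add x y hx hy => rw [map_add, add_smul, ← hx, ← hy]
  | tmul f η =>
    obtain ⟨η, rfl⟩ := Submodule.Quotient.mk_surjective _ η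
    rw [ctsLift_tmul, mk_eq_smul_of_mem_span hD ht, ctsD, TensorProduct.smul_tmul', smul_eq_mul,
      mul_one, TensorProduct.tmul_smul, TensorProduct.smul_tmul', Algebra.smul_def, mul_comm]

end Differentials

/-! ### Passage from global to local differentials. -/

section Global

theorem toGlobalDiff_surjective (O B M : Type*) [CommRing O] [CommRing B] [IsLocalRing B]
    [Field M] [Algebra B M] [Algebra O B] : Function.Surjective (toGlobalDiff O B M) :=
  LinearMap.lTensor_surjective _ (Submodule.mkQ_surjective _)

variable {O B : Type*} (M : Type*) [CommRing O]
  [CommRing B] [IsDomain B] [IsLocalRing B] [IsNoetherianRing B] [IsIntegrallyClosed B]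
  [Field M] [Algebra B M] [IsFractionRing B M] [Algebra O B] [Algebra O M] [IsScalarTower O B M]
  (y : HeightOnePrime B)

/-- By linearity it is enough to compare exact differentials. The right side sees η only through its
class in `GlobalDiff`; this is why the residue does not depend on the lift of ω. -/
theorem ctsLift_toCtsDiff (D : Derivation O B B)
    (E : Derivation O (complRing M y) (complRing M y)) (e : complRing M y)
    (hE : ∀ b : B, E (algebraMap B (complRing M y) b) = algebraMap B (complRing M y) (D b) * e)
    (η : M ⊗[B] Ω[B⁄O]) :
    ctsLift (complField M y) E (toCtsDiff O B M y η) =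
      algebraMap M (complField M y) (ctsLift M D (toGlobalDiff O B M η)) * e := by
  have h1 : ∀ η : Ω[B⁄O], E.liftKaehlerDifferential (KaehlerDifferential.map O O B (complRing M y) η) =
      algebraMap B (complRing M y) (D.liftKaehlerDifferential η) * e := by
    intro η
    have : η ∈ Submodule.span B (Set.range (KaehlerDifferential.D O B)) := by
      rw [KaehlerDifferential.span_range_derivation]; trivial
    induction this using Submodule.span_induction with
    | mem x hx => 
      obtain ⟨b, rfl⟩ := hx
      rw [KaehlerDifferential.map_D, Derivation.liftKaehlerDifferential_comp_D,
        Derivation.liftKaehlerDifferential_comp_D, hE]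
    | zero => simp
    | add x y _ _ hx hy => simp only [map_add, hx, hy, add_mul]
    | smul a x _ hx =>
      rw [(KaehlerDifferential.map O O B (complRing M y)).map_smul,
        D.liftKaehlerDifferential.map_smul, ← algebraMap_smul (complRing M y) a
        (KaehlerDifferential.map O O B (complRing M y) x), LinearMap.map_smul, hx, smul_eq_mul,
        smul_eq_mul, map_mul, mul_assoc]
  induction η using TensorProduct.induction_on with
  | zero => simp
  | add x y hx hy => simp only [map_add, hx, hy, add_mul]
  | tmul m η =>
    have h2 : toCtsDiff O B M y (m ⊗ₜ η) = algebraMap M (complField M y) m ⊗ₜ[complRing M y]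
      (Submodule.Quotient.mk (KaehlerDifferential.map O O B (complRing M y) η) :
        SepDiff O (complRing M y)) := rfl
    have h3 : toGlobalDiff O B M (m ⊗ₜ η) = m ⊗ₜ (Submodule.Quotient.mk η : SepDiff O B) := rfl
    rw [h2, h3, ctsLift_tmul, ctsLift_tmul, h1, map_mul, map_mul, mul_assoc,
      ← IsScalarTower.algebraMap_apply, ← IsScalarTower.algebraMap_apply]
    rfl

end Global

end Reciprocity

namespace Reciprocity

/-! ### Differentiation and residues of Laurent series over a field. -/

section LaurentDerivation

variable {k : Type*} [Field k]

/-- The Euler operator `f ↦ t df/dt` on Laurent series. -/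
def laurentEuler (f : LaurentSeries k) : LaurentSeries k where
  coeff n := (n : k) * f.coeff n
  isPWO_support' := f.isPWO_support.mono fun n hn => by
    intro h
    exact hn (by simp [h])

@[simp]
theorem coeff_laurentEuler (f : LaurentSeries k) (n : ℤ) :
    (laurentEuler f).coeff n = n * f.coeff n := rfl

theorem support_laurentEuler_subset (f : LaurentSeries k) :
    (laurentEuler f).support ⊆ f.support := fun n hn h => hn (by simp [h])

theorem laurentEuler_mul (f g : LaurentSeries k) :
    laurentEuler (f * g) = f * laurentEuler g + g * laurentEuler f := by
  ext n
  rw [mul_comm g, HahnSeries.coeff_add, coeff_laurentEuler, HahnSeries.coeff_mul,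
    HahnSeries.coeff_mul_right' g.isPWO_support (support_laurentEuler_subset g),
    HahnSeries.coeff_mul_left' f.isPWO_support (support_laurentEuler_subset f),
    Finset.mul_sum, ← Finset.sum_add_distrib]
  refine Finset.sum_congr rfl fun ij hij => ?_
  rw [Finset.mem_antidiagonal] at hij
  rw [← hij.2.2, coeff_laurentEuler, coeff_laurentEuler]
  push_cast
  ring

theorem laurentEuler_add (f g : LaurentSeries k) :
    laurentEuler (f + g) = laurentEuler f + laurentEuler g := by
  ext n; simp [mul_add]

/-- The derivation `d/dt` of the field of Laurent series, as an additive map. -/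
noncomputable def laurentDerivative : LaurentSeries k →+ LaurentSeries k :=
  AddMonoidHom.mk' (fun f => HahnSeries.single (-1 : ℤ) (1 : k) * laurentEuler f) fun f g => by
    rw [laurentEuler_add, mul_add]

theorem laurentDerivative_mul (f g : LaurentSeries k) :
    laurentDerivative (f * g) = f * laurentDerivative g + g * laurentDerivative f := by
  change HahnSeries.single (-1 : ℤ) (1 : k) * laurentEuler (f * g) =
    f * (HahnSeries.single (-1 : ℤ) (1 : k) * laurentEuler g) +
    g * (HahnSeries.single (-1 : ℤ) (1 : k) * laurentEuler f)
  rw [laurentEuler_mul]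
  ring

theorem laurentDerivative_apply (f : LaurentSeries k) :
    laurentDerivative f = HahnSeries.single (-1 : ℤ) (1 : k) * laurentEuler f := rfl

@[simp]
theorem coeff_laurentDerivative (f : LaurentSeries k) (n : ℤ) :
    (laurentDerivative f).coeff n = (n + 1) * f.coeff (n + 1) := by
  have h := HahnSeries.coeff_single_mul_add (r := (1 : k)) (x := laurentEuler f) (a := n + 1)
    (b := (-1 : ℤ))
  rw [laurentDerivative_apply]
  simpa using h

theorem laurentDerivative_coe (f : PowerSeries k) :
    laurentDerivative (f : LaurentSeries k) = (PowerSeries.derivative k f : PowerSeries k) := by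
  ext n
  rw [coeff_laurentDerivative, PowerSeries.coeff_coe, PowerSeries.coeff_coe]
  rcases lt_trichotomy n (-1) with h | rfl | h
  · rw [if_pos (by omega), if_pos (by omega), mul_zero]
  · simp
  · rw [if_neg (by omega), if_neg (by omega)]
    obtain ⟨m, rfl⟩ := Int.eq_ofNat_of_zero_le (show 0 ≤ n by omega)
    rw [show ((m : ℤ) + 1).natAbs = m + 1 by omega, Int.natAbs_natCast]
    simp [PowerSeries.coeff_derivative, mul_comm]

theorem laurentDerivative_single_one :
    laurentDerivative (HahnSeries.single (1 : ℤ) (1 : k)) = 1 := by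
  rw [← PowerSeries.coe_X, laurentDerivative_coe]
  simp

theorem coeff_neg_one_coe (f : PowerSeries k) : (f : LaurentSeries k).coeff (-1) = 0 := by
  rw [PowerSeries.coeff_coe]; simp

theorem mem_range_coe_iff (f : LaurentSeries k) :
    (∃ g : PowerSeries k, (g : LaurentSeries k) = f) ↔ ∀ n : ℤ, n < 0 → f.coeff n = 0 := by
  constructor
  · rintro ⟨g, rfl⟩ n hn
    rw [PowerSeries.coeff_coe, if_pos hn]
  · intro h
    refine ⟨PowerSeries.mk fun n => f.coeff n, ?_⟩
    ext n
    rw [PowerSeries.coeff_coe]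
    split_ifs with hn
    · exact (h n hn).symm
    · rw [PowerSeries.coeff_mk]; congr 1; omega

/-- The residue of `a dq / q` for a uniformiser `q = X u`. -/
theorem coeff_neg_one_mul_dlog (a u : PowerSeries k) (hu : IsUnit u) :
    ((a : LaurentSeries k) * laurentDerivative ((PowerSeries.X * u : PowerSeries k) : LaurentSeries k)
      * ((PowerSeries.X * u : PowerSeries k) : LaurentSeries k)⁻¹).coeff (-1) =
      PowerSeries.constantCoeff a := by
  obtain ⟨w, hw⟩ := hu.exists_right_inv
  have hw' : (u : LaurentSeries k) * (w : LaurentSeries k) = 1 := by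
    rw [← PowerSeries.coe_mul, hw, PowerSeries.coe_one]
  have hu0 : (u : LaurentSeries k) ≠ 0 := left_ne_zero_of_mul_eq_one hw'
  have hX0 : (HahnSeries.single (1 : ℤ) (1 : k) : LaurentSeries k) ≠ 0 := by
    simp
  have hX : (HahnSeries.single (1 : ℤ) (1 : k) : LaurentSeries k)⁻¹ = HahnSeries.single (-1 : ℤ) 1 := by
    rw [HahnSeries.inv_single]; simp
  -- Logarithmic derivative of X u: it is X⁻¹ + u'/u, and u'/u is a power series because u is a
  -- unit.
  have h1 : (a : LaurentSeries k) * laurentDerivative ((PowerSeries.X * u : PowerSeries k) : LaurentSeries k)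
      * ((PowerSeries.X * u : PowerSeries k) : LaurentSeries k)⁻¹ =
      HahnSeries.single (-1 : ℤ) 1 * (a : LaurentSeries k) +
        ((a * w * PowerSeries.derivative k u : PowerSeries k) : LaurentSeries k) := by
    rw [← hX, PowerSeries.coe_mul, laurentDerivative_mul, PowerSeries.coe_X,
      laurentDerivative_single_one, laurentDerivative_coe, PowerSeries.coe_mul, PowerSeries.coe_mul,
      eq_inv_of_mul_eq_one_right hw']
    field_simp
    ring
  rw [h1, HahnSeries.coeff_add, coeff_neg_one_coe, add_zero]
  have h := HahnSeries.coeff_single_mul_add (r := (1 : k)) (x := (a : LaurentSeries k)) (a := 0)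
    (b := (-1 : ℤ))
  rw [zero_add, one_mul] at h
  rw [h, PowerSeries.coeff_coe]
  simp

end LaurentDerivation

end Reciprocity

/-! ### The derivation and the residue attached to a Laurent coordinate. -/

namespace Reciprocity

theorem exists_derivation_restrict {O R F : Type*} [CommRing O] [CommRing R] [CommRing F]
    [Algebra O R] [Algebra O F] [Algebra R F] [FaithfulSMul R F] [IsScalarTower O R F]
    (E : Derivation O F F) (hE : ∀ x : R, ∃ z : R, algebraMap R F z = E (algebraMap R F x)) :
    ∃ D : Derivation O R R, ∀ x, algebraMap R F (D x) = E (algebraMap R F x) := by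
  have hinj := FaithfulSMul.algebraMap_injective R F
  have key : ∀ (a : O) (x : R), algebraMap R F (a • x) = a • algebraMap R F x := fun a x => by
    rw [Algebra.smul_def, Algebra.smul_def, map_mul, ← IsScalarTower.algebraMap_apply]
  choose d hd using hE
  refine ⟨Derivation.mk' { toFun := d, map_add' := fun x y => hinj ?_, map_smul' := fun a x => hinj ?_ }
    fun x y => hinj ?_, hd⟩
  · rw [hd, map_add, map_add, map_add, hd, hd]
  · rw [hd, key, RingHom.id_apply, key, hd, E.map_smul]
  · simp only [LinearMap.coe_mk, AddHom.coe_mk, smul_eq_mul, map_add, map_mul, hd,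
      Derivation.leibniz]

theorem powerSeries_equiv_mem_maximalIdeal_iff {k R : Type*} [Field k] [CommRing R] [IsLocalRing R]
    (e : PowerSeries k ≃+* R) (g : PowerSeries k) :
    e g ∈ maximalIdeal R ↔ PowerSeries.constantCoeff g = 0 := by
  rw [mem_maximalIdeal, mem_nonunits_iff, MulEquiv.isUnit_map, PowerSeries.isUnit_iff_constantCoeff,
    isUnit_iff_ne_zero, not_not]

namespace LaurentCoordinate

variable {K R F : Type*} [Field K] [CommRing R] [Field F] [Algebra K F] [Algebra R F]
  (c : LaurentCoordinate K R F)

/-- The coefficient of `t⁻¹` of the expansion of an element of `F`. -/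
noncomputable def residue (f : F) : constField K F := (c.equiv.symm f).coeff (-1)

theorem residue_add (f g : F) : c.residue (f + g) = c.residue f + c.residue g := by
  simp [residue]

theorem residue_sub (f g : F) : c.residue (f - g) = c.residue f - c.residue g := by
  simp [residue]

theorem residue_algebraMap_mul (a : constField K F) (f : F) :
    c.residue (algebraMap _ F a * f) = a * c.residue f := by
  rw [residue, map_mul, AlgEquiv.commutes, LaurentSeries.algebraMap_apply,
    HahnSeries.C_mul_eq_smul, HahnSeries.coeff_smul, smul_eq_mul, residue]

/-- The derivation `d/dt`, as an additive map. -/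
noncomputable def deriv : F →+ F :=
  (c.equiv : LaurentSeries (constField K F) →+ F).comp
    (laurentDerivative.comp (c.equiv.symm : F →+ LaurentSeries (constField K F)))

theorem deriv_apply (f : F) : c.deriv f = c.equiv (laurentDerivative (c.equiv.symm f)) := rfl

theorem deriv_mul (f g : F) : c.deriv (f * g) = f * c.deriv g + g * c.deriv f := by
  simp [deriv_apply, laurentDerivative_mul]

theorem deriv_const (a : constField K F) : c.deriv (algebraMap _ F a) = 0 := by
  have : laurentDerivative (HahnSeries.C a : LaurentSeries (constField K F)) = 0 := by
    ext n
    rw [coeff_laurentDerivative]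
    by_cases h : n + 1 = 0
    · have h' : (n : constField K F) + 1 = 0 := by
        exact_mod_cast congrArg (Int.cast : ℤ → constField K F) h
      simp [h']
    · rw [HahnSeries.C_apply, HahnSeries.coeff_single_of_ne h]; simp
  rw [deriv_apply, AlgEquiv.commutes, LaurentSeries.algebraMap_apply, this, map_zero]

theorem residue_deriv (f : F) : c.residue (c.deriv f) = 0 := by
  simp [residue, deriv_apply]

theorem deriv_t : c.deriv (algebraMap R F c.t) = 1 := by
  rw [← c.equiv_variable, deriv_apply, AlgEquiv.symm_apply_apply, laurentDerivative_single_one,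
    map_one]

theorem exists_coe (x : R) : ∃ g : PowerSeries (constField K F),
    c.equiv (g : LaurentSeries (constField K F)) = algebraMap R F x := by
  obtain ⟨g, hg⟩ := (mem_range_coe_iff (c.equiv.symm (algebraMap R F x))).mpr
    ((c.mem_integers_iff _).mp ⟨x, by simp⟩)
  exact ⟨g, by rw [hg]; simp⟩

theorem exists_algebraMap (g : PowerSeries (constField K F)) :
    ∃ x : R, algebraMap R F x = c.equiv (g : LaurentSeries (constField K F)) :=
  (c.mem_integers_iff _).mpr ((mem_range_coe_iff _).mp ⟨g, rfl⟩)

theorem residue_algebraMap (x : R) : c.residue (algebraMap R F x) = 0 := by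
  obtain ⟨g, hg⟩ := c.exists_coe x
  rw [← hg, residue, AlgEquiv.symm_apply_apply, coeff_neg_one_coe]

theorem exists_deriv_eq (x : R) : ∃ z : R, algebraMap R F z = c.deriv (algebraMap R F x) := by
  obtain ⟨g, hg⟩ := c.exists_coe x
  rw [← hg, deriv_apply, AlgEquiv.symm_apply_apply, laurentDerivative_coe]
  exact (c.mem_integers_iff _).mpr ((mem_range_coe_iff _).mp ⟨_, rfl⟩)

theorem exists_algebraMap_eq_const (c : LaurentCoordinate K R F) (a : constField K F) : ∃ x : R, algebraMap R F x = algebraMap _ F a := by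
  obtain ⟨x, hx⟩ := c.exists_algebraMap (PowerSeries.C a)
  refine ⟨x, hx.trans ?_⟩
  rw [PowerSeries.coe_C, ← LaurentSeries.algebraMap_apply, AlgEquiv.commutes]

section Derivation

variable {O : Type*} [CommRing O] [Algebra O K] [Algebra O F] [IsScalarTower O K F]

/-- The derivation `d/dt` of the field `F`. -/
noncomputable def fieldDerivation (c : LaurentCoordinate K R F) : Derivation O F F :=
  Derivation.mk'
    { toFun := c.deriv
      map_add' := c.deriv.map_add
      map_smul' := fun a f => by
        have h : algebraMap O F a = algebraMap (constField K F) F (algebraMap K _ (algebraMap O K a)) := by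
          rw [← IsScalarTower.algebraMap_apply, ← IsScalarTower.algebraMap_apply]
        rw [Algebra.smul_def, deriv_mul, h, deriv_const, mul_zero, add_zero, ← h,
          RingHom.id_apply, Algebra.smul_def] }
    c.deriv_mul

theorem fieldDerivation_apply (f : F) : (c.fieldDerivation : Derivation O F F) f = c.deriv f := rfl

variable [Algebra O R] [IsScalarTower O R F] [FaithfulSMul R F]

/-- The derivation `d/dt` of the ring of integers `R`. -/
noncomputable def derivation (c : LaurentCoordinate K R F) : Derivation O R R :=
  (exists_derivation_restrict (c.fieldDerivation : Derivation O F F) c.exists_deriv_eq).choose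

theorem algebraMap_derivation (x : R) :
    algebraMap R F ((c.derivation : Derivation O R R) x) = c.deriv (algebraMap R F x) :=
  (exists_derivation_restrict (c.fieldDerivation : Derivation O F F) c.exists_deriv_eq).choose_spec x

theorem derivation_t : (c.derivation : Derivation O R R) c.t = 1 :=
  FaithfulSMul.algebraMap_injective R F (by rw [algebraMap_derivation, deriv_t, map_one])

end Derivation

section Uniformizer

variable [FaithfulSMul R F]

/-- The identification of `R` with the ring of power series. -/
theorem exists_ringEquiv : ∃ e : PowerSeries (constField K F) ≃+* R,
    (∀ g : PowerSeries (constField K F), algebraMap R F (e g) = c.equiv (g : LaurentSeries _)) ∧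
      e PowerSeries.X = c.t := by
  have hinj := FaithfulSMul.algebraMap_injective R F
  choose φ hφ using c.exists_algebraMap
  let e : PowerSeries (constField K F) →+* R :=
    { toFun := φ
      map_one' := hinj (by rw [hφ]; simp)
      map_mul' := fun x y => hinj (by rw [map_mul, hφ, hφ, hφ]; simp)
      map_zero' := hinj (by rw [hφ]; simp)
      map_add' := fun x y => hinj (by rw [map_add, hφ, hφ, hφ]; simp) }
  have he : Function.Bijective e := by
    constructor
    · intro x y hxy
      have h1 : c.equiv (x : LaurentSeries _) = c.equiv (y : LaurentSeries _) := by
        rw [← hφ, ← hφ]; exact congrArg _ hxy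
      exact HahnSeries.ofPowerSeries_injective (c.equiv.injective h1)
    · intro x
      obtain ⟨g, hg⟩ := c.exists_coe x
      exact ⟨g, hinj (by rw [← hg]; exact hφ g)⟩
  refine ⟨RingEquiv.ofBijective e he, hφ, hinj ?_⟩
  refine (hφ _).trans ?_
  rw [PowerSeries.coe_X, c.equiv_variable]

variable [IsLocalRing R]

theorem maximalIdeal_eq_span_t : maximalIdeal R = Ideal.span {c.t} := by
  obtain ⟨e, he, heX⟩ := c.exists_ringEquiv
  ext x
  obtain ⟨g, rfl⟩ := e.surjective x
  rw [powerSeries_equiv_mem_maximalIdeal_iff, ← PowerSeries.X_dvd_iff, Ideal.mem_span_singleton, ← heX,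
    map_dvd_iff]

variable [IsDomain R]

/-- The residue of `a dq / q`, for a uniformiser `q`, is the class of `a`. -/
theorem residue_mul_dlog {q : R} (hq : maximalIdeal R = Ideal.span {q}) (a r : R)
    (z : constField K F) (hz : algebraMap R F r = algebraMap _ F z) (har : a - r ∈ maximalIdeal R) :
    c.residue (algebraMap R F a * c.deriv (algebraMap R F q) * (algebraMap R F q)⁻¹) = z := by
  obtain ⟨e, he, heX⟩ := c.exists_ringEquiv
  have h1 : Associated c.t q := by
    rw [← Ideal.span_singleton_eq_span_singleton, ← hq, c.maximalIdeal_eq_span_t]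
  obtain ⟨u, hu⟩ := h1
  obtain ⟨a, rfl⟩ := e.surjective a
  obtain ⟨w, hw⟩ := e.surjective u
  obtain ⟨r, rfl⟩ := e.surjective r
  have hwu : IsUnit w := by
    rw [← MulEquiv.isUnit_map e, hw]; exact u.isUnit
  have hq' : q = e (PowerSeries.X * w) := by rw [map_mul, hw, heX, hu]
  have hr : r = PowerSeries.C z := by
    apply HahnSeries.ofPowerSeries_injective (Γ := ℤ)
    apply c.equiv.injective
    rw [← he, hz, PowerSeries.coe_C, ← LaurentSeries.algebraMap_apply, AlgEquiv.commutes]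
  rw [← map_sub, powerSeries_equiv_mem_maximalIdeal_iff, map_sub, sub_eq_zero, hr, PowerSeries.constantCoeff_C] at har
  rw [hq', he, he, deriv_apply, residue, map_mul, map_mul, map_inv₀, AlgEquiv.symm_apply_apply,
    AlgEquiv.symm_apply_apply, AlgEquiv.symm_apply_apply, coeff_neg_one_mul_dlog _ _ hwu, har]

end Uniformizer

end LaurentCoordinate
end Reciprocity

/-! ### Residue characteristic zero: independence of the coordinate. -/

namespace Reciprocity
namespace LaurentCoordinate

variable {O K R F : Type*} [CommRing O] [Field K] [CommRing R] [Field F] [Algebra K F] [Algebra R F]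
  [Algebra O K] [Algebra O R] [Algebra O F] [IsScalarTower O K F] [IsScalarTower O R F]
  [FaithfulSMul R F] 

/-- Scale the minimal polynomial of the constant into a polynomial P over O. By separability P'(a)
is a nonzero constant, hence a unit of R, so 0 = d(P(a)) = P'(a) da forces da = 0. -/
theorem kaehlerD_eq_zero_of_const [IsDomain O] [IsFractionRing O K] [CharZero K]
    (c : LaurentCoordinate K R F) {a : R} {z : constField K F}
    (haz : algebraMap R F a = algebraMap _ F z) : KaehlerDifferential.D O R a = 0 := by
  have hinj := FaithfulSMul.algebraMap_injective R F
  have hint : IsIntegral K z := Algebra.IsIntegral.isIntegral z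
  set P := IsLocalization.integerNormalization (nonZeroDivisors O) (minpoly K z) with hP
  obtain ⟨b, hb', hb⟩ := IsLocalization.integerNormalization_spec (nonZeroDivisors O) (minpoly K z)
  have hb0 : algebraMap O K b ≠ 0 := IsFractionRing.to_map_ne_zero_of_mem_nonZeroDivisors hb'
  have hbP : P.map (algebraMap O K) = Polynomial.C (algebraMap O K b) * minpoly K z := by
    rw [hP, hb, ← Polynomial.smul_eq_C_mul, algebraMap_smul]
  have heval : ∀ Q : Polynomial O, algebraMap R F (Polynomial.aeval a Q) =
      algebraMap _ F (Polynomial.aeval z (Q.map (algebraMap O K))) := fun Q => by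
    rw [← Polynomial.aeval_algebraMap_apply, haz, ← Polynomial.aeval_algebraMap_apply,
      Polynomial.aeval_map_algebraMap]
  have h0 : Polynomial.aeval a P = 0 := hinj (by
    rw [heval, hbP, map_mul, minpoly.aeval, mul_zero, map_zero, map_zero])
  have h1 : Polynomial.aeval z (P.derivative.map (algebraMap O K)) ≠ 0 := by
    rw [← Polynomial.derivative_map, hbP, Polynomial.derivative_C_mul, map_mul, Polynomial.aeval_C]
    refine mul_ne_zero (by simp [hb0]) ?_
    exact (Algebra.IsSeparable.isSeparable K z).aeval_derivative_ne_zero (minpoly.aeval K z)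
  obtain ⟨w, hw⟩ := c.exists_algebraMap_eq_const
    (Polynomial.aeval z (P.derivative.map (algebraMap O K)))⁻¹
  have h2 : w * Polynomial.aeval a P.derivative = 1 := hinj (by
    rw [map_mul, heval, hw, ← map_mul, inv_mul_cancel₀ h1, map_one, map_one])
  have h3 := Derivation.map_aeval (KaehlerDifferential.D O R) P a
  rw [h0, map_zero] at h3
  rw [← one_smul R (KaehlerDifferential.D O R a), ← h2, mul_smul, ← h3, smul_zero]

/-- Up to a constant, whose differential vanishes, an element has the form t h, and d(t h) = h dt +
t dh with t in the maximal ideal. -/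
theorem kaehlerD_mem_span_sup [IsDomain O] [IsFractionRing O K] [CharZero K] [IsLocalRing R]
    (c : LaurentCoordinate K R F) (x : R) :
    KaehlerDifferential.D O R x ∈
      (R ∙ KaehlerDifferential.D O R c.t) ⊔ maximalIdeal R • (⊤ : Submodule R (Ω[R⁄O])) := by
  have hinj := FaithfulSMul.algebraMap_injective R F
  obtain ⟨e, he, heX⟩ := c.exists_ringEquiv
  obtain ⟨g, rfl⟩ := e.surjective x
  obtain ⟨h, hh⟩ : PowerSeries.X ∣ g - PowerSeries.C (PowerSeries.constantCoeff g) := by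
    rw [PowerSeries.X_dvd_iff]; simp
  have h1 : e g = e (PowerSeries.C (PowerSeries.constantCoeff g)) + c.t * e h := by
    rw [← heX, ← map_mul, ← hh, ← map_add]; congr 1; ring
  have h2 : algebraMap R F (e (PowerSeries.C (PowerSeries.constantCoeff g))) =
      algebraMap _ F (PowerSeries.constantCoeff g) := by
    rw [he, PowerSeries.coe_C, ← LaurentSeries.algebraMap_apply, AlgEquiv.commutes]
  rw [h1, map_add, c.kaehlerD_eq_zero_of_const h2, zero_add, Derivation.leibniz, add_comm]
  refine Submodule.add_mem_sup (Submodule.smul_mem _ _ (Submodule.mem_span_singleton_self _))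
    (Submodule.smul_mem_smul ?_ trivial)
  rw [c.maximalIdeal_eq_span_t]
  exact Ideal.mem_span_singleton_self _

section Unique

variable [IsDomain O] [IsFractionRing O K] [CharZero K] [IsDomain R] [IsLocalRing R]
  [IsNoetherianRing R] [IsFractionRing R F]

theorem eq_smul_ctsD (c : LaurentCoordinate K R F) (ω : CtsDiff O R F) :
    ω = ctsLift F c.derivation ω • ctsD O F c.t :=
  eq_ctsLift_smul_ctsD F c.derivation_t c.kaehlerD_mem_span_sup ω

/-- The chain rule holds because dx = (dx/dt) dt already in Ω^cts, through which the other
derivation factors. No continuity of the change of coordinate has to be assumed. -/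
theorem derivation_eq_mul (c c' : LaurentCoordinate K R F) (x : R) :
    (c'.derivation : Derivation O R R) x =
      (c.derivation : Derivation O R R) x * (c'.derivation : Derivation O R R) c.t := by
  apply FaithfulSMul.algebraMap_injective R F
  have h := congrArg (ctsLift F c'.derivation) (c.eq_smul_ctsD (ctsD O F x))
  rwa [map_smul, ctsLift_ctsD, ctsLift_ctsD, ctsLift_ctsD, smul_eq_mul, ← map_mul] at h

/-- Induction on the order of the pole. Exactness of d(h q⁻ⁿ) gives n · res(h q⁻ⁿ⁻¹ dq) = res(q⁻ⁿ
dh) in either coordinate, and characteristic zero allows division by n. The induction ends at simple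
poles, which are logarithmic differentials. -/
theorem residue_mul_deriv_t_aux (c c' : LaurentCoordinate K R F) (O : Type*) [CommRing O]
    [IsDomain O] [Algebra O K] [Algebra O R] [Algebra O F] [IsScalarTower O K F]
    [IsScalarTower O R F] [IsFractionRing O K] (n : ℕ) (h : R) :
    c'.residue (algebraMap R F h * (algebraMap R F c.t)⁻¹ ^ n * c'.deriv (algebraMap R F c.t)) =
      c.residue (algebraMap R F h * (algebraMap R F c.t)⁻¹ ^ n) := by
  set q := algebraMap R F c.t with hq
  have hq0 : q ≠ 0 := by
    intro h0
    have := c.deriv_t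
    rw [← hq, h0, map_zero] at this
    exact zero_ne_one this
  have hderiv : ∀ h : R, c'.deriv (algebraMap R F h) = c.deriv (algebraMap R F h) * c'.deriv q := by
    intro h
    rw [← algebraMap_derivation (O := O), ← algebraMap_derivation (O := O),
      ← algebraMap_derivation (O := O), ← map_mul, derivation_eq_mul c c']
  induction n generalizing h with
  | zero =>
    rw [pow_zero, mul_one, residue_algebraMap, hq, ← algebraMap_derivation (O := O), ← map_mul,
      residue_algebraMap]
  | succ n ih =>
    rcases Nat.eq_zero_or_pos n with rfl | hn
    -- Simple pole: `q` is a uniformizer for both coordinates, so both residues equal the constant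
    -- to which `h` is congruent.
    · obtain ⟨e, he, heX⟩ := c.exists_ringEquiv
      obtain ⟨g, rfl⟩ := e.surjective h
      set r := e (PowerSeries.C (PowerSeries.constantCoeff g)) with hr
      have h2 : algebraMap R F r = algebraMap _ F (PowerSeries.constantCoeff g) := by
        rw [he, PowerSeries.coe_C, ← LaurentSeries.algebraMap_apply, AlgEquiv.commutes]
      have h3 : e g - r ∈ maximalIdeal R := by
        rw [hr, ← map_sub, powerSeries_equiv_mem_maximalIdeal_iff]; simp
      have h4 := c.residue_mul_dlog c.maximalIdeal_eq_span_t (e g) r _ h2 h3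
      have h5 := c'.residue_mul_dlog c.maximalIdeal_eq_span_t (e g) r _ h2 h3
      rw [deriv_t, mul_one] at h4
      rw [zero_add, pow_one, h4, ← h5]
      congr 1
      ring
    · have hn' : (n : constField K F) ≠ 0 := Nat.cast_ne_zero.mpr hn.ne'
      -- exactness of `d (h / q ^ n)`
      have key : ∀ c'' : LaurentCoordinate K R F,
          (n : constField K F) * c''.residue (algebraMap R F h * q⁻¹ ^ (n + 1) * c''.deriv q) =
            c''.residue (c''.deriv (algebraMap R F h) * q⁻¹ ^ n) := by
        intro c''
        have e1 : c''.deriv (algebraMap R F h * q⁻¹ ^ n) =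
            c''.deriv (algebraMap R F h) * q⁻¹ ^ n - algebraMap _ F (n : constField K F) *
              (algebraMap R F h * q⁻¹ ^ (n + 1) * c''.deriv q) := by
          have := (c''.fieldDerivation : Derivation O F F).leibniz_pow q⁻¹ n
          rw [Derivation.leibniz_inv, fieldDerivation_apply, fieldDerivation_apply] at this
          rw [deriv_mul, this]
          obtain ⟨m, rfl⟩ := Nat.exists_eq_add_of_le' hn
          simp only [nsmul_eq_mul, smul_eq_mul, map_natCast, Nat.add_sub_cancel]
          ring
        have e2 := c''.residue_deriv (algebraMap R F h * q⁻¹ ^ n)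
        rw [e1, residue_sub, residue_algebraMap_mul, sub_eq_zero] at e2
        exact e2.symm
      apply mul_left_cancel₀ hn'
      have k1 := key c
      rw [hq, deriv_t, mul_one, ← hq] at k1
      rw [key c', k1, hderiv, mul_right_comm, ← algebraMap_derivation (O := O), ih]

theorem residue_mul_deriv_t (c c' : LaurentCoordinate K R F) (O : Type*) [CommRing O]
    [IsDomain O] [Algebra O K] [Algebra O R] [Algebra O F] [IsScalarTower O K F]
    [IsScalarTower O R F] [IsFractionRing O K] [IsPrincipalIdealRing R] (f : F) :
    c'.residue (f * c'.deriv (algebraMap R F c.t)) = c.residue f := by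
  obtain ⟨x, y, hy, rfl⟩ := IsFractionRing.div_surjective R f
  obtain ⟨e, he, heX⟩ := c.exists_ringEquiv
  obtain ⟨g, rfl⟩ := e.surjective y
  have hg0 : g ≠ 0 := by
    rintro rfl
    exact nonZeroDivisors.ne_zero hy (map_zero e)
  obtain ⟨n, w, hw, rfl⟩ : ∃ (n : ℕ) (w : PowerSeries (constField K F)),
      IsUnit w ∧ g = w * PowerSeries.X ^ n :=
    ⟨g.order.toNat, g.divXPowOrder, PowerSeries.isUnit_divided_by_X_pow_order hg0, by
      rw [mul_comm, PowerSeries.X_pow_order_mul_divXPowOrder]⟩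
  obtain ⟨u, rfl⟩ := hw
  have h1 : algebraMap R F x / algebraMap R F (e ((u : PowerSeries (constField K F)) * PowerSeries.X ^ n)) =
      algebraMap R F (x * e (↑u⁻¹ : PowerSeries (constField K F))) * (algebraMap R F c.t)⁻¹ ^ n := by
    have hu : algebraMap R F (e (↑u⁻¹ : PowerSeries (constField K F))) * algebraMap R F (e (u : PowerSeries (constField K F))) = 1 := by
      rw [← map_mul, ← map_mul, Units.inv_mul, map_one, map_one]
    rw [map_mul, map_mul, map_pow, map_pow, heX, map_mul, eq_inv_of_mul_eq_one_left hu, div_eq_mul_inv,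
      mul_inv, inv_pow]
    ring
  rw [h1, residue_mul_deriv_t_aux c c' O]

/-- In equal characteristic zero, the residue does not depend on the coordinate. -/
theorem isLocalResidue_iff [IsPrincipalIdealRing R] (c : LaurentCoordinate K R F)
    [CharZero (ResidueField R)] (ω : CtsDiff O R F) (r : constField K F) :
    IsLocalResidue O K R F ω r ↔ r = c.residue (ctsLift F c.derivation ω) := by
  constructor
  · rintro (⟨-, c', f, rfl, rfl⟩ | ⟨h, -⟩)
    swap
    · exact absurd ‹CharZero (ResidueField R)› h
    -- Rewrite f dt' as a multiple of dt; applying d/dt' to both sides expresses f in terms of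
    -- dt/dt'.
    · have h1 := c.eq_smul_ctsD (f • ctsD O F c'.t)
      have h2 := congrArg (ctsLift F c'.derivation) h1
      rw [map_smul, map_smul, ctsLift_ctsD, ctsLift_ctsD, derivation_t, map_one, smul_eq_mul,
        mul_one, smul_eq_mul, algebraMap_derivation] at h2
      exact (congrArg c'.residue h2).trans (residue_mul_deriv_t c c' O _)
  · rintro rfl
    exact Or.inl ⟨inferInstance, c, _, c.eq_smul_ctsD ω, rfl⟩

end Unique

end LaurentCoordinate
end Reciprocity

namespace Reciprocity

/-! ### Evaluation of power series in complete rings, and coefficient fields. -/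

section Evaluation

variable {A R : Type*} [CommRing A] [CommRing R] (j : A →+* R) {I : Ideal R} {q : R} (hq : q ∈ I)

theorem mk_eval₂_trunc_mul (hq : q ∈ I) (n : ℕ) (f g : PowerSeries A) :
    Ideal.Quotient.mk (I ^ n) ((PowerSeries.trunc n (f * g)).eval₂ j q) =
      Ideal.Quotient.mk (I ^ n) ((PowerSeries.trunc n f).eval₂ j q) *
        Ideal.Quotient.mk (I ^ n) ((PowerSeries.trunc n g).eval₂ j q) := by
  rw [← map_mul, ← Polynomial.eval₂_mul, Ideal.Quotient.eq, ← Polynomial.eval₂_sub]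
  have h : Polynomial.X ^ n ∣ PowerSeries.trunc n (f * g) - PowerSeries.trunc n f * PowerSeries.trunc n g := by
    rw [Polynomial.X_pow_dvd_iff]
    intro d hd
    rw [← PowerSeries.trunc_trunc_mul_trunc, Polynomial.coeff_sub, PowerSeries.coeff_trunc, if_pos hd,
      ← Polynomial.coe_mul, Polynomial.coeff_coe, sub_self]
  obtain ⟨p, hp⟩ := h
  rw [hp, Polynomial.eval₂_mul, Polynomial.eval₂_X_pow]
  exact Ideal.mul_mem_right _ _ (Ideal.pow_mem_pow hq n)

theorem mk_eval₂_trunc_trunc (hq : q ∈ I) {m n : ℕ} (hmn : m ≤ n) (f : PowerSeries A) :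
    Ideal.Quotient.mk (I ^ m) ((PowerSeries.trunc n f).eval₂ j q) =
      Ideal.Quotient.mk (I ^ m) ((PowerSeries.trunc m f).eval₂ j q) := by
  rw [Ideal.Quotient.eq, ← Polynomial.eval₂_sub]
  have h : Polynomial.X ^ m ∣ PowerSeries.trunc n f - PowerSeries.trunc m f := by
    rw [Polynomial.X_pow_dvd_iff]
    intro d hd
    rw [Polynomial.coeff_sub, PowerSeries.coeff_trunc, PowerSeries.coeff_trunc, if_pos hd,
      if_pos (hd.trans_le hmn), sub_self]
  obtain ⟨p, hp⟩ := h
  rw [hp, Polynomial.eval₂_mul, Polynomial.eval₂_X_pow]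
  exact Ideal.mul_mem_right _ _ (Ideal.pow_mem_pow hq m)

/-- Power series may be evaluated at elements of `I` in an `I`-adically complete ring. -/
theorem exists_powerSeries_eval [IsAdicComplete I R] (hq : q ∈ I) :
    ∃ ev : PowerSeries A →+* R, ∀ f n, ev f - (PowerSeries.trunc n f).eval₂ j q ∈ I ^ n := by
  let φ : (n : ℕ) → PowerSeries A →+* R ⧸ I ^ n := fun n =>
    { toFun f := Ideal.Quotient.mk (I ^ n) ((PowerSeries.trunc n f).eval₂ j q)
      map_one' := by
        rcases n with _ | n
        · refine (Ideal.Quotient.eq (y := 1)).mpr ?_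
          rw [pow_zero, Ideal.one_eq_top]; trivial
        · rw [PowerSeries.trunc_one, Polynomial.eval₂_one, map_one]
      map_mul' := mk_eval₂_trunc_mul j hq n
      map_zero' := by rw [map_zero, Polynomial.eval₂_zero, map_zero]
      map_add' f g := by rw [map_add, Polynomial.eval₂_add, map_add] }
  have hφ : ∀ {m n : ℕ} (hle : m ≤ n), (Ideal.Quotient.factorPow I hle).comp (φ n) = φ m := by
    intro m n hle
    ext1 f
    exact mk_eval₂_trunc_trunc j hq hle f
  refine ⟨IsAdicComplete.liftRingHom I φ hφ, fun f n => ?_⟩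
  rw [← Ideal.Quotient.eq, IsAdicComplete.mk_liftRingHom]
  rfl

theorem eq_of_forall_sub_mem_pow [IsHausdorff I R] {x y : R} (h : ∀ n, x - y ∈ I ^ n) : x = y := by
  rw [← sub_eq_zero]
  refine IsHausdorff.haus ‹IsHausdorff I R› _ fun n => ?_
  rw [SModEq.zero, smul_eq_mul, Ideal.mul_top]
  exact h n

/-- A complete discrete valuation ring with a coefficient field is a power series ring. -/
theorem exists_powerSeries_equiv {k : Type*} [Field k] [IsDomain R] [IsLocalRing R]
    [IsAdicComplete (maximalIdeal R) R] (j : k →+* R)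
    (hj : ∀ x : R, ∃ a : k, x - j a ∈ maximalIdeal R) {q : R} (hq : maximalIdeal R = Ideal.span {q})
    (hq0 : q ≠ 0) :
    ∃ e : PowerSeries k ≃+* R, e PowerSeries.X = q ∧ ∀ a, e (PowerSeries.C a) = j a := by
  have hqm : q ∈ maximalIdeal R := hq ▸ Ideal.mem_span_singleton_self q
  obtain ⟨ev, hev⟩ := exists_powerSeries_eval j hqm
  have hX : ev PowerSeries.X = q := by
    refine eq_of_forall_sub_mem_pow (I := maximalIdeal R) fun n => ?_
    -- The truncation of X equals X only from length 2 on, so precision n + 2 is used; likewise n +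
    -- 1 for constants below.
    refine Ideal.pow_le_pow_right (Nat.le_add_right n 2) ?_
    have := hev PowerSeries.X (n + 2)
    rwa [PowerSeries.trunc_X, Polynomial.eval₂_X] at this
  have hC : ∀ a, ev (PowerSeries.C a) = j a := by
    intro a
    refine eq_of_forall_sub_mem_pow (I := maximalIdeal R) fun n => ?_
    refine Ideal.pow_le_pow_right (Nat.le_add_right n 1) ?_
    have := hev (PowerSeries.C a) (n + 1)
    rwa [PowerSeries.trunc_C, Polynomial.eval₂_C] at this
  refine ⟨RingEquiv.ofBijective ev ⟨?_, ?_⟩, hX, hC⟩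
  · rw [injective_iff_map_eq_zero]
    intro f hf
    by_contra hf0
    have h1 : f = PowerSeries.X ^ f.order.toNat * f.divXPowOrder :=
      PowerSeries.X_pow_order_mul_divXPowOrder.symm
    have h2 := (PowerSeries.isUnit_divided_by_X_pow_order hf0).map ev
    rw [h1, map_mul, map_pow, hX] at hf
    exact mul_ne_zero (pow_ne_zero _ hq0) h2.ne_zero hf
  · intro x
    choose a ha using hj
    have hd : ∀ x, ∃ z, x - j (a x) = q * z := fun x => by
      have := ha x
      rwa [hq, Ideal.mem_span_singleton] at this
    choose d hd using hd
    -- The q-adic expansion of x: `s n` is the quotient left after n digits, and `a (s n)` is the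
    -- n-th digit.
    let s : ℕ → R := fun n => d^[n] x
    have hs : ∀ n, s n = j (a (s n)) + q * s (n + 1) := fun n => by
      simp only [s, Function.iterate_succ_apply']
      rw [← hd]; ring
    refine ⟨PowerSeries.mk fun n => a (s n), ?_⟩
    refine eq_of_forall_sub_mem_pow (I := maximalIdeal R) fun n => ?_
    have h2 : ∀ n, x = (PowerSeries.trunc n (PowerSeries.mk fun n => a (s n))).eval₂ j q + q ^ n * s n := by
      intro n
      induction n with
      | zero => simp [s]
      | succ n ih =>
        rw [PowerSeries.trunc_succ, Polynomial.eval₂_add, Polynomial.eval₂_monomial,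
          PowerSeries.coeff_mk]
        conv_lhs => rw [ih, hs n]
        ring
    have h3 := hev (PowerSeries.mk fun n => a (s n)) n
    have h4 : q ^ n * s n ∈ maximalIdeal R ^ n := Ideal.mul_mem_right _ _ (Ideal.pow_mem_pow hqm n)
    have h5 := Ideal.sub_mem _ h3 h4
    rwa [sub_sub, ← h2 n] at h5

end Evaluation

/-! ### Existence of Laurent coordinates. -/

section Existence

variable {K R F : Type*} [Field K] [CharZero K] [CommRing R] [IsDomain R] [IsLocalRing R]
  [IsAdicComplete (maximalIdeal R) R] [Field F] [Algebra K R] [Algebra K F] [Algebra R F]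
  [IsFractionRing R F] [IsScalarTower K R F] [Algebra.IsAlgebraic K (ResidueField R)]

/-- In characteristic zero the minimal polynomial of the residue class is separable, so Hensel's
lemma lifts the class to a root in R, which is integral over K. -/
theorem exists_sub_mem_of_isAlgebraic (x : R) :
    ∃ a : R, IsIntegral K a ∧ x - a ∈ maximalIdeal R := by
  have hint : IsIntegral K (residue R x) := (Algebra.IsAlgebraic.isAlgebraic _).isIntegral
  set p := minpoly K (residue R x) with hp
  have h1 : (p.map (algebraMap K R)).eval x ∈ maximalIdeal R := by
    rw [← residue_eq_zero_iff, ← Polynomial.eval_map_apply, Polynomial.map_map]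
    have := minpoly.aeval K (residue R x)
    rwa [Polynomial.aeval_def, Polynomial.eval₂_eq_eval_map] at this
  have h2 : IsUnit ((p.map (algebraMap K R)).derivative.eval x) := by
    rw [← residue_ne_zero_iff_isUnit, ← Polynomial.eval_map_apply, Polynomial.derivative_map, Polynomial.map_map]
    have := (Algebra.IsSeparable.isSeparable K (residue R x)).aeval_derivative_ne_zero 
      (minpoly.aeval K (residue R x))
    rwa [Polynomial.aeval_def, Polynomial.eval₂_eq_eval_map] at this
  obtain ⟨a, ha, hax⟩ := HenselianRing.is_henselian (I := maximalIdeal R)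
    (p.map (algebraMap K R)) ((minpoly.monic hint).map _) x h1 (h2.map _)
  refine ⟨a, ⟨p, minpoly.monic hint, ?_⟩, ?_⟩
  · rwa [Polynomial.eval₂_eq_eval_map]
  · rw [← neg_sub]; exact neg_mem hax

/-- Cohen structure theorem in residue characteristic zero, with a prescribed uniformiser. -/
theorem exists_laurentCoordinate [IsIntegrallyClosed R] {q : R} (hq : maximalIdeal R = Ideal.span {q})
    (hq0 : q ≠ 0) : ∃ c : LaurentCoordinate K R F, c.t = q := by
  have hinj := FaithfulSMul.algebraMap_injective R F
  -- An element algebraic over the field K ⊆ R is integral over R, hence lies in R.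
  have hk : ∀ a : constField K F, ∃ r : R, algebraMap R F r = algebraMap _ F a := by
    intro a
    have h1 : IsIntegral K (algebraMap (constField K F) F a) :=
      (Algebra.IsIntegral.isIntegral a).algebraMap
    exact IsIntegrallyClosed.isIntegral_iff.mp h1.tower_top
  choose φ hφ using hk
  let j : constField K F →+* R :=
    { toFun := φ
      map_one' := hinj (by rw [hφ, map_one, map_one])
      map_mul' := fun x y => hinj (by rw [map_mul, hφ, hφ, hφ, map_mul])
      map_zero' := hinj (by rw [hφ, map_zero, map_zero])
      map_add' := fun x y => hinj (by rw [map_add, hφ, hφ, hφ, map_add]) }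
  have hj : ∀ x : R, ∃ a : constField K F, x - j a ∈ maximalIdeal R := by
    intro x
    obtain ⟨a, ha, hax⟩ := exists_sub_mem_of_isAlgebraic (K := K) x
    have ha' : algebraMap R F a ∈ constField K F :=
      mem_algebraicClosure_iff.mpr (ha.algebraMap (B := F)).isAlgebraic
    refine ⟨⟨_, ha'⟩, ?_⟩
    have : j ⟨_, ha'⟩ = a := hinj (hφ _)
    rwa [this]
  obtain ⟨e, heX, heC⟩ := exists_powerSeries_equiv j hj hq hq0
  let E : LaurentSeries (constField K F) ≃+* F := IsFractionRing.ringEquivOfRingEquiv e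
  have hE : ∀ g : PowerSeries (constField K F), E (g : LaurentSeries _) = algebraMap R F (e g) :=
    fun g => IsFractionRing.ringEquivOfRingEquiv_algebraMap e g
  refine ⟨{ equiv := AlgEquiv.ofRingEquiv (f := E) ?_, mem_integers_iff := ?_, t := q,
            equiv_variable := ?_ }, rfl⟩
  · intro a
    rw [LaurentSeries.algebraMap_apply, ← PowerSeries.coe_C, hE, heC]
    exact hφ a
  · intro f
    rw [← mem_range_coe_iff]
    change (∃ x, algebraMap R F x = E f) ↔ _
    constructor
    · rintro ⟨x, hx⟩
      refine ⟨e.symm x, E.injective ?_⟩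
      rw [hE, ← hx, RingEquiv.apply_symm_apply]
    · rintro ⟨g, rfl⟩
      exact ⟨_, (hE g).symm⟩
  · rw [← PowerSeries.coe_X]
    exact (hE _).trans (by rw [heX])

end Existence

end Reciprocity

/-! ### Mixed characteristic: integral double series and their filtration. -/

namespace Reciprocity

/-- The integral form of `DoubleCoordinate`: an isomorphism of `R` with the ring of double series
`∑ a_i t^i` with coefficients in `O` such that `a_i → 0` as `i → -∞`. -/
structure DoubleExpansion (O R : Type*) [CommRing O] [IsLocalRing O] [CommRing R] [Algebra O R] where
  coeff : R →ₗ[O] (ℤ → O)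
  injective : Function.Injective coeff
  eventually_mem : ∀ (x : R) (n : ℕ), ∀ᶠ i in Filter.atBot, coeff x i ∈ maximalIdeal O ^ n
  exists_coeff_eq : ∀ a : ℤ → O, (∀ n : ℕ, ∀ᶠ i in Filter.atBot, a i ∈ maximalIdeal O ^ n) →
    ∃ x, coeff x = a
  coeff_mul : ∀ (x y : R) (i : ℤ) (n : ℕ), ∃ S : Finset ℤ, ∀ S' : Finset ℤ, S ⊆ S' →
    (∑ r ∈ S', coeff x r * coeff y (i - r)) - coeff (x * y) i ∈ maximalIdeal O ^ n
  t : R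
  coeff_t : coeff t = Pi.single (1 : ℤ) 1

namespace DoubleExpansion

variable {O R : Type*} [CommRing O] [IsLocalRing O] [CommRing R] [Algebra O R]
  (E : DoubleExpansion O R)

theorem coeff_mul_mem {x y : R} {i : ℤ} {n : ℕ}
    (h : ∀ r, E.coeff x r * E.coeff y (i - r) ∈ maximalIdeal O ^ n) :
    E.coeff (x * y) i ∈ maximalIdeal O ^ n := by
  obtain ⟨S, hS⟩ := E.coeff_mul x y i n
  have h1 := Ideal.sub_mem _ (Ideal.sum_mem _ fun r (_ : r ∈ S) => h r) (hS S le_rfl)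
  rwa [sub_sub_cancel] at h1

/-- The elements all of whose coefficients of index less than `m` are divisible by `π ^ n`. -/
def fil (m : ℤ) (n : ℕ) : Submodule O R where
  carrier := {x | ∀ i < m, E.coeff x i ∈ maximalIdeal O ^ n}
  add_mem' hx hy i hi := by
    rw [map_add]; exact Ideal.add_mem _ (hx i hi) (hy i hi)
  zero_mem' i _ := by rw [map_zero]; exact zero_mem _
  smul_mem' a x hx i hi := by
    rw [map_smul]; exact Ideal.mul_mem_left _ _ (hx i hi)

theorem mul_mem_fil {m m' : ℤ} {n : ℕ} {x y : R} (hx : x ∈ E.fil m n) (hy : y ∈ E.fil m' n) :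
    x * y ∈ E.fil (m + m') n := by
  intro i hi
  refine E.coeff_mul_mem fun r => ?_
  rcases lt_or_ge r m with hr | hr
  · exact Ideal.mul_mem_right _ _ (hx r hr)
  · exact Ideal.mul_mem_left _ _ (hy _ (by omega))

theorem fil_anti {m m' : ℤ} {n n' : ℕ} (hm : m' ≤ m) (hn : n' ≤ n) : E.fil m n ≤ E.fil m' n' :=
  fun _ hx i hi => Ideal.pow_le_pow_right hn (hx i (hi.trans_le hm))

theorem exists_mem_fil (x : R) (n : ℕ) : ∃ m : ℕ, x ∈ E.fil (-m) n := by
  obtain ⟨b, hb⟩ := Filter.eventually_atBot.mp (E.eventually_mem x n)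
  exact ⟨b.natAbs, fun i hi => hb i (by omega)⟩

section Hausdorff

variable [IsHausdorff (maximalIdeal O) O]

/-- The product formula only asserts convergence; when the terms vanish outside a finite set, the
partial sums are stationary and the limit is a finite sum. -/
theorem coeff_mul_eq_sum {x y : R} {i : ℤ} (S : Finset ℤ)
    (h : ∀ r ∉ S, E.coeff x r * E.coeff y (i - r) = 0) :
    E.coeff (x * y) i = ∑ r ∈ S, E.coeff x r * E.coeff y (i - r) := by
  classical
  refine eq_of_forall_sub_mem_pow (I := maximalIdeal O) fun n => ?_
  obtain ⟨T, hT⟩ := E.coeff_mul x y i n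
  have h1 := hT (T ∪ S) Finset.subset_union_left
  rw [← Finset.sum_subset (Finset.subset_union_right : S ⊆ T ∪ S) (fun r _ hr => h r hr)] at h1
  rw [← neg_sub]
  exact neg_mem h1

theorem coeff_t_mul (x : R) (i : ℤ) : E.coeff (E.t * x) i = E.coeff x (i - 1) := by
  rw [E.coeff_mul_eq_sum {1}]
  · simp [E.coeff_t]
  · intro r hr
    rw [E.coeff_t, Pi.single_eq_of_ne (by simpa using hr), zero_mul]

/-- The structure does not prescribe the expansion of 1; it is recovered from t * 1 = t. -/
theorem coeff_one : E.coeff 1 = Pi.single (0 : ℤ) 1 := by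
  ext i
  have h := E.coeff_t_mul 1 (i + 1)
  rw [mul_one, E.coeff_t, add_sub_cancel_right] at h
  rw [← h, Pi.single_apply, Pi.single_apply]
  simp

theorem exists_inv_t : ∃ s : R, E.t * s = 1 := by
  obtain ⟨s, hs⟩ := E.exists_coeff_eq (Pi.single (-1 : ℤ) 1) fun n => by
    filter_upwards [Filter.eventually_lt_atBot (-1 : ℤ)] with i hi
    rw [Pi.single_eq_of_ne hi.ne]; exact zero_mem _
  refine ⟨s, E.injective ?_⟩
  ext i
  rw [coeff_t_mul, coeff_one, hs, Pi.single_apply, Pi.single_apply]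
  congr 1
  simp only [eq_iff_iff]; omega

/-- The variable as a unit of `R`. -/
noncomputable def unitT : Rˣ := Units.mkOfMulEqOne E.t _ E.exists_inv_t.choose_spec

@[simp]
theorem coe_unitT : (E.unitT : R) = E.t := rfl

theorem coeff_unitT_zpow_mul (n : ℤ) (x : R) (i : ℤ) :
    E.coeff ((E.unitT ^ n : Rˣ) * x) i = E.coeff x (i - n) := by
  induction n generalizing i with
  | zero => simp
  | succ n ih =>
    rw [zpow_add_one, mul_comm (E.unitT ^ (n : ℤ)), Units.val_mul, mul_assoc, coe_unitT,
      coeff_t_mul, ih]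
    ring_nf
  | pred n ih =>
    have h := E.coeff_t_mul ((E.unitT ^ (-(n : ℤ) - 1) : Rˣ) * x) (i + 1)
    rw [← coe_unitT, ← mul_assoc, ← Units.val_mul, ← zpow_one_add, add_sub_cancel_right] at h
    rw [← h]
    rw [show 1 + (-(n : ℤ) - 1) = -n by ring, ih]
    ring_nf

theorem coeff_unitT_zpow (n : ℤ) : E.coeff (E.unitT ^ n : Rˣ) = Pi.single n 1 := by
  ext i
  have h := E.coeff_unitT_zpow_mul n 1 i
  rw [mul_one] at h
  rw [h, coeff_one, Pi.single_apply, Pi.single_apply]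
  congr 1
  simp only [eq_iff_iff]; omega

theorem coeff_t_pow_mul (n : ℕ) (x : R) (i : ℤ) :
    E.coeff (E.t ^ n * x) i = E.coeff x (i - n) := by
  rw [← E.coeff_unitT_zpow_mul n x i]; simp

/-- The inclusion `O⟦X⟧ → R` with `X ↦ t`. -/
theorem exists_ofPowerSeries : ∃ ι : PowerSeries O →+* R, ∀ f i,
    E.coeff (ι f) i = if i < 0 then 0 else PowerSeries.coeff i.natAbs f := by
  choose ι hι using fun f : PowerSeries O => E.exists_coeff_eq
    (fun i => if i < 0 then 0 else PowerSeries.coeff i.natAbs f) fun n => by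
      filter_upwards [Filter.eventually_lt_atBot (0 : ℤ)] with i hi
      rw [if_pos hi]; exact zero_mem _
  have hι' : ∀ f i, E.coeff (ι f) i = if i < 0 then 0 else PowerSeries.coeff i.natAbs f :=
    fun f i => congrFun (hι f) i
  refine ⟨{ toFun := ι, map_one' := ?_, map_mul' := fun f g => ?_, map_zero' := ?_,
            map_add' := fun f g => ?_ }, hι'⟩
  · apply E.injective
    ext i
    rw [hι', coeff_one, Pi.single_apply]
    rcases lt_trichotomy i 0 with h | rfl | h
    · rw [if_pos h, if_neg h.ne]
    · simp
    · rw [if_neg (by omega), if_neg h.ne', PowerSeries.coeff_one, if_neg (by omega)]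
  · apply E.injective
    ext i
    rw [hι']
    split_ifs with h
    · rw [E.coeff_mul_eq_sum ∅, Finset.sum_empty]
      intro r _
      rw [hι', hι']
      split_ifs <;> first | simp | omega
    · obtain ⟨m, rfl⟩ := Int.eq_ofNat_of_zero_le (not_lt.mp h)
      rw [E.coeff_mul_eq_sum ((Finset.range (m + 1)).map Nat.castEmbedding), Finset.sum_map,
        Int.natAbs_natCast, PowerSeries.coeff_mul,
        Finset.Nat.sum_antidiagonal_eq_sum_range_succ
          (fun a b => PowerSeries.coeff a f * PowerSeries.coeff b g)]
      · refine Finset.sum_congr rfl fun r hr => ?_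
        rw [Finset.mem_range] at hr
        rw [hι', hι', if_neg (by simp), if_neg (by simp; omega)]
        congr 3
        simp; omega
      · intro r hr
        simp only [Finset.mem_map, Finset.mem_range, Nat.castEmbedding_apply, not_exists, not_and] at hr
        rw [hι', hι']
        have := hr r.natAbs
        split_ifs <;> first | simp | omega
  · apply E.injective
    ext i
    rw [hι']; simp
  · apply E.injective
    ext i
    rw [hι', E.coeff.map_add, Pi.add_apply, hι', hι']
    split_ifs <;> simp

/-- The inclusion `O⟦X⟧ → R` with `X ↦ t`. -/
noncomputable def ofPowerSeries : PowerSeries O →+* R := E.exists_ofPowerSeries.choose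

theorem coeff_ofPowerSeries (f : PowerSeries O) (i : ℤ) :
    E.coeff (E.ofPowerSeries f) i = if i < 0 then 0 else PowerSeries.coeff i.natAbs f :=
  E.exists_ofPowerSeries.choose_spec f i

theorem ofPowerSeries_X : E.ofPowerSeries PowerSeries.X = E.t := by
  apply E.injective
  ext i
  rw [coeff_ofPowerSeries, E.coeff_t, Pi.single_apply, PowerSeries.coeff_X]
  split_ifs <;> first | rfl | omega

theorem ofPowerSeries_C (a : O) : E.ofPowerSeries (PowerSeries.C a) = algebraMap O R a := by
  apply E.injective
  ext i
  rw [coeff_ofPowerSeries, Algebra.algebraMap_eq_smul_one, map_smul, coeff_one, Pi.smul_apply,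
    Pi.single_apply, PowerSeries.coeff_C]
  split_ifs <;> first | omega | simp

/-- The derivation `t d/dt`. -/
theorem exists_euler : ∃ D : Derivation O R R, ∀ x i, E.coeff (D x) i = i * E.coeff x i := by
  choose θ hθ using fun x : R => E.exists_coeff_eq (fun i => (i : O) * E.coeff x i) fun n => by
    filter_upwards [E.eventually_mem x n] with i hi
    exact Ideal.mul_mem_left _ _ hi
  have hθ' : ∀ x i, E.coeff (θ x) i = i * E.coeff x i := fun x i => congrFun (hθ x) i
  refine ⟨Derivation.mk' { toFun := θ, map_add' := fun x y => ?_, map_smul' := fun a x => ?_ }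
    fun x y => ?_, hθ'⟩
  · apply E.injective; ext i; simp [hθ', mul_add]
  · apply E.injective; ext i; simp [hθ']; ring
  · apply E.injective
    ext i
    simp only [LinearMap.coe_mk, AddHom.coe_mk, smul_eq_mul, map_add, Pi.add_apply]
    rw [hθ', mul_comm y]
    refine eq_of_forall_sub_mem_pow (I := maximalIdeal O) fun n => ?_
    classical
    obtain ⟨S1, h1⟩ := E.coeff_mul x y i n
    obtain ⟨S2, h2⟩ := E.coeff_mul x (θ y) i n
    obtain ⟨S3, h3⟩ := E.coeff_mul (θ x) y i n
    -- A common finite index set approximates all three products; there Leibniz's rule is the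
    -- identity i = r + (i - r).
    have k1 := Ideal.mul_mem_left _ (i : O) (h1 (S1 ∪ (S2 ∪ S3)) (by simp))
    have k2 := h2 (S1 ∪ (S2 ∪ S3)) (fun a ha => by simp [ha])
    have k3 := h3 (S1 ∪ (S2 ∪ S3)) (fun a ha => by simp [ha])
    have k4 := Ideal.sub_mem _ (Ideal.add_mem _ k2 k3) k1
    convert k4 using 1
    have k5 : (∑ r ∈ S1 ∪ (S2 ∪ S3), E.coeff x r * E.coeff (θ y) (i - r)) +
        ∑ r ∈ S1 ∪ (S2 ∪ S3), E.coeff (θ x) r * E.coeff y (i - r) =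
        i * ∑ r ∈ S1 ∪ (S2 ∪ S3), E.coeff x r * E.coeff y (i - r) := by
      rw [← Finset.sum_add_distrib, Finset.mul_sum]
      refine Finset.sum_congr rfl fun r _ => ?_
      rw [hθ', hθ']
      push_cast
      ring
    linear_combination -k5

/-- The derivation `d/dt` of `R`. -/
noncomputable def derivation : Derivation O R R := (↑E.unitT⁻¹ : R) • E.exists_euler.choose

theorem coeff_derivation (x : R) (i : ℤ) :
    E.coeff (E.derivation x) i = (i + 1) * E.coeff x (i + 1) := by
  have h := E.coeff_unitT_zpow_mul (-1) (E.exists_euler.choose x) i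
  rw [E.exists_euler.choose_spec, zpow_neg_one] at h
  rw [derivation, Derivation.smul_apply, smul_eq_mul, h]
  push_cast
  simp

theorem coeff_neg_one_derivation (x : R) : E.coeff (E.derivation x) (-1) = 0 := by
  rw [coeff_derivation]; simp

theorem derivation_ofPowerSeries (f : PowerSeries O) :
    E.derivation (E.ofPowerSeries f) = E.ofPowerSeries (PowerSeries.derivative O f) := by
  apply E.injective
  ext i
  rw [coeff_derivation, coeff_ofPowerSeries, coeff_ofPowerSeries]
  rcases lt_trichotomy i (-1) with h | rfl | h
  · rw [if_pos (by omega), if_pos (by omega), mul_zero]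
  · simp
  · obtain ⟨n, rfl⟩ := Int.eq_ofNat_of_zero_le (show 0 ≤ i by omega)
    rw [if_neg (by omega), if_neg (by omega), Int.natAbs_natCast,
      show ((n : ℤ) + 1).natAbs = n + 1 by omega]
    simp [PowerSeries.coeff_derivative, mul_comm]

theorem derivation_t : E.derivation E.t = 1 := by
  apply E.injective
  ext i
  rw [coeff_derivation, E.coeff_t, coeff_one, Pi.single_apply, Pi.single_apply]
  by_cases h : i = 0
  · simp [h]
  · rw [if_neg (by omega), if_neg h, mul_zero]

end Hausdorff

end DoubleExpansion
end Reciprocity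

namespace Reciprocity

/-! ### Frobenius and Artin–Schreier equations for power series modulo π. -/

section FiniteField

/-- The power map `f ↦ f ^ q` on power series over a finite field. -/
theorem coeff_pow_card_pow {κ : Type*} [Field κ] [Finite κ] (f : PowerSeries κ) (l n : ℕ) :
    PowerSeries.coeff n (f ^ Nat.card κ ^ l) =
      if Nat.card κ ^ l ∣ n then PowerSeries.coeff (n / Nat.card κ ^ l) f else 0 := by
  have := Fintype.ofFinite κ
  obtain ⟨p, hp⟩ := CharP.exists κ
  rcases FiniteField.card κ p with ⟨⟨m, mpos⟩, ⟨hp, hm⟩⟩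
  have : Fact p.Prime := ⟨hp⟩
  rw [Nat.card_eq_fintype_card]
  have h0 : Fintype.card κ ^ l ≠ 0 := pow_ne_zero _ Fintype.card_ne_zero
  rw [← PowerSeries.coeff_expand _ h0]
  congr 1
  have h := MvPowerSeries.map_iterateFrobenius_expand (R := κ) p hp.ne_zero (σ := Unit) f (m * l)
  have h2 : iterateFrobenius κ p (m * l) = RingHom.id κ := by
    ext x
    have h3 : p ^ m = Fintype.card κ := hm.symm
    rw [iterateFrobenius_def, pow_mul, h3]
    -- The coefficients are fixed by this iterate of Frobenius, so the power map is the substitution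
    -- of a power of X.
    exact FiniteField.pow_card_pow l x
  rw [h2] at h
  have h3 : Fintype.card κ ^ l = p ^ (m * l) := by rw [hm, pow_mul]; rfl
  simp only [h3]
  exact h.symm

variable {O : Type*} [CommRing O] [IsLocalRing O] {π : O}

theorem C_dvd_iff (hπ : maximalIdeal O = Ideal.span {π}) (f : PowerSeries O) :
    PowerSeries.C π ∣ f ↔ PowerSeries.map (residue O) f = 0 := by
  constructor
  · rintro ⟨g, rfl⟩
    rw [map_mul, PowerSeries.map_C,
      (residue_eq_zero_iff π).mpr (hπ ▸ Ideal.mem_span_singleton_self π), map_zero, zero_mul]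
  · intro h
    have : ∀ n, ∃ b, PowerSeries.coeff n f = π * b := fun n => by
      have h1 := congrArg (PowerSeries.coeff n) h
      rw [PowerSeries.coeff_map, map_zero, residue_eq_zero_iff, hπ, Ideal.mem_span_singleton] at h1
      exact h1
    choose b hb using this
    exact ⟨PowerSeries.mk b, by ext n; rw [PowerSeries.coeff_C_mul, PowerSeries.coeff_mk, hb]⟩

variable [Finite (ResidueField O)]

/-- Modulo π, with q = |κ|^l, the q-th power map is X ↦ X^q. Sorting the monomials by their exponent
modulo q therefore exhibits 1, X, …, X^(q-1) as generators over the ring of q-th powers. -/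
theorem exists_eq_sum_pow_card (hπ : maximalIdeal O = Ideal.span {π}) (l : ℕ) (g : PowerSeries O) :
    ∃ (f : ℕ → PowerSeries O) (g1 : PowerSeries O),
      g = (∑ j ∈ Finset.range (Nat.card (ResidueField O) ^ l),
        PowerSeries.X ^ j * f j ^ Nat.card (ResidueField O) ^ l) + PowerSeries.C π * g1 := by
  set q := Nat.card (ResidueField O) ^ l with hq
  have q0 : 0 < q := pow_pos Nat.card_pos _
  let f : ℕ → PowerSeries O := fun j => PowerSeries.mk fun n => PowerSeries.coeff (n * q + j) g
  have h : PowerSeries.C π ∣ g - ∑ j ∈ Finset.range q, PowerSeries.X ^ j * f j ^ q := by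
    rw [C_dvd_iff hπ, map_sub, sub_eq_zero, map_sum]
    ext n
    simp only [map_sum, map_mul, map_pow, PowerSeries.map_X, PowerSeries.coeff_X_pow_mul', hq,
      coeff_pow_card_pow]
    rw [← hq, Finset.sum_eq_single (n % q)]
    · rw [if_pos (Nat.mod_le _ _), if_pos (Nat.dvd_sub_mod n)]
      simp only [PowerSeries.coeff_map, f, PowerSeries.coeff_mk]
      congr 2
      rw [Nat.div_mul_cancel (Nat.dvd_sub_mod n), Nat.sub_add_cancel (Nat.mod_le _ _)]
    · intro j hj hjn
      split_ifs with h1 h2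
      · exfalso
        apply hjn
        rw [Finset.mem_range] at hj
        rw [← Nat.mod_eq_of_lt hj]
        exact (Nat.modEq_iff_dvd' h1).mpr h2
      · rfl
      · rfl
    · intro hn
      exact absurd (Finset.mem_range.mpr (Nat.mod_lt n q0)) hn
  obtain ⟨g1, hg1⟩ := h
  exact ⟨f, g1, by rw [← hg1]; ring⟩

/-- Artin–Schreier equations modulo `π`. -/
theorem exists_eq_sub_pow_card (hπ : maximalIdeal O = Ideal.span {π}) {l : ℕ} (hl : l ≠ 0)
    (f : PowerSeries O) (hf : PowerSeries.constantCoeff f = 0) :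
    ∃ g f1 : PowerSeries O,
      f = g - g ^ Nat.card (ResidueField O) ^ l + PowerSeries.C π * f1 := by
  set q := Nat.card (ResidueField O) ^ l with hq
  have q0 : 1 < q := Nat.one_lt_pow hl Finite.one_lt_card
  -- Comparing coefficients in a - a^q = f modulo π gives a_n = f_n + a_(n/q) when q divides n.
  -- Index 0 is excluded from the recursion, where it would refer to itself; this is why f must have
  -- zero constant term.
  obtain ⟨a, ha⟩ : ∃ a : ℕ → O, ∀ n, a n = PowerSeries.coeff n f +
      if 0 < n ∧ q ∣ n then a (n / q) else 0 := by
    let a : ℕ → O := fun n => Nat.strongRec (motive := fun _ => O) (fun n ih =>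
      PowerSeries.coeff n f + if h : 0 < n ∧ q ∣ n then ih (n / q) (Nat.div_lt_self h.1 q0) else 0) n
    refine ⟨a, fun n => ?_⟩
    simp only [a]
    rw [Nat.strongRec_eq]
    split_ifs <;> rfl
  have a0 : a 0 = 0 := by
    rw [ha, if_neg (by simp), PowerSeries.coeff_zero_eq_constantCoeff_apply, hf, add_zero]
  have h : PowerSeries.C π ∣ f - (PowerSeries.mk a - PowerSeries.mk a ^ q) := by
    rw [C_dvd_iff hπ, map_sub, sub_eq_zero, map_sub, map_pow]
    ext n
    rw [map_sub, hq, coeff_pow_card_pow, ← hq]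
    simp only [PowerSeries.coeff_map, PowerSeries.coeff_mk]
    rw [ha n, map_add]
    rcases Nat.eq_zero_or_pos n with rfl | hn
    · simp [a0]
    · simp only [hn, true_and]
      split_ifs <;> simp
  obtain ⟨f1, hf1⟩ := h
  exact ⟨PowerSeries.mk a, f1, by linear_combination hf1⟩

/-- One q-th power gains one power of I: in a^q - b^q = (a - b) Σ a^i b^(q-1-i) the sum is congruent
to q b^(q-1), which lies in I. -/
theorem pow_pow_sub_mem {R : Type*} [CommRing R] {I : Ideal R} {q : ℕ} (hq : (q : R) ∈ I) {a b : R}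
    (h : a - b ∈ I) (k : ℕ) : a ^ q ^ k - b ^ q ^ k ∈ I ^ (k + 1) := by
  induction k with
  | zero => simpa using h
  | succ k ih =>
    rw [pow_succ q k, pow_mul, pow_mul, ← geom_sum₂_mul, pow_succ' I (k + 1)]
    refine Ideal.mul_mem_mul ?_ ih
    have h1 : a ^ q ^ k - b ^ q ^ k ∈ I := Ideal.pow_le_self (by simp) ih
    rw [← Ideal.Quotient.eq] at h1
    rw [← Ideal.Quotient.eq_zero_iff_mem, map_sum]
    simp only [map_mul, map_pow] at h1 ⊢
    rw [h1]
    have h2 : ∀ i ∈ Finset.range q, ((Ideal.Quotient.mk I b ^ q ^ k) ^ i) *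
        (Ideal.Quotient.mk I b ^ q ^ k) ^ (q - 1 - i) = (Ideal.Quotient.mk I b ^ q ^ k) ^ (q - 1) := by
      intro i hi
      rw [Finset.mem_range] at hi
      rw [← pow_add]; congr 1; omega
    rw [Finset.sum_congr rfl h2, Finset.sum_const, Finset.card_range, nsmul_eq_mul,
      ← map_natCast (Ideal.Quotient.mk I), Ideal.Quotient.eq_zero_iff_mem.mpr hq, zero_mul]

end FiniteField
end Reciprocity

namespace Reciprocity

namespace DoubleExpansion

/-! ### The order modulo π does not depend on the expansion. -/

section Order

variable {O R : Type*} [CommRing O] [IsLocalRing O] [IsDomain O] [IsHausdorff (maximalIdeal O) O]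
  [CommRing R] [Algebra O R] (E E' : DoubleExpansion O R) {π : O}

/-- The coefficients divided by πⁿ still tend to zero at -∞, so they are the expansion of an
element. -/
theorem forall_coeff_mem_iff (hπ : maximalIdeal O = Ideal.span {π}) (hπ0 : π ≠ 0) {x : R} {n : ℕ} :
    (∀ i, E.coeff x i ∈ maximalIdeal O ^ n) ↔ ∃ z, x = π ^ n • z := by
  have hmem : ∀ k (a : O), a ∈ maximalIdeal O ^ k ↔ π ^ k ∣ a := fun k a => by
    rw [hπ, Ideal.span_singleton_pow, Ideal.mem_span_singleton]
  constructor
  · intro h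
    choose b hb using fun i => (hmem n _).mp (h i)
    obtain ⟨z, hz⟩ := E.exists_coeff_eq b fun k => by
      filter_upwards [E.eventually_mem x (n + k)] with i hi
      rw [hmem, hb, pow_add] at hi
      rw [hmem]
      exact (mul_dvd_mul_iff_left (pow_ne_zero n hπ0)).mp hi
    refine ⟨z, E.injective ?_⟩
    ext i
    rw [map_smul, hz, Pi.smul_apply, smul_eq_mul, hb]
  · rintro ⟨z, rfl⟩ i
    rw [map_smul, Pi.smul_apply, smul_eq_mul, hmem]
    exact dvd_mul_right _ _

/-- Collect the coefficients of index at least k into a power series; the remainder has all its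
coefficients divisible by πⁿ. -/
theorem exists_eq_t_pow_mul (hπ : maximalIdeal O = Ideal.span {π}) (hπ0 : π ≠ 0) {x : R} {k n : ℕ}
    (hx : x ∈ E.fil k n) : ∃ g z, x = E.t ^ k * E.ofPowerSeries g + π ^ n • z := by
  obtain ⟨z, hz⟩ := (E.forall_coeff_mem_iff hπ hπ0 (n := n)
    (x := x - E.t ^ k * E.ofPowerSeries (PowerSeries.mk fun i => E.coeff x (i + k)))).mp fun i => by
    rw [map_sub, Pi.sub_apply, coeff_t_pow_mul, coeff_ofPowerSeries]
    split_ifs with h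
    · rw [sub_zero]; exact hx i (by omega)
    · rw [PowerSeries.coeff_mk, show ((i - k).natAbs : ℤ) + k = i by omega, sub_self]
      exact zero_mem _
  exact ⟨_, z, by rw [← hz]; ring⟩

/-- The reduction of `x` modulo `π` is a Laurent series of order `m`. -/
def HasOrder (x : R) (m : ℤ) : Prop := x ∈ E.fil m 1 ∧ E.coeff x m ∉ maximalIdeal O

variable {E}

theorem HasOrder.le {x : R} {m n : ℤ} (h : E.HasOrder x m) (hn : x ∈ E.fil n 1) : n ≤ m := by
  by_contra! hlt
  exact h.2 (by simpa using hn m hlt)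

theorem HasOrder.unique {x : R} {m n : ℤ} (h : E.HasOrder x m) (h' : E.HasOrder x n) : m = n :=
  le_antisymm (h'.le h.1) (h.le h'.1)

theorem exists_hasOrder (hπ : maximalIdeal O = Ideal.span {π}) (hπ0 : π ≠ 0) {x : R}
    (hx : ¬ ∃ z, x = π • z) : ∃ m, E.HasOrder x m := by
  classical
  rw [← pow_one π, ← E.forall_coeff_mem_iff hπ hπ0, not_forall] at hx
  obtain ⟨m0, h0⟩ := E.exists_mem_fil x 1
  obtain ⟨m, hm, hm'⟩ := Int.exists_least_of_bdd (P := fun i => E.coeff x i ∉ maximalIdeal O ^ 1)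
    ⟨-m0, fun i hi => by by_contra! hlt; exact hi (h0 i hlt)⟩ hx
  refine ⟨m, fun i hi => ?_, by simpa using hm⟩
  by_contra hi'
  exact absurd (hm' i hi') (by omega)

/-- In the coefficient of index m + n every product other than that of the two leading coefficients
lies in the maximal ideal, which is prime. -/
theorem HasOrder.mul {x y : R} {m n : ℤ} (hx : E.HasOrder x m) (hy : E.HasOrder y n) :
    E.HasOrder (x * y) (m + n) := by
  classical
  refine ⟨mul_mem_fil E hx.1 hy.1, fun h => ?_⟩
  obtain ⟨S, hS⟩ := E.coeff_mul x y (m + n) 1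
  have h1 := hS (insert m S) (Finset.subset_insert _ _)
  rw [pow_one] at h1
  have h2 := Ideal.add_mem _ h1 h
  rw [sub_add_cancel, ← Finset.add_sum_erase _ _ (Finset.mem_insert_self m S)] at h2
  have h3 : ∑ r ∈ (insert m S).erase m, E.coeff x r * E.coeff y (m + n - r) ∈ maximalIdeal O := by
    refine Ideal.sum_mem _ fun r hr => ?_
    rcases lt_or_gt_of_ne (Finset.ne_of_mem_erase hr) with h | h
    · exact Ideal.mul_mem_right _ _ (by simpa using hx.1 r h)
    · exact Ideal.mul_mem_left _ _ (by simpa using hy.1 (m + n - r) (by omega))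
  rw [Ideal.add_mem_iff_left _ h3, add_sub_cancel_left] at h2
  exact ((maximalIdeal.isMaximal O).isPrime.mem_or_mem h2).elim hx.2 hy.2

theorem hasOrder_t_zpow (n : ℤ) : E.HasOrder (E.unitT ^ n : Rˣ) n := by
  refine ⟨fun i hi => ?_, ?_⟩
  · rw [coeff_unitT_zpow, Pi.single_eq_of_ne hi.ne]; exact zero_mem _
  · rw [coeff_unitT_zpow, Pi.single_eq_same]
    exact fun h => (maximalIdeal.isMaximal O).ne_top ((Ideal.eq_top_iff_one _).mpr h)

theorem hasOrder_t : E.HasOrder E.t 1 := by simpa using hasOrder_t_zpow (E := E) 1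

theorem hasOrder_one : E.HasOrder 1 0 := by simpa using hasOrder_t_zpow (E := E) 0

theorem HasOrder.pow {x : R} {m : ℤ} (hx : E.HasOrder x m) (n : ℕ) : E.HasOrder (x ^ n) (n * m) := by
  induction n with
  | zero => simpa using hasOrder_one
  | succ n ih =>
    rw [pow_succ]
    convert ih.mul hx using 1
    push_cast; ring

theorem HasOrder.congr {x y : R} {m : ℤ} (hx : E.HasOrder x m) (h : y - x ∈ E.fil (m + 1) 1) :
    E.HasOrder y m := by
  have h1 : y = x + (y - x) := by ring
  refine ⟨h1 ▸ add_mem hx.1 (E.fil_anti (by omega) le_rfl h), fun h2 => hx.2 ?_⟩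
  have h3 := h m (by omega)
  rw [pow_one, map_sub, Pi.sub_apply] at h3
  have h4 := Ideal.sub_mem _ h2 h3
  rwa [sub_sub_cancel] at h4

theorem exists_hasOrder_unit (hπ : maximalIdeal O = Ideal.span {π}) (hπ0 : π ≠ 0) (u : Rˣ) :
    ∃ m, E.HasOrder (u : R) m := by
  refine exists_hasOrder hπ hπ0 ?_
  rintro ⟨z, hz⟩
  have h1 : ∀ i, E.coeff 1 i ∈ maximalIdeal O ^ 1 :=
    (E.forall_coeff_mem_iff hπ hπ0).mpr ⟨z * ↑u⁻¹, by rw [pow_one, ← smul_mul_assoc, ← hz]; simp⟩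
  have h2 := h1 0
  rw [pow_one] at h2
  exact (hasOrder_one (E := E)).2 h2

theorem smul_mem_fil (hπ : maximalIdeal O = Ideal.span {π}) (m : ℤ) (n : ℕ) {k : ℕ} {z : R}
    (h : z ∈ E.fil m k) : π ^ n • z ∈ E.fil m (k + n) := by
  intro i hi
  rw [map_smul, Pi.smul_apply, smul_eq_mul, mul_comm, pow_add]
  exact Ideal.mul_mem_mul (h i hi) (Ideal.pow_mem_pow (hπ ▸ Ideal.mem_span_singleton_self π) n)

theorem mem_fil_zero (m : ℤ) (z : R) : z ∈ E.fil m 0 := fun i _ => by simp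

theorem pow_smul_mem_fil (hπ : maximalIdeal O = Ideal.span {π}) (m : ℤ) (n : ℕ) (z : R) :
    π ^ n • z ∈ E.fil m n := by simpa using smul_mem_fil hπ m n (mem_fil_zero (E := E) m z)

variable (E)
variable [Finite (ResidueField O)]

/-- Being of the form v - v^q is a purely algebraic property. Modulo π an element of positive order
has it for every q that is a positive power of |κ|. An element of order m < 0 does not have it once
q > |m|, because v would have negative order n and v - v^q would have order q n. The property is
thus visible in every expansion and transports information about orders from `E` to `E'`. -/
theorem mem_fil_zero_of_mem_fil_one (hπ : maximalIdeal O = Ideal.span {π}) (hπ0 : π ≠ 0) {x : R}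
    (hx : x ∈ E.fil 1 1) : x ∈ E'.fil 0 1 := by
  by_cases h0 : ∃ z, x = π • z
  · obtain ⟨z, rfl⟩ := h0
    rw [← pow_one π]; exact pow_smul_mem_fil hπ _ _ _
  obtain ⟨m, hm⟩ := exists_hasOrder (E := E') hπ hπ0 h0
  rcases le_or_gt 0 m with h | h
  · exact E'.fil_anti h le_rfl hm.1
  exfalso
  obtain ⟨g, z, hz⟩ := E.exists_eq_t_pow_mul hπ hπ0 (k := 1) (by simpa using hx)
  have hc : 1 < Nat.card (ResidueField O) := Finite.one_lt_card
  -- With l = |m| one gets q = |κ|^l > |m|, so m cannot be q n with n < 0.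
  set l := m.natAbs with hl
  obtain ⟨w, f1, hw⟩ := exists_eq_sub_pow_card hπ (l := l) (by omega) (PowerSeries.X * g) (by simp)
  set q := Nat.card (ResidueField O) ^ l with hq
  have hlq : l < q := Nat.lt_pow_self hc
  obtain ⟨z', hz'⟩ : ∃ z', x = E.ofPowerSeries w - E.ofPowerSeries w ^ q + π • z' := by
    refine ⟨E.ofPowerSeries f1 + z, ?_⟩
    have h1 := congrArg E.ofPowerSeries hw
    simp only [map_mul, map_add, map_sub, map_pow, E.ofPowerSeries_X, E.ofPowerSeries_C,
      ← Algebra.smul_def] at h1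
    rw [hz, pow_one, pow_one, h1, smul_add]; abel
  set v := E.ofPowerSeries w
  by_cases hv : ∃ z, v = π • z
  · obtain ⟨z, hz⟩ := hv
    apply h0
    refine ⟨z - z * v ^ (q - 1) + z', ?_⟩
    rw [hz', smul_add, smul_sub, ← smul_mul_assoc, ← hz, mul_pow_sub_one (by omega)]
  obtain ⟨n, hn⟩ := exists_hasOrder (E := E') hπ hπ0 hv
  have hzf : ∀ k, π • z' ∈ E'.fil k 1 := fun k => by
    rw [← pow_one π]; exact pow_smul_mem_fil hπ _ _ _
  rcases le_or_gt 0 n with hn0 | hn0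
  · have h1 : x ∈ E'.fil 0 1 := by
      rw [hz']
      refine add_mem (sub_mem (E'.fil_anti hn0 le_rfl hn.1) ?_) (hzf 0)
      exact E'.fil_anti (by positivity) le_rfl (hn.pow q).1
    exact absurd (hm.le h1) (by omega)
  · have h1 : E'.HasOrder (-x) (q * n) := by
      refine (hn.pow q).congr ?_
      have : -x - v ^ q = -v - π • z' := by rw [hz']; abel
      rw [this]
      refine sub_mem (neg_mem (E'.fil_anti ?_ le_rfl hn.1)) (hzf _)
      have : (q : ℤ) * n ≤ 2 * n := mul_le_mul_of_nonpos_right (by omega) hn0.le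
      omega
    have h2 : E'.HasOrder x (q * n) := by
      refine ⟨?_, fun h3 => h1.2 ?_⟩
      · simpa using neg_mem h1.1
      · simpa using h3
    have h3 := hm.unique h2
    have : (q : ℤ) * n ≤ q * (-1) := mul_le_mul_of_nonneg_left (by omega) (by positivity)
    omega

/-- If x had negative order in `E'`, then so would t x^k for large k, although t x^k has positive
order in `E`. -/
theorem mem_fil_zero_iff (hπ : maximalIdeal O = Ideal.span {π}) (hπ0 : π ≠ 0) {x : R}
    (hx : x ∈ E.fil 0 1) : x ∈ E'.fil 0 1 := by
  by_cases h0 : ∃ z, x = π • z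
  · obtain ⟨z, rfl⟩ := h0
    rw [← pow_one π]; exact pow_smul_mem_fil hπ _ _ _
  obtain ⟨m, hm⟩ := exists_hasOrder (E := E') hπ hπ0 h0
  obtain ⟨n, hn⟩ := exists_hasOrder_unit (E := E') hπ hπ0 E.unitT
  rw [coe_unitT] at hn
  rcases le_or_gt 0 m with h | h
  · exact E'.fil_anti h le_rfl hm.1
  exfalso
  have h1 : ∀ k : ℕ, E.t * x ^ k ∈ E.fil 1 1 := by
    intro k
    induction k with
    | zero => simpa using hasOrder_t.1
    | succ k ih =>
      rw [pow_succ, ← mul_assoc]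
      simpa using mul_mem_fil E ih hx
  obtain ⟨k, hk⟩ : ∃ k : ℕ, n < k := ⟨n.natAbs + 1, by omega⟩
  have h2 := (hn.mul (hm.pow k)).le (E.mem_fil_zero_of_mem_fil_one E' hπ hπ0 (h1 _))
  have : (k : ℤ) * m ≤ (k : ℤ) * (-1) := mul_le_mul_of_nonneg_left (by omega) (by positivity)
  omega

/-- The order n is nonnegative since t has positive order in `E`. If it were 0, then t⁻¹ would have
nonnegative order in `E'`, hence in `E`, where its order is -1. -/
theorem one_le_of_hasOrder_t (hπ : maximalIdeal O = Ideal.span {π}) (hπ0 : π ≠ 0) {n : ℤ}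
    (hn : E'.HasOrder E.t n) : 1 ≤ n := by
  have h1 : E'.HasOrder (E.unitT⁻¹ : Rˣ) (-n) := by
    obtain ⟨m, hm⟩ := exists_hasOrder_unit (E := E') hπ hπ0 E.unitT⁻¹
    have h := hn.mul hm
    rw [← coe_unitT, Units.mul_inv] at h
    have := h.unique hasOrder_one
    rwa [show -n = m by omega]
  have h2 := hn.le (E.mem_fil_zero_of_mem_fil_one E' hπ hπ0 hasOrder_t.1)
  by_contra! h3
  have h4 : E.HasOrder (E.unitT⁻¹ : Rˣ) (-1) := by
    simpa using hasOrder_t_zpow (E := E) (-1)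
  have h5 := h4.le (E'.mem_fil_zero_iff E hπ hπ0 (E'.fil_anti (by omega) le_rfl h1.1))
  omega

/-- The reduction of the variable of one expansion is a uniformizer for any other expansion. -/
theorem hasOrder_t_one (hπ : maximalIdeal O = Ideal.span {π}) (hπ0 : π ≠ 0) :
    E'.HasOrder E.t 1 := by
  obtain ⟨n, hn⟩ := exists_hasOrder_unit (E := E') hπ hπ0 E.unitT
  rw [coe_unitT] at hn
  have h1 := E.one_le_of_hasOrder_t E' hπ hπ0 hn
  obtain ⟨n', hn'⟩ := exists_hasOrder_unit (E := E) hπ hπ0 E'.unitT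
  rw [coe_unitT] at hn'
  have h2 := E'.one_le_of_hasOrder_t E hπ hπ0 hn'
  -- the quotient of the two variables
  have h3 : (E.t * ↑E'.unitT⁻¹ : R) ∈ E'.fil 0 1 := by
    have := hn.mul (hasOrder_t_zpow (E := E') (-1))
    rw [zpow_neg_one] at this
    exact E'.fil_anti (by omega) le_rfl this.1
  obtain ⟨k, hk⟩ := exists_hasOrder_unit (E := E) hπ hπ0 (E.unitT * E'.unitT⁻¹)
  rw [Units.val_mul, coe_unitT] at hk
  have h4 := hk.le (E'.mem_fil_zero_iff E hπ hπ0 h3)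
  have h5 := hk.mul hn'
  rw [mul_assoc, ← coe_unitT E', Units.inv_mul, mul_one] at h5
  have h6 := h5.unique hasOrder_t
  obtain rfl : n' = 1 := by omega
  -- symmetric argument
  obtain ⟨k', hk'⟩ := exists_hasOrder_unit (E := E') hπ hπ0 (E'.unitT * E.unitT⁻¹)
  rw [Units.val_mul, coe_unitT] at hk'
  have h7 : (E'.t * ↑E.unitT⁻¹ : R) ∈ E.fil 0 1 := by
    have := hn'.mul (hasOrder_t_zpow (E := E) (-1))
    rw [zpow_neg_one] at this
    exact E.fil_anti (by omega) le_rfl this.1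
  have h8 := hk'.le (E.mem_fil_zero_iff E' hπ hπ0 h7)
  have h9 := hk'.mul hn
  rw [mul_assoc, ← coe_unitT E, Units.inv_mul, mul_one] at h9
  have h10 := h9.unique hasOrder_t
  obtain rfl : n = 1 := by omega
  exact hn

end Order

/-! ### Comparison of the topologies of two expansions. -/

section Continuity

variable {O R : Type*} [CommRing O] [IsLocalRing O] [IsDomain O] [IsHausdorff (maximalIdeal O) O]
  [CommRing R] [Algebra O R] (E E' : DoubleExpansion O R) {π : O} [Finite (ResidueField O)]

theorem pow_mem_fil {x : R} {m : ℤ} {n : ℕ} (hx : x ∈ E.fil m n) (k : ℕ) : x ^ k ∈ E.fil (k * m) n := by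
  induction k with
  | zero =>
    simp only [pow_zero, Nat.cast_zero, zero_mul]
    intro i hi
    rw [coeff_one, Pi.single_eq_of_ne hi.ne]; exact zero_mem _
  | succ k ih =>
    rw [pow_succ]
    convert mul_mem_fil E ih hx using 1
    push_cast; ring_nf

theorem natCast_card_mem : (Nat.card (ResidueField O) : O) ∈ maximalIdeal O := by
  have := Fintype.ofFinite (ResidueField O)
  rw [← residue_eq_zero_iff, map_natCast, Nat.card_eq_fintype_card, FiniteField.cast_card_eq_zero]

/-- Modulo π, x is t^m times a power series, and |κ| ∈ (π); raising to the power |κ|ⁿ improves this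
to a congruence modulo πⁿ⁺¹. -/
theorem pow_card_pow_mem_fil (hπ : maximalIdeal O = Ideal.span {π}) (hπ0 : π ≠ 0) {x : R} {m : ℕ}
    (hx : x ∈ E.fil m 1) (n : ℕ) :
    x ^ Nat.card (ResidueField O) ^ n ∈ E.fil (Nat.card (ResidueField O) ^ n * m) n := by
  obtain ⟨g, z, hz⟩ := E.exists_eq_t_pow_mul hπ hπ0 hx
  have h1 : E.t ^ m * E.ofPowerSeries g ∈ E.fil m n := by
    intro i hi
    rw [coeff_t_pow_mul, coeff_ofPowerSeries, if_pos (by omega)]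
    exact zero_mem _
  have h2 := pow_mem_fil E h1 (Nat.card (ResidueField O) ^ n)
  have h3 := pow_pow_sub_mem (R := R) (I := Ideal.span {algebraMap O R π})
    (q := Nat.card (ResidueField O)) (a := x) (b := E.t ^ m * E.ofPowerSeries g) (by
      have := natCast_card_mem (O := O)
      rw [hπ, Ideal.mem_span_singleton] at this
      rw [Ideal.mem_span_singleton]
      simpa using (algebraMap O R).map_dvd this) (by
      rw [hz, Ideal.mem_span_singleton, pow_one, Algebra.smul_def, add_sub_cancel_left]
      exact dvd_mul_right _ _) n
  rw [Ideal.span_singleton_pow, Ideal.mem_span_singleton] at h3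
  obtain ⟨z', hz'⟩ := h3
  rw [← sub_add_cancel (x ^ _) ((E.t ^ m * E.ofPowerSeries g) ^ _)]
  refine add_mem ?_ (by exact_mod_cast h2)
  rw [hz', ← map_pow, ← Algebra.smul_def]
  exact E.fil_anti le_rfl (by omega) (pow_smul_mem_fil hπ _ (n + 1) z')

/-- Any two expansions define the same topology. -/
theorem exists_t_pow_mul_mem_fil (hπ : maximalIdeal O = Ideal.span {π}) (hπ0 : π ≠ 0) (M N : ℕ) :
    ∃ C : ℕ, ∀ g, E.t ^ C * E.ofPowerSeries g ∈ E'.fil M N := by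
  set q := Nat.card (ResidueField O) ^ N with hq
  have hq1 : 0 < q := pow_pos Nat.card_pos _
  choose m hm using fun j : ℕ => E'.exists_mem_fil (E.t ^ j) N
  set m0 := (Finset.range q).sup m
  have ht := E.hasOrder_t_one E' hπ hπ0
  -- The exponent is a multiple of q so that t^C can be absorbed into the q-th powers of the
  -- decomposition of g; `m0` compensates the poles modulo π^N of t^j, j < q, in `E'`.
  refine ⟨q * (M + m0), ?_⟩
  -- Induction on the precision i: the q-th powers are already small modulo π^N, and the error term
  -- carries a factor π, so for it precision i suffices to reach i + 1.
  have key : ∀ i ≤ N, ∀ g, E.t ^ (q * (M + m0)) * E.ofPowerSeries g ∈ E'.fil M i := by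
    intro i
    induction i with
    | zero => exact fun _ g => mem_fil_zero _ _
    | succ i ih =>
      intro hi g
      obtain ⟨f, g1, hg⟩ := exists_eq_sum_pow_card hπ N g
      rw [← hq] at hg
      have h1 : E.t ^ (q * (M + m0)) * E.ofPowerSeries g =
          (∑ j ∈ Finset.range q, E.t ^ j * (E.t ^ (M + m0) * E.ofPowerSeries (f j)) ^ q) +
            π ^ 1 • (E.t ^ (q * (M + m0)) * E.ofPowerSeries g1) := by
        have h := congrArg E.ofPowerSeries hg
        simp only [map_mul, map_add, map_sum, map_pow, E.ofPowerSeries_X, E.ofPowerSeries_C] at h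
        rw [h, mul_add, Finset.mul_sum, pow_one, Algebra.smul_def]
        congr 1
        · refine Finset.sum_congr rfl fun j _ => ?_
          rw [mul_pow, ← pow_mul, mul_comm q]; ring
        · ring
      rw [h1]
      refine add_mem (sum_mem fun j hj => ?_) (smul_mem_fil hπ _ _ (ih (by omega) g1))
      have h2 : E.t ^ (M + m0) * E.ofPowerSeries (f j) ∈ E'.fil (M + m0 : ℕ) 1 := by
        have h3 : E.t ^ (M + m0) ∈ E'.fil (M + m0 : ℕ) 1 := by
          simpa using (ht.pow (M + m0)).1
        have h4 : E.ofPowerSeries (f j) ∈ E'.fil 0 1 := by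
          refine E.mem_fil_zero_iff E' hπ hπ0 fun k hk => ?_
          rw [coeff_ofPowerSeries, if_pos hk]; exact zero_mem _
        simpa using mul_mem_fil E' h3 h4
      have h5 := pow_card_pow_mem_fil E' hπ hπ0 h2 N
      have h6 := mul_mem_fil E' (hm j) h5
      refine E'.fil_anti ?_ hi h6
      have h7 : m j ≤ m0 := Finset.le_sup hj
      rw [← Nat.cast_pow, ← hq]
      have h8 : M + m0 ≤ q * (M + m0) := Nat.le_mul_of_pos_left _ hq1
      have h9 : (-(m j : ℤ) + (q : ℤ) * ((M + m0 : ℕ) : ℤ)) = ((q * (M + m0) : ℕ) : ℤ) - m j := by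
        push_cast; ring
      rw [h9]; omega
  exact key N le_rfl

end Continuity

end DoubleExpansion
end Reciprocity

namespace Reciprocity

namespace DoubleExpansion

/-! ### Invariance of the coefficient of t⁻¹ under change of coordinate. -/

section ChangeOfCoordinate

variable {O R : Type*} [CommRing O] [IsLocalRing O] [IsDomain O] [IsHausdorff (maximalIdeal O) O]
  [CharZero O] [CommRing R] [Algebra O R] (E E' : DoubleExpansion O R) {π : O}

/-- Up to the nonzero integer k + 1 this is the exact form d(h^(k+1)). -/
theorem coeff_neg_one_pow_mul_derivation (h : R) (k : ℕ) :
    E.coeff (h ^ k * E.derivation h) (-1) = 0 := by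
  have h1 := E.coeff_neg_one_derivation (h ^ (k + 1))
  rw [Derivation.leibniz_pow, Nat.add_sub_cancel, map_nsmul, Pi.smul_apply, nsmul_eq_mul,
    smul_eq_mul] at h1
  exact (mul_eq_zero.mp h1).resolve_left (by exact_mod_cast k.succ_ne_zero)

theorem coeff_neg_one_inv_pow_mul_derivation (u : Rˣ) (k : ℕ) :
    E.coeff ((↑u⁻¹ : R) ^ (k + 2) * E.derivation u) (-1) = 0 := by
  have h1 := E.coeff_neg_one_pow_mul_derivation (↑u⁻¹ : R) k
  rw [Derivation.leibniz_of_mul_eq_one (b := (u : R)) _ u.inv_mul, smul_eq_mul] at h1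
  rw [← neg_eq_zero, ← Pi.neg_apply, ← map_neg, ← h1, pow_add, neg_mul, mul_neg, mul_assoc]

/-- Here z is the logarithmic derivative of 1 + πh, whose series would have denominators. Instead
h^n z = π h^n dh - π h^(n+1) z, with h^n dh of residue zero, shows that the residue of z is
divisible by every π^n. -/
theorem coeff_neg_one_mul_of_dlog {h z : R} (hπ : maximalIdeal O = Ideal.span {π})
    (hz : (1 + π • h) * z = π • E.derivation h) : E.coeff z (-1) = 0 := by
  have h1 : ∀ n : ℕ, E.coeff z (-1) = (-π) ^ n * E.coeff (h ^ n * z) (-1) := by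
    intro n
    induction n with
    | zero => simp
    | succ n ih =>
      have h2 : h ^ n * z = π • (h ^ n * E.derivation h) - π • (h ^ (n + 1) * z) := by
        rw [← mul_smul_comm, ← hz, pow_succ, ← smul_mul_assoc, ← mul_smul_comm]
        ring
      rw [ih, h2, map_sub, map_smul, map_smul, Pi.sub_apply, Pi.smul_apply, Pi.smul_apply,
        coeff_neg_one_pow_mul_derivation, smul_eq_mul, smul_eq_mul]
      ring
  refine eq_of_forall_sub_mem_pow (I := maximalIdeal O) fun n => ?_
  rw [sub_zero, h1 n, hπ, Ideal.span_singleton_pow, Ideal.mem_span_singleton, neg_pow]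
  exact (dvd_mul_left _ _).mul_right _

/-- Write t = w t' with w of order 0, and w = a (1 + πh) with a a unit power series in t'. Then dlog
t = dlog t' + dlog a + dlog(1 + πh); the first term contributes 1, the second has no negative
powers, and the third has residue zero. -/
theorem coeff_neg_one_inv_mul_derivation_t [Finite (ResidueField O)]
    (hπ : maximalIdeal O = Ideal.span {π}) (hπ0 : π ≠ 0) :
    E'.coeff ((↑E.unitT⁻¹ : R) * E'.derivation E.t) (-1) = 1 := by
  set w : Rˣ := E.unitT * E'.unitT⁻¹ with hw
  have hw0 : E'.HasOrder (w : R) 0 := by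
    have := (E.hasOrder_t_one E' hπ hπ0).mul (hasOrder_t_zpow (E := E') (-1))
    simpa [hw] using this
  obtain ⟨g, z, hgz⟩ := E'.exists_eq_t_pow_mul hπ hπ0 (k := 0) (n := 1) (x := (w : R))
    (by simpa using hw0.1)
  rw [pow_zero, one_mul, pow_one] at hgz
  have hg : IsUnit g := by
    rw [PowerSeries.isUnit_iff_constantCoeff, ← notMem_maximalIdeal]
    intro h
    apply hw0.2
    rw [hgz, map_add, Pi.add_apply, map_smul, Pi.smul_apply, coeff_ofPowerSeries, if_neg (by simp)]
    exact add_mem (by simpa using h)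
      (Ideal.mul_mem_right _ _ (hπ ▸ Ideal.mem_span_singleton_self π))
  obtain ⟨v, rfl⟩ := hg
  set a : R := E'.ofPowerSeries v with ha
  set b : R := E'.ofPowerSeries (↑v⁻¹ : PowerSeries O) with hb
  have hab : a * b = 1 := by rw [ha, hb, ← map_mul, Units.mul_inv, map_one]
  set h := b * z with hh
  have hwa : (w : R) = a * (1 + π • h) := by
    rw [hgz, mul_add, mul_one, mul_smul_comm, hh, ← mul_assoc, hab, one_mul]
  -- logarithmic derivatives
  have hwinv : (w : R) * ↑w⁻¹ = 1 := w.mul_inv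
  -- This is dlog(1 + πh), since a w⁻¹ is the inverse of 1 + πh.
  set y := a * ↑w⁻¹ * (π • E'.derivation h) with hy
  have h1 : E'.coeff y (-1) = 0 := by
    refine E'.coeff_neg_one_mul_of_dlog (h := h) hπ ?_
    rw [hy, ← mul_assoc, ← mul_assoc, mul_comm _ a, ← hwa, hwinv, one_mul]
  have h2 : E'.coeff (b * E'.derivation a) (-1) = 0 := by
    refine eq_of_forall_sub_mem_pow (I := maximalIdeal O) fun n => ?_
    rw [sub_zero]
    have hb0 : b ∈ E'.fil 0 n := fun i hi => by
      rw [hb, coeff_ofPowerSeries, if_pos hi]; exact zero_mem _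
    have ha0 : E'.derivation a ∈ E'.fil 0 n := fun i hi => by
      rw [coeff_derivation, ha, coeff_ofPowerSeries]
      split_ifs with hi'
      · rw [mul_zero]; exact zero_mem _
      · have : i = -1 := by omega
        subst this; simp
    exact mul_mem_fil E' hb0 ha0 (-1) (by simp)
  have h3 : E'.derivation (w : R) = (1 + π • h) * E'.derivation a + a * π • E'.derivation h := by
    rw [hwa, Derivation.leibniz, map_add, Derivation.map_one_eq_zero, zero_add,
      Derivation.map_smul, smul_eq_mul, smul_eq_mul, add_comm]
  have h4 : E.t = w * E'.t := by
    rw [hw, ← coe_unitT, ← coe_unitT, ← Units.val_mul]; simp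
  have h5 : (↑E.unitT⁻¹ : R) = ↑w⁻¹ * ↑E'.unitT⁻¹ := by
    rw [hw, ← Units.val_mul]; simp
  have h6 : (↑E.unitT⁻¹ : R) * E'.derivation E.t = ↑E'.unitT⁻¹ + (b * E'.derivation a + y) := by
    have h7 : (↑E'.unitT⁻¹ : R) * E'.t = 1 := by rw [← coe_unitT, Units.inv_mul]
    have h8 : (1 + π • h) * ↑w⁻¹ = b := by
      calc (1 + π • h) * ↑w⁻¹ = b * (a * (1 + π • h)) * ↑w⁻¹ := by
            rw [← mul_assoc, mul_comm b, hab, one_mul]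
        _ = b := by rw [← hwa, mul_assoc, hwinv, mul_one]
    rw [h5, h4, Derivation.leibniz, derivation_t, smul_eq_mul, smul_eq_mul, mul_one, h3, hy, ← h8]
    linear_combination ((1 + π • h) * ↑w⁻¹ * E'.derivation a + a * ↑w⁻¹ * π • E'.derivation h) * h7
      + (↑E'.unitT⁻¹ : R) * hwinv
  rw [h6, map_add, map_add, Pi.add_apply, Pi.add_apply, h1, h2, add_zero, add_zero]
  have := E'.coeff_unitT_zpow (-1)
  rw [zpow_neg_one] at this
  rw [this, Pi.single_eq_same]

/-- The coefficient of `t⁻¹` in `f` depends only on the differential form `f dt`. -/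
theorem coeff_neg_one_eq [Finite (ResidueField O)]
    (hπ : maximalIdeal O = Ideal.span {π}) (hπ0 : π ≠ 0) (f : R) :
    E.coeff f (-1) = E'.coeff (f * E'.derivation E.t) (-1) := by
  symm
  refine eq_of_forall_sub_mem_pow (I := maximalIdeal O) fun N => ?_
  obtain ⟨m1, hm1⟩ := E'.exists_mem_fil (E'.derivation E.t) N
  obtain ⟨C, hC⟩ := E.exists_t_pow_mul_mem_fil E' hπ hπ0 m1 N
  obtain ⟨m, hm⟩ := E.exists_mem_fil f N
  -- Modulo π^N, f is a Laurent polynomial in t plus a tail in t^C. By the choice of `C` the tail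
  -- times dt has no t'⁻¹ term modulo π^N. The lower bound -m - 1 ensures that the index -1 belongs
  -- to the range.
  have h0 : f - ∑ i ∈ Finset.Ico (-m - 1 : ℤ) C, E.coeff f i • ((E.unitT ^ i : Rˣ) : R) ∈ E.fil C N := by
    intro i hi
    rw [map_sub, map_sum, Pi.sub_apply, Finset.sum_apply]
    simp only [map_smul, Pi.smul_apply, coeff_unitT_zpow, Pi.single_apply, smul_eq_mul, mul_ite,
      mul_one, mul_zero, Finset.sum_ite_eq, Finset.mem_Ico]
    split_ifs with h
    · rw [sub_self]; exact zero_mem _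
    · rw [sub_zero]; exact hm i (by omega)
  obtain ⟨g, z, hgz⟩ := E.exists_eq_t_pow_mul hπ hπ0 h0
  rw [sub_eq_iff_eq_add] at hgz
  have h1 : ∀ i : ℤ, E'.coeff (((E.unitT ^ i : Rˣ) : R) * E'.derivation E.t) (-1) =
      if -1 = i then 1 else 0 := by
    intro i
    split_ifs with hi
    · subst hi
      rw [zpow_neg_one]
      exact E.coeff_neg_one_inv_mul_derivation_t E' hπ hπ0
    · rcases le_or_gt 0 i with h | h
      · obtain ⟨k, rfl⟩ := Int.eq_ofNat_of_zero_le h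
        simpa using E'.coeff_neg_one_pow_mul_derivation E.t k
      · obtain ⟨k, rfl⟩ : ∃ k : ℕ, i = -((k + 2 : ℕ) : ℤ) := ⟨(-i - 2).natAbs, by omega⟩
        rw [zpow_neg, zpow_natCast, ← inv_pow, Units.val_pow_eq_pow_val]
        simpa using E'.coeff_neg_one_inv_pow_mul_derivation E.unitT k
  have h2 : E'.coeff (E.t ^ C * E.ofPowerSeries g * E'.derivation E.t) (-1) ∈ maximalIdeal O ^ N :=
    mul_mem_fil E' (hC g) hm1 (-1) (by omega)
  rw [show f * E'.derivation E.t = _ * E'.derivation E.t from congrArg (· * E'.derivation E.t) hgz]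
  rw [add_mul, add_mul, Finset.sum_mul, map_add, map_add, map_sum, Pi.add_apply, Pi.add_apply,
    Finset.sum_apply]
  simp only [smul_mul_assoc, map_smul, Pi.smul_apply, h1]
  simp only [smul_eq_mul, mul_ite, mul_one, mul_zero, Finset.sum_ite_eq, Finset.mem_Ico]
  rw [if_pos (by omega), add_sub_cancel_right]
  refine add_mem h2 (Ideal.mul_mem_right _ _ (Ideal.pow_mem_pow (hπ ▸ Ideal.mem_span_singleton_self π) N))

end ChangeOfCoordinate

end DoubleExpansion
end Reciprocity

namespace Reciprocity

namespace DoubleExpansion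

/-! ### Recognition of double series as limits of Laurent series. -/

section Existence

variable {O R : Type*} [CommRing O] [CommRing R] [Algebra O R] {π : O} {Ψ : LaurentSeries O →+* R}

theorem dvd_coeff_of_dvd [IsDomain O] [IsDomain R] [FaithfulSMul O R] (hπ0 : π ≠ 0)
    (hC : ∀ a, Ψ (HahnSeries.C a) = algebraMap O R a)
    (h1 : ∀ s, algebraMap O R π ∣ Ψ s → ∃ s', s = HahnSeries.C π * s')
    (n : ℕ) {s : LaurentSeries O} (h : algebraMap O R π ^ n ∣ Ψ s) (i : ℤ) : π ^ n ∣ s.coeff i := by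
  induction n generalizing s with
  | zero => simp
  | succ n ih =>
    obtain ⟨s', rfl⟩ := h1 s ((dvd_pow_self _ n.succ_ne_zero).trans h)
    rw [map_mul, hC, pow_succ', mul_dvd_mul_iff_left (by
      simpa using (map_ne_zero_iff _ (FaithfulSMul.algebraMap_injective O R)).mpr hπ0)] at h
    rw [HahnSeries.C_mul_eq_smul, HahnSeries.coeff_smul, pow_succ', smul_eq_mul]
    exact mul_dvd_mul_left _ (ih h)

theorem exists_dvd_sub (hC : ∀ a, Ψ (HahnSeries.C a) = algebraMap O R a)
    (h2 : ∀ x, ∃ s, algebraMap O R π ∣ x - Ψ s) (n : ℕ) (x : R) :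
    ∃ s, algebraMap O R π ^ n ∣ x - Ψ s := by
  induction n generalizing x with
  | zero => exact ⟨0, by simp⟩
  | succ n ih =>
    obtain ⟨s, z, hz⟩ := h2 x
    obtain ⟨s', w, hw⟩ := ih z
    refine ⟨s + HahnSeries.C π * s', w, ?_⟩
    rw [map_add, map_mul, hC, ← sub_sub, hz, ← mul_sub, hw]
    ring

theorem dvd_of_forall_dvd_coeff [IsDomain O] (hπ0 : π ≠ 0)
    (hC : ∀ a, Ψ (HahnSeries.C a) = algebraMap O R a) {n : ℕ} {s : LaurentSeries O}
    (h : ∀ i, π ^ n ∣ s.coeff i) : algebraMap O R π ^ n ∣ Ψ s := by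
  choose b hb using h
  have hbs : BddBelow (Function.support b) := by
    refine ⟨s.order, fun i hi => ?_⟩
    by_contra! hlt
    have := hb i
    rw [HahnSeries.coeff_eq_zero_of_lt_order hlt] at this
    exact hi ((mul_eq_zero.mp this.symm).resolve_left (pow_ne_zero _ hπ0))
  refine ⟨Ψ (HahnSeries.ofSuppBddBelow b hbs), ?_⟩
  rw [← map_pow, ← hC, ← map_mul]
  congr 1
  ext i
  rw [HahnSeries.C_mul_eq_smul, HahnSeries.coeff_smul, hb]
  rfl

theorem coeff_mul_eq_finset_sum (s s' : LaurentSeries O) (i : ℤ) :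
    ∃ S : Finset ℤ, ∀ S' : Finset ℤ, S ⊆ S' →
      ∑ r ∈ S', s.coeff r * s'.coeff (i - r) = (s * s').coeff i := by
  classical
  rw [HahnSeries.coeff_mul]
  refine ⟨(Finset.antidiagonal s.isPWO_support s'.isPWO_support i).image Prod.fst,
    fun S' hS' => ?_⟩
  rw [← Finset.sum_subset hS', Finset.sum_image]
  · refine Finset.sum_congr rfl fun p hp => ?_
    rw [Finset.mem_antidiagonal] at hp
    rw [← hp.2.2, add_sub_cancel_left]
  · intro p hp p' hp' h
    have hp := Finset.mem_antidiagonal.mp (Finset.mem_coe.mp hp)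
    have hp' := Finset.mem_antidiagonal.mp (Finset.mem_coe.mp hp')
    ext
    · exact h
    · have := hp.2.2; have := hp'.2.2; omega
  · intro r _ hr
    by_contra h0
    apply hr
    rw [Finset.mem_image]
    exact ⟨(r, i - r), Finset.mem_antidiagonal.mpr
      ⟨left_ne_zero_of_mul h0, right_ne_zero_of_mul h0, by simp⟩, rfl⟩

/-- A complete ring which is approximated by Laurent series modulo `π` consists of double series. -/
theorem exists_doubleExpansion [IsLocalRing O] [IsDomain O] [IsAdicComplete (maximalIdeal O) O]
    [IsDomain R] [IsLocalRing R] [IsAdicComplete (maximalIdeal R) R] [FaithfulSMul O R]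
    (hπ : maximalIdeal O = Ideal.span {π}) (hπ0 : π ≠ 0)
    (hR : maximalIdeal R = Ideal.span {algebraMap O R π})
    (hC : ∀ a, Ψ (HahnSeries.C a) = algebraMap O R a)
    (h1 : ∀ s, algebraMap O R π ∣ Ψ s → ∃ s', s = HahnSeries.C π * s')
    (h2 : ∀ x, ∃ s, algebraMap O R π ∣ x - Ψ s) :
    ∃ E : DoubleExpansion O R, (∀ s : LaurentSeries O, E.coeff (Ψ s) = s.coeff) ∧
      E.t = Ψ (HahnSeries.single 1 1) := by
  classical
  set r := algebraMap O R π with hr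
  have memO : ∀ n (a : O), a ∈ maximalIdeal O ^ n ↔ π ^ n ∣ a := fun n a => by
    rw [hπ, Ideal.span_singleton_pow, Ideal.mem_span_singleton]
  have memR : ∀ n (a : R), a ∈ maximalIdeal R ^ n ↔ r ^ n ∣ a := fun n a => by
    rw [hR, Ideal.span_singleton_pow, Ideal.mem_span_singleton]
  have eqO : ∀ a b : O, (∀ n, π ^ n ∣ a - b) → a = b := fun a b h =>
    eq_of_forall_sub_mem_pow (I := maximalIdeal O) fun n => (memO _ _).mpr (h n)
  have eqR : ∀ a b : R, (∀ n, r ^ n ∣ a - b) → a = b := fun a b h =>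
    eq_of_forall_sub_mem_pow (I := maximalIdeal R) fun n => (memR _ _).mpr (h n)
  -- coefficients
  have ex : ∀ x : R, ∃ a : ℤ → O, ∀ n s, r ^ n ∣ x - Ψ s → ∀ i, π ^ n ∣ a i - s.coeff i := by
    intro x
    choose s hs using fun n => exists_dvd_sub (π := π) hC h2 n x
    have hco : ∀ m n s', m ≤ n → r ^ m ∣ x - Ψ s' → ∀ i, π ^ m ∣ s'.coeff i - (s n).coeff i := by
      intro m n s' hmn h i
      rw [← HahnSeries.coeff_sub]
      refine dvd_coeff_of_dvd hπ0 hC h1 m ?_ i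
      rw [map_sub]
      have := dvd_sub ((pow_dvd_pow _ hmn).trans (hs n)) h
      rwa [sub_sub_sub_cancel_left] at this
    have : ∀ i, ∃ L : O, ∀ n, π ^ n ∣ (s n).coeff i - L := by
      intro i
      obtain ⟨L, hL⟩ := IsPrecomplete.prec (I := maximalIdeal O) (M := O) inferInstance
        (f := fun n => (s n).coeff i) (fun {m n} hmn => by
          rw [SModEq.sub_mem, smul_eq_mul, Ideal.mul_top, memO]
          exact hco m n _ hmn (hs m) i)
      refine ⟨L, fun n => ?_⟩
      have := hL n
      rwa [SModEq.sub_mem, smul_eq_mul, Ideal.mul_top, memO] at this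
    choose a ha using this
    refine ⟨a, fun n s' h i => ?_⟩
    have e1 := hco n n s' le_rfl h i
    have e2 := ha i n
    rw [← dvd_neg]
    convert dvd_add e1 e2 using 1
    ring
  choose co hco using ex
  have approx : ∀ x n, ∃ s, r ^ n ∣ x - Ψ s ∧ ∀ i, π ^ n ∣ co x i - s.coeff i := fun x n => by
    obtain ⟨s, hs⟩ := exists_dvd_sub (π := π) hC h2 n x
    exact ⟨s, hs, hco x n s hs⟩
  -- Coefficients are characterized by Laurent approximations modulo every power of π; linearity and
  -- surjectivity are then checked by exhibiting approximations.
  have uniq : ∀ x a, (∀ n, ∃ s, r ^ n ∣ x - Ψ s ∧ ∀ i, π ^ n ∣ a i - s.coeff i) → co x = a := by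
    intro x a h
    ext i
    refine eqO _ _ fun n => ?_
    obtain ⟨s, hs, hs'⟩ := h n
    have := dvd_sub (hco x n s hs i) (hs' i)
    rwa [sub_sub_sub_cancel_right] at this
  have coΨ : ∀ s, co (Ψ s) = s.coeff := fun s => uniq _ _ fun n => ⟨s, by simp, by simp⟩
  refine ⟨{ coeff := { toFun := co, map_add' := fun x y => uniq _ _ fun n => ?_,
                       map_smul' := fun c x => uniq _ _ fun n => ?_ }
            injective := fun x y h => eqR _ _ fun n => ?_
            eventually_mem := fun x n => ?_
            exists_coeff_eq := fun a ha => ?_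
            coeff_mul := fun x y i n => ?_
            t := Ψ (HahnSeries.single 1 1)
            coeff_t := ?_ }, coΨ, rfl⟩
  · obtain ⟨s, hs, hs'⟩ := approx x n
    obtain ⟨u, hu, hu'⟩ := approx y n
    refine ⟨s + u, ?_, fun i => ?_⟩
    · convert dvd_add hs hu using 1
      rw [map_add]; ring
    · convert dvd_add (hs' i) (hu' i) using 1
      rw [HahnSeries.coeff_add, Pi.add_apply]; ring
  · obtain ⟨s, hs, hs'⟩ := approx x n
    refine ⟨HahnSeries.C c * s, ?_, fun i => ?_⟩
    · convert hs.mul_left (algebraMap O R c) using 1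
      rw [map_mul, hC, Algebra.smul_def]; ring
    · convert (hs' i).mul_left c using 1
      rw [HahnSeries.C_mul_eq_smul, HahnSeries.coeff_smul]
      simp [mul_sub]
  · obtain ⟨s, hs, hs'⟩ := approx x n
    obtain ⟨u, hu, hu'⟩ := approx y n
    have e : r ^ n ∣ Ψ (s - u) := by
      refine dvd_of_forall_dvd_coeff hπ0 hC fun i => ?_
      have e1 := dvd_sub (hu' i) (hs' i)
      have h4 : co x i = co y i := congrFun h i
      rwa [h4, sub_sub_sub_cancel_left, ← HahnSeries.coeff_sub] at e1
    rw [map_sub] at e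
    convert dvd_add (dvd_sub hs hu) e using 1
    ring
  · obtain ⟨s, hs, hs'⟩ := approx x n
    filter_upwards [Filter.eventually_lt_atBot s.order] with i hi
    have := hs' i
    rw [HahnSeries.coeff_eq_zero_of_lt_order hi, sub_zero] at this
    exact (memO _ _).mpr this
  · choose b hb using fun n => Filter.eventually_atBot.mp (ha n)
    -- Cutting off below `b n` discards only multiples of π^n, so the truncated series are Laurent
    -- series and form a Cauchy sequence.
    have hbs : ∀ n, BddBelow (Function.support fun i => if b n ≤ i then a i else 0) := fun n =>
      ⟨b n, fun i hi => by by_contra hlt; exact hi (if_neg hlt)⟩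
    let s : ℕ → LaurentSeries O := fun n => HahnSeries.ofSuppBddBelow _ (hbs n)
    have hs : ∀ n i, π ^ n ∣ a i - (s n).coeff i := by
      intro n i
      change π ^ n ∣ a i - if b n ≤ i then a i else 0
      split_ifs with h
      · simp
      · rw [sub_zero, ← memO]; exact hb n i (by omega)
    obtain ⟨L, hL⟩ := IsPrecomplete.prec (I := maximalIdeal R) (M := R) inferInstance
      (f := fun n => Ψ (s n)) (fun {m n} hmn => by
        rw [SModEq.sub_mem, smul_eq_mul, Ideal.mul_top, memR, ← map_sub]
        refine dvd_of_forall_dvd_coeff hπ0 hC fun i => ?_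
        have := dvd_sub ((pow_dvd_pow _ hmn).trans (hs n i)) (hs m i)
        rwa [sub_sub_sub_cancel_left] at this)
    refine ⟨L, uniq _ _ fun n => ⟨s n, ?_, hs n⟩⟩
    have := hL n
    rw [SModEq.sub_mem, smul_eq_mul, Ideal.mul_top, memR] at this
    rwa [dvd_sub_comm]
  · obtain ⟨s, hs, hs'⟩ := approx x n
    obtain ⟨u, hu, hu'⟩ := approx y n
    obtain ⟨S, hS⟩ := coeff_mul_eq_finset_sum s u i
    refine ⟨S, fun S' hS' => ?_⟩
    have e1 : r ^ n ∣ x * y - Ψ (s * u) := by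
      convert dvd_add (hs.mul_right y) (hu.mul_left (Ψ s)) using 1
      rw [map_mul]; ring
    have e2 := hco _ n _ e1 i
    rw [← hS S' hS'] at e2
    have e3 : π ^ n ∣ ∑ k ∈ S', co x k * co y (i - k) - ∑ k ∈ S', s.coeff k * u.coeff (i - k) := by
      rw [← Finset.sum_sub_distrib]
      refine Finset.dvd_sum fun k _ => ?_
      convert dvd_add ((hs' k).mul_right (co y (i - k))) ((hu' (i - k)).mul_left (s.coeff k)) using 1
      ring
    rw [memO]
    have := dvd_sub e3 e2
    rwa [sub_sub_sub_cancel_right] at this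
  · change co _ = _
    rw [coΨ]
    ext i
    rw [HahnSeries.coeff_single, Pi.single_apply]
    congr

end Existence

end DoubleExpansion
end Reciprocity

/-! ### The constants of the field of double series. -/

namespace Reciprocity

/-- Algebraic elements over a finite field are fixed by a power of Frobenius. -/
theorem exists_pow_card_eq {κ L : Type*} [Field κ] [Finite κ] [Field L] [Algebra κ L] {x : L}
    (hx : IsAlgebraic κ x) : ∃ q > 1, x ^ q = x := by
  have := IntermediateField.adjoin.finiteDimensional hx.isIntegral
  have : Finite (IntermediateField.adjoin κ {x}) := Module.finite_of_finite κ
  have := Fintype.ofFinite (IntermediateField.adjoin κ {x})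
  refine ⟨Fintype.card (IntermediateField.adjoin κ {x}), Fintype.one_lt_card, ?_⟩
  have := FiniteField.pow_card (⟨x, IntermediateField.mem_adjoin_simple_self κ x⟩ : IntermediateField.adjoin κ {x})
  simpa using congrArg Subtype.val this

namespace DoubleExpansion

variable {O R : Type*} [CommRing O] [IsDomain O] [IsDiscreteValuationRing O]
  [IsHausdorff (maximalIdeal O) O] [Finite (ResidueField O)]
  [CommRing R] [IsDomain R] [IsLocalRing R] [Algebra O R] [FaithfulSMul O R]
  {π : O}

section Constants

/-- The residue class of y is algebraic over the finite residue field of O, hence fixed by some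
power map. -/
theorem exists_pow_sub_eq_smul (hπ : maximalIdeal O = Ideal.span {π})
    (hR : maximalIdeal R = Ideal.span {algebraMap O R π}) {y : R} (hy : IsAlgebraic O y) :
    ∃ q > 1, ∃ z, y ^ q - y = π • z := by
  have hπ0 : π ≠ 0 := fun h => IsDiscreteValuationRing.not_a_field O (by rw [hπ, h]; simp)
  let f : O →+* ResidueField R := (residue R).comp (algebraMap O R)
  have hfπ : f π = 0 := by
    rw [RingHom.comp_apply, residue_eq_zero_iff, hR]
    exact Ideal.mem_span_singleton_self _
  have : IsLocalHom f := ⟨fun a ha => by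
    by_contra h
    have h1 : a ∈ maximalIdeal O := h
    rw [hπ, Ideal.mem_span_singleton] at h1
    obtain ⟨b, rfl⟩ := h1
    rw [map_mul, hfπ, zero_mul] at ha
    exact not_isUnit_zero ha⟩
  let : Algebra (ResidueField O) (ResidueField R) := (ResidueField.lift f).toAlgebra
  obtain ⟨p, hp0, hp⟩ := hy
  have hC : Irreducible (Polynomial.C π) := by
    refine Prime.irreducible (Polynomial.prime_C_iff.mpr ?_)
    exact ((IsDiscreteValuationRing.irreducible_iff_uniformizer π).mpr hπ).prime
  -- Removing the powers of π leaves an equation for y that stays nontrivial modulo π.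
  obtain ⟨n, p', hp', rfl⟩ := WfDvdMonoid.max_power_factor hp0 hC
  rw [map_mul, map_pow, Polynomial.aeval_C] at hp
  have hp1 : Polynomial.aeval y p' = 0 := (mul_eq_zero.mp hp).resolve_left
    (pow_ne_zero _ ((map_ne_zero_iff _ (FaithfulSMul.algebraMap_injective O R)).mpr hπ0))
  have hal : IsAlgebraic (ResidueField O) (residue R y) := by
    refine ⟨p'.map (residue O), fun h => hp' ?_, ?_⟩
    · rw [Polynomial.C_dvd_iff_dvd_coeff]
      intro i
      have := congrArg (fun p => p.coeff i) h
      simp only [Polynomial.coeff_map, Polynomial.coeff_zero, residue_eq_zero_iff, hπ,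
        Ideal.mem_span_singleton] at this
      exact this
    · rw [Polynomial.aeval_def, Polynomial.eval₂_map]
      have : (algebraMap (ResidueField O) (ResidueField R)).comp (residue O) = f := by
        ext a; exact ResidueField.lift_residue_apply (f := f) a
      rw [this, ← Polynomial.hom_eval₂]
      rw [Polynomial.aeval_def] at hp1
      rw [hp1, map_zero]
  obtain ⟨q, hq, h⟩ := exists_pow_card_eq hal
  refine ⟨q, hq, ?_⟩
  have h1 : y ^ q - y ∈ maximalIdeal R := by
    rw [← residue_eq_zero_iff, map_sub, map_pow, h, sub_self]
  rw [hR, Ideal.mem_span_singleton] at h1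
  obtain ⟨z, hz⟩ := h1
  exact ⟨z, by rw [hz, Algebra.smul_def]⟩

/-- From y^q ≡ y modulo π the order m satisfies q m = m, so it is 0 unless π divides y. Subtracting
the coefficient of index 0 keeps y algebraic but excludes order 0, so the difference is divisible by
π. -/
theorem exists_sub_algebraMap_eq_smul (E : DoubleExpansion O R) (hπ : maximalIdeal O = Ideal.span {π})
    (hR : maximalIdeal R = Ideal.span {algebraMap O R π}) {y : R} (hy : IsAlgebraic O y) :
    ∃ a z, y = algebraMap O R a + π • z := by
  have hπ0 : π ≠ 0 := fun h => IsDiscreteValuationRing.not_a_field O (by rw [hπ, h]; simp)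
  have key : ∀ y : R, IsAlgebraic O y → ∀ m, E.HasOrder y m → m = 0 := by
    intro y hy m hm
    obtain ⟨q, hq, z, hz⟩ := exists_pow_sub_eq_smul hπ hR hy
    have h1 : E.HasOrder (y ^ q) m := by
      refine hm.congr ?_
      rw [hz, ← pow_one π]
      exact pow_smul_mem_fil hπ _ _ _
    have h2 := h1.unique (hm.pow q)
    have h3 : ((q : ℤ) - 1) * m = 0 := by linarith
    exact (mul_eq_zero.mp h3).resolve_left (by omega)
  by_cases h0 : ∃ z, y = π • z
  · obtain ⟨z, hz⟩ := h0
    exact ⟨0, z, by simpa using hz⟩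
  obtain ⟨m, hm⟩ := exists_hasOrder (E := E) hπ hπ0 h0
  obtain rfl := key y hy m hm
  by_cases h1 : ∃ z, y - algebraMap O R (E.coeff y 0) = π • z
  · obtain ⟨z, hz⟩ := h1
    exact ⟨_, z, by rw [← hz]; ring⟩
  obtain ⟨m, hm'⟩ := exists_hasOrder (E := E) hπ hπ0 h1
  have h2 := key _ (hy.sub (isAlgebraic_algebraMap _)) m hm'
  subst h2
  exact absurd (by
    rw [map_sub, Pi.sub_apply, Algebra.algebraMap_eq_smul_one, map_smul, coeff_one]
    simp) hm'.2

/-- The base ring is algebraically closed in the ring of double series. -/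
theorem exists_eq_algebraMap (E : DoubleExpansion O R) (hπ : maximalIdeal O = Ideal.span {π})
    (hR : maximalIdeal R = Ideal.span {algebraMap O R π}) {y : R} (hy : IsAlgebraic O y) :
    ∃ a, y = algebraMap O R a := by
  have hπ0 : π ≠ 0 := fun h => IsDiscreteValuationRing.not_a_field O (by rw [hπ, h]; simp)
  have h : ∀ n : ℕ, ∀ y : R, IsAlgebraic O y → ∃ a z, y = algebraMap O R a + π ^ n • z := by
    intro n
    induction n with
    | zero => exact fun y _ => ⟨0, y, by simp⟩
    | succ n ih =>
      intro y hy
      obtain ⟨a, z, hz⟩ := E.exists_sub_algebraMap_eq_smul hπ hR hy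
      have hz' : IsAlgebraic O z := by
        have h1 : IsAlgebraic O (π • z) := by
          rw [show π • z = y - algebraMap O R a by rw [hz]; ring]
          exact hy.sub (isAlgebraic_algebraMap _)
        exact h1.of_smul (mem_nonZeroDivisors_of_ne_zero hπ0)
      obtain ⟨b, w, hw⟩ := ih z hz'
      refine ⟨a + π * b, w, ?_⟩
      rw [hz, hw, map_add, map_mul, smul_add, ← Algebra.smul_def, pow_succ', mul_smul, add_assoc]
  -- Being congruent to an element of O modulo each πⁿ forces all coefficients of nonzero index to
  -- vanish.
  refine ⟨E.coeff y 0, E.injective ?_⟩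
  ext i
  rw [Algebra.algebraMap_eq_smul_one, map_smul, coeff_one, Pi.smul_apply, smul_eq_mul]
  refine eq_of_forall_sub_mem_pow (I := maximalIdeal O) fun n => ?_
  obtain ⟨a, z, hz⟩ := h n y hy
  have h1 : ∀ i, E.coeff y i - a * Pi.single (M := fun _ => O) (0 : ℤ) (1 : O) i ∈ maximalIdeal O ^ n := by
    intro i
    rw [hz, Algebra.algebraMap_eq_smul_one, map_add, map_smul, map_smul, coeff_one, Pi.add_apply,
      Pi.smul_apply, Pi.smul_apply, smul_eq_mul, add_sub_cancel_left]
    exact Ideal.mul_mem_right _ _ (Ideal.pow_mem_pow (hπ ▸ Ideal.mem_span_singleton_self π) n)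
  by_cases hi : i = 0
  · subst hi; simp
  · have := h1 i
    rw [Pi.single_eq_of_ne hi, mul_zero] at this ⊢
    exact this

/-- `K` is algebraically closed in the field of double series. -/
theorem exists_algebraMap_eq_constField (E : DoubleExpansion O R) {K F : Type*} [Field K] [Algebra O K] [IsFractionRing O K]
    [Field F] [Algebra R F] [IsFractionRing R F] [Algebra O F] [IsScalarTower O R F]
    [Algebra K F] [IsScalarTower O K F] (hπ : maximalIdeal O = Ideal.span {π})
    (hR : maximalIdeal R = Ideal.span {algebraMap O R π})
    (hF : ∀ f : F, ∃ (n : ℕ) (x : R), algebraMap O F π ^ n * f = algebraMap R F x)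
    (a : constField K F) : ∃ b : K, algebraMap K (constField K F) b = a := by
  have hπ0 : π ≠ 0 := fun h => IsDiscreteValuationRing.not_a_field O (by rw [hπ, h]; simp)
  have ha : IsAlgebraic K (a : F) := mem_algebraicClosure_iff.mp a.2
  rw [← IsFractionRing.isAlgebraic_iff O K F] at ha
  obtain ⟨n, x, hx⟩ := hF a
  have h1 : IsAlgebraic O (algebraMap R F x) := by
    rw [← hx, ← map_pow, ← Algebra.smul_def]
    exact ha.smul _
  rw [isAlgebraic_algebraMap_iff (IsFractionRing.injective R F)] at h1
  obtain ⟨b, rfl⟩ := E.exists_eq_algebraMap hπ hR h1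
  refine ⟨algebraMap O K b / algebraMap O K π ^ n, Subtype.ext ?_⟩
  have h2 : algebraMap O F π ≠ 0 := by
    rw [IsScalarTower.algebraMap_apply O R F]
    simpa using hπ0
  change algebraMap K F _ = _
  rw [map_div₀, map_pow, ← IsScalarTower.algebraMap_apply, ← IsScalarTower.algebraMap_apply,
    IsScalarTower.algebraMap_apply O R F b, ← hx, mul_div_cancel_left₀ _ (pow_ne_zero _ h2)]

end Constants

/-! ### Generation of the differentials by dt in mixed characteristic. -/

section Differentials

open KaehlerDifferential

/-- Let q = |κ|. Modulo π and up to a power of t, x is a sum of terms t^j f^q, and d(f^q) = q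
f^(q-1) df lies in 𝔪Ω because q does. -/
theorem kaehlerD_mem_span_sup (E : DoubleExpansion O R) (hπ : maximalIdeal O = Ideal.span {π})
    (hR : maximalIdeal R = Ideal.span {algebraMap O R π}) (x : R) :
    D O R x ∈ (Submodule.span R {D O R E.t}) ⊔ maximalIdeal R • (⊤ : Submodule R Ω[R⁄O]) := by
  have hπ0 : π ≠ 0 := fun h => IsDiscreteValuationRing.not_a_field O (by rw [hπ, h]; simp)
  set W := (Submodule.span R {D O R E.t}) ⊔ maximalIdeal R • (⊤ : Submodule R Ω[R⁄O])
  have ht : D O R E.t ∈ W := Submodule.mem_sup_left (Submodule.mem_span_singleton_self _)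
  have hs : ∀ z : R, D O R (π • z) ∈ W := fun z => by
    rw [Derivation.map_smul, ← algebraMap_smul R]
    exact Submodule.mem_sup_right (Submodule.smul_mem_smul (hR ▸ Ideal.mem_span_singleton_self _)
      trivial)
  have hmul : ∀ x y : R, D O R x ∈ W → D O R y ∈ W → D O R (x * y) ∈ W := fun x y hx hy => by
    rw [Derivation.leibniz]
    exact add_mem (W.smul_mem _ hy) (W.smul_mem _ hx)
  have hpow : ∀ x : R, D O R (x ^ Nat.card (ResidueField O)) ∈ W := fun x => by
    rw [Derivation.leibniz_pow, ← Nat.cast_smul_eq_nsmul R]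
    refine Submodule.mem_sup_right (Submodule.smul_mem_smul ?_ trivial)
    have := natCast_card_mem (O := O)
    rw [hπ, Ideal.mem_span_singleton] at this
    rw [hR, Ideal.mem_span_singleton]
    simpa using (algebraMap O R).map_dvd this
  have hinv : D O R (↑E.unitT⁻¹ : R) ∈ W := by
    rw [Derivation.leibniz_of_mul_eq_one (b := (E.unitT : R)) _ E.unitT.inv_mul]
    exact W.smul_mem _ ht
  have hpw : ∀ (x : R) (n : ℕ), D O R x ∈ W → D O R (x ^ n) ∈ W := fun x n hx => by
    rw [Derivation.leibniz_pow]
    exact nsmul_mem (W.smul_mem _ hx) _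
  obtain ⟨m, hm⟩ := E.exists_mem_fil x 1
  have h0 : E.t ^ m * x ∈ E.fil (0 : ℕ) 1 := by
    intro i hi
    rw [coeff_t_pow_mul]
    exact hm _ (by omega)
  obtain ⟨g, z, hgz⟩ := E.exists_eq_t_pow_mul hπ hπ0 h0
  obtain ⟨f, g1, hg⟩ := exists_eq_sum_pow_card hπ 1 g
  have h1 : x = (↑E.unitT⁻¹ : R) ^ m * (E.t ^ m * x) := by
    rw [← mul_assoc, ← mul_pow, ← coe_unitT, Units.inv_mul, one_pow, one_mul]
  rw [h1]
  refine hmul _ _ (hpw _ _ hinv) ?_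
  rw [hgz, hg]
  simp only [pow_zero, one_mul, pow_one, map_add, map_mul, map_sum, map_pow, ofPowerSeries_X,
    ofPowerSeries_C, ← Algebra.smul_def]
  exact add_mem (add_mem (sum_mem fun j _ => hmul _ _ (hpw _ _ ht) (hpow _)) (hs _)) (hs _)

end Differentials

end DoubleExpansion
end Reciprocity

namespace Reciprocity

namespace DoubleExpansion

/-! ### Integral expansions versus coordinates of the field. -/

section Conversion

variable {O K R F : Type*} [CommRing O] [IsDomain O] [IsDiscreteValuationRing O] [IsHausdorff (maximalIdeal O) O]
  [Field K] [Algebra O K] [IsFractionRing O K]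
  [CommRing R] [IsDomain R] [Field F] [Algebra R F] [IsFractionRing R F]
  [Algebra O R] [FaithfulSMul O R] [Algebra O F] [IsScalarTower O R F]
  [Algebra K F] [IsScalarTower O K F] {π : O}

theorem algebraMap_constField_injective : Function.Injective (algebraMap O (constField K F)) := by
  rw [IsScalarTower.algebraMap_eq O K (constField K F)]
  exact (algebraMap K (constField K F)).injective.comp (IsFractionRing.injective O K)

theorem isIntegral_iff_exists (hK : ∀ a : constField K F, ∃ b : K, algebraMap K (constField K F) b = a)
    (a : constField K F) : IsIntegral O a ↔ ∃ b : O, algebraMap O (constField K F) b = a := by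
  constructor
  · intro h
    obtain ⟨b, rfl⟩ := hK a
    rw [isIntegral_algebraMap_iff (algebraMap K (constField K F)).injective] at h
    obtain ⟨c, rfl⟩ := IsIntegrallyClosed.isIntegral_iff.mp h
    exact ⟨c, IsScalarTower.algebraMap_apply O K (constField K F) c⟩
  · rintro ⟨b, rfl⟩
    exact isIntegral_algebraMap

theorem memMulIntegers_iff (hK : ∀ a : constField K F, ∃ b : K, algebraMap K (constField K F) b = a)
    (d : O) (a : constField K F) :
    MemMulIntegers O d a ↔ ∃ b : O, a = algebraMap O (constField K F) (d * b) := by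
  constructor
  · rintro ⟨b, hb, rfl⟩
    obtain ⟨c, rfl⟩ := (isIntegral_iff_exists hK b).mp hb
    exact ⟨c, by rw [map_mul]⟩
  · rintro ⟨b, rfl⟩
    exact ⟨algebraMap O _ b, isIntegral_algebraMap, by rw [map_mul]⟩

theorem memMulIntegers_algebraMap_iff (hπ : maximalIdeal O = Ideal.span {π})
    (hK : ∀ a : constField K F, ∃ b : K, algebraMap K (constField K F) b = a) (n : ℕ) (a : O) :
    MemMulIntegers O (π ^ n) (algebraMap O (constField K F) a) ↔ a ∈ maximalIdeal O ^ n := by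
  rw [memMulIntegers_iff hK, hπ, Ideal.span_singleton_pow, Ideal.mem_span_singleton]
  constructor
  · rintro ⟨b, hb⟩
    exact ⟨b, algebraMap_constField_injective hb⟩
  · rintro ⟨b, rfl⟩
    exact ⟨b, rfl⟩

/-- Once the constant field is K, its elements integral over O are those of O, and the
neighbourhoods d·O are cofinal with the powers of π. A coordinate of F thus restricts to an
expansion of R. -/
theorem _root_.Reciprocity.DoubleCoordinate.exists_doubleExpansion
    (hπ : maximalIdeal O = Ideal.span {π})
    (hK : ∀ a : constField K F, ∃ b : K, algebraMap K (constField K F) b = a)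
    (c : DoubleCoordinate O K R F) : ∃ E : DoubleExpansion O R, E.t = c.t ∧
      ∀ x i, c.coeff (algebraMap R F x) i = algebraMap O (constField K F) (E.coeff x i) := by
  have hπ0 : π ≠ 0 := fun h => IsDiscreteValuationRing.not_a_field O (by rw [hπ, h]; simp)
  have inj := algebraMap_constField_injective (O := O) (K := K) (F := F)
  choose co hco using fun x i => (isIntegral_iff_exists hK _).mp
    ((c.mem_integers_iff (algebraMap R F x)).mp ⟨x, rfl⟩ i)
  have hlin : ∀ (a : O) (f : F), c.coeff (a • f) = algebraMap O (constField K F) a • c.coeff f := by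
    intro a f
    rw [← map_smul]
    congr 1
    rw [Algebra.smul_def, Algebra.smul_def, IsScalarTower.algebraMap_apply O K F,
      IsScalarTower.algebraMap_apply O K (constField K F)]
    rfl
  refine ⟨{ coeff := { toFun := co, map_add' := fun x y => ?_, map_smul' := fun a x => ?_ }
            injective := fun x y h => ?_
            eventually_mem := fun x n => ?_
            exists_coeff_eq := fun a ha => ?_
            coeff_mul := fun x y i n => ?_
            t := c.t
            coeff_t := ?_ }, rfl, fun x i => (hco x i).symm⟩
  · ext i
    apply inj
    rw [hco, map_add, map_add, Pi.add_apply, Pi.add_apply, map_add, hco, hco]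
  · ext i
    apply inj
    rw [hco, RingHom.id_apply, Pi.smul_apply, smul_eq_mul, map_mul, hco, Algebra.smul_def, map_mul,
      ← IsScalarTower.algebraMap_apply, ← Algebra.smul_def, hlin]
    rfl
  · apply IsFractionRing.injective R F
    apply c.injective
    ext1 i
    rw [← hco, ← hco]
    exact congrArg _ (congrFun h i)
  · filter_upwards [((c.mem_range_iff _).mp ⟨algebraMap R F x, rfl⟩).2 (π ^ n) (pow_ne_zero _ hπ0)]
      with i hi
    rwa [← hco, memMulIntegers_algebraMap_iff hπ hK] at hi
  · obtain ⟨f, hf⟩ := (c.mem_range_iff fun i => algebraMap O (constField K F) (a i)).mpr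
      ⟨⟨1, one_ne_zero, fun i => by rw [map_one, one_mul]; exact isIntegral_algebraMap⟩,
       fun d hd => by
        obtain ⟨n, hn⟩ := IsDiscreteValuationRing.associated_pow_irreducible hd
          ((IsDiscreteValuationRing.irreducible_iff_uniformizer π).mpr hπ)
        filter_upwards [ha n] with i hi
        rw [hπ, Ideal.span_singleton_pow, Ideal.mem_span_singleton, ← hn.dvd_iff_dvd_left] at hi
        obtain ⟨b, hb⟩ := hi
        exact (memMulIntegers_iff hK _ _).mpr ⟨b, by rw [hb]⟩⟩
    obtain ⟨x, rfl⟩ := (c.mem_integers_iff f).mpr fun i => by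
      rw [hf]; exact isIntegral_algebraMap
    refine ⟨x, ?_⟩
    ext i
    apply inj
    have := congrFun hf i
    rwa [← hco] at this
  · obtain ⟨S, hS⟩ := c.coeff_mul (algebraMap R F x) (algebraMap R F y) i (π ^ n)
      (pow_ne_zero _ hπ0)
    refine ⟨S, fun S' hS' => ?_⟩
    have := hS S' hS'
    rw [← map_mul, ← hco] at this
    simp only [← hco] at this
    simp only [← map_mul, ← map_sum, ← map_sub] at this
    rwa [memMulIntegers_algebraMap_iff hπ hK] at this
  · ext i
    apply inj
    change algebraMap O (constField K F) (co c.t i) = _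
    rw [hco, c.coeff_variable, Pi.single_apply, Pi.single_apply]
    split_ifs <;> simp

theorem exists_pow_mul_eq (hπ : maximalIdeal O = Ideal.span {π}) (b : K) :
    ∃ (n : ℕ) (a : O), algebraMap O K π ^ n * b = algebraMap O K a := by
  obtain ⟨a, d, hd, rfl⟩ := IsFractionRing.div_surjective (A := O) b
  have hd0 := nonZeroDivisors.ne_zero hd
  obtain ⟨n, u, hn⟩ := IsDiscreteValuationRing.associated_pow_irreducible hd0
    ((IsDiscreteValuationRing.irreducible_iff_uniformizer π).mpr hπ)
  refine ⟨n, u * a, ?_⟩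
  have : algebraMap O K d ≠ 0 := by simpa using hd0
  rw [← map_pow, ← hn]
  field_simp
  simp only [map_mul]
  ring

variable (E : DoubleExpansion O R)

/-- The coefficients of f are those of π^n f ∈ R divided by π^n; cross-multiplication shows that the
choice of n is irrelevant. -/
theorem exists_linearMap (hπ : maximalIdeal O = Ideal.span {π})
    (hK : ∀ a : constField K F, ∃ b : K, algebraMap K (constField K F) b = a)
    (hF : ∀ f : F, ∃ (n : ℕ) (x : R), algebraMap O F π ^ n * f = algebraMap R F x) :
    ∃ co : F →ₗ[constField K F] (ℤ → constField K F),
      ∀ x i, co (algebraMap R F x) i = algebraMap O (constField K F) (E.coeff x i) := by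
  have hπ0 : π ≠ 0 := fun h => IsDiscreteValuationRing.not_a_field O (by rw [hπ, h]; simp)
  have inj := algebraMap_constField_injective (O := O) (K := K) (F := F)
  set j := algebraMap O (constField K F) with hj
  have hjπ : j π ≠ 0 := (map_ne_zero_iff _ inj).mpr hπ0
  choose N X hX using hF
  let co : F → ℤ → constField K F := fun f i => j (E.coeff (X f) i) / j π ^ N f
  have hco : ∀ f n y, algebraMap O F π ^ n * f = algebraMap R F y →
      ∀ i, co f i = j (E.coeff y i) / j π ^ n := by
    intro f n y h i
    have h1 : π ^ n • X f = π ^ N f • y := by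
      apply IsFractionRing.injective R F
      rw [Algebra.smul_def, Algebra.smul_def, map_mul, map_mul, ← h, ← hX,
        ← IsScalarTower.algebraMap_apply, ← IsScalarTower.algebraMap_apply, map_pow, map_pow]
      ring
    have h2 := congrArg (fun z => j (E.coeff z i)) h1
    simp only [map_smul, Pi.smul_apply, smul_eq_mul, map_mul, map_pow] at h2
    change j (E.coeff (X f) i) / j π ^ N f = _
    rw [div_eq_div_iff (pow_ne_zero _ hjπ) (pow_ne_zero _ hjπ)]
    linear_combination h2
  refine ⟨{ toFun := co, map_add' := fun f g => ?_, map_smul' := fun a f => ?_ }, fun x i => ?_⟩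
  · ext1 i
    rw [hco (f + g) (N f + N g) (π ^ N g • X f + π ^ N f • X g)]
    · change _ = j (E.coeff (X f) i) / j π ^ N f + j (E.coeff (X g) i) / j π ^ N g
      rw [map_add, Pi.add_apply, map_smul, map_smul, Pi.smul_apply, Pi.smul_apply, smul_eq_mul,
        smul_eq_mul, map_add, map_mul, map_mul, map_pow, map_pow, pow_add]
      field_simp
    · rw [map_add, Algebra.smul_def, Algebra.smul_def, map_mul, map_mul, ← hX, ← hX,
        ← IsScalarTower.algebraMap_apply, ← IsScalarTower.algebraMap_apply, map_pow, map_pow]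
      ring
  · ext1 i
    obtain ⟨b, rfl⟩ := hK a
    obtain ⟨n, c, hc⟩ := exists_pow_mul_eq (K := K) hπ b
    rw [RingHom.id_apply, Pi.smul_apply, smul_eq_mul, hco (algebraMap K (constField K F) b • f)
      (n + N f) (c • X f)]
    · change _ = _ * (j (E.coeff (X f) i) / j π ^ N f)
      have h1 := congrArg (algebraMap K (constField K F)) hc
      rw [map_mul, map_pow, ← IsScalarTower.algebraMap_apply, ← IsScalarTower.algebraMap_apply,
        ← hj] at h1
      rw [map_smul, Pi.smul_apply, smul_eq_mul, map_mul, pow_add, ← h1]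
      field_simp
    · have h1 := congrArg (algebraMap K F) hc
      rw [map_mul, map_pow, ← IsScalarTower.algebraMap_apply, ← IsScalarTower.algebraMap_apply] at h1
      rw [Algebra.smul_def, Algebra.smul_def, map_mul, ← hX, ← IsScalarTower.algebraMap_apply O R F, ← h1,
        ← IsScalarTower.algebraMap_apply K (constField K F) F]
      ring
  · change co _ i = _
    rw [hco _ 0 x (by simp)]
    simp

theorem exists_doubleCoordinate (hπ : maximalIdeal O = Ideal.span {π})
    (hK : ∀ a : constField K F, ∃ b : K, algebraMap K (constField K F) b = a)
    (hF : ∀ f : F, ∃ (n : ℕ) (x : R), algebraMap O F π ^ n * f = algebraMap R F x) :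
    ∃ c : DoubleCoordinate O K R F, c.t = E.t ∧
      ∀ x i, c.coeff (algebraMap R F x) i = algebraMap O (constField K F) (E.coeff x i) := by
  have hπ0 : π ≠ 0 := fun h => IsDiscreteValuationRing.not_a_field O (by rw [hπ, h]; simp)
  obtain ⟨co, hco⟩ := E.exists_linearMap (K := K) hπ hK hF
  have inj := algebraMap_constField_injective (O := O) (K := K) (F := F)
  set j := algebraMap O (constField K F) with hj
  have hsm : ∀ (a : O) (f : F), algebraMap O F a * f = j a • f := fun a f => by
    rw [Algebra.smul_def, hj, IsScalarTower.algebraMap_apply O K F,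
      IsScalarTower.algebraMap_apply O K (constField K F)]
    rfl
  have hlin : ∀ (a : O) (f : F) i, co (algebraMap O F a * f) i = j a * co f i := by
    intro a f i
    rw [hsm, map_smul]
    rfl
  have hjne : ∀ a : O, a ≠ 0 → j a ≠ 0 := fun a ha => (map_ne_zero_iff _ inj).mpr ha
  have hFne : ∀ a : O, a ≠ 0 → algebraMap O F a ≠ 0 := fun a ha => by
    rw [IsScalarTower.algebraMap_apply O K F]
    simpa using ha
  have hint : ∀ x : F, x ∈ Set.range (algebraMap R F) ↔ ∀ i, IsIntegral O (co x i) := by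
    intro f
    constructor
    · rintro ⟨x, rfl⟩ i
      rw [hco]
      exact isIntegral_algebraMap
    · intro h
      obtain ⟨n, x, hx⟩ := hF f
      have h1 : ∀ i, E.coeff x i ∈ maximalIdeal O ^ n := by
        intro i
        obtain ⟨b, hb⟩ := (isIntegral_iff_exists hK _).mp (h i)
        rw [hπ, Ideal.span_singleton_pow, Ideal.mem_span_singleton]
        refine ⟨b, inj ?_⟩
        rw [← hco, ← hx, ← map_pow, hlin, map_mul, ← hb]
      have : ∃ z, x = π ^ n • z := (E.forall_coeff_mem_iff hπ hπ0).mp h1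
      obtain ⟨z, rfl⟩ := this
      refine ⟨z, ?_⟩
      rw [Algebra.smul_def, map_mul, ← IsScalarTower.algebraMap_apply, map_pow] at hx
      exact (mul_left_cancel₀ (pow_ne_zero _ (hFne π hπ0)) hx).symm
  have hcofin : ∀ (d : O), d ≠ 0 → ∃ n u, π ^ n = d * u := fun d hd => by
    obtain ⟨n, u, hn⟩ := IsDiscreteValuationRing.associated_pow_irreducible hd
      ((IsDiscreteValuationRing.irreducible_iff_uniformizer π).mpr hπ)
    exact ⟨n, u, hn.symm⟩
  refine ⟨{ coeff := co
            injective := ?_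
            mem_range_iff := fun a => ⟨?_, ?_⟩
            coeff_mul := fun f g i d hd => ?_
            mem_integers_iff := hint
            t := E.t
            coeff_variable := ?_ }, rfl, hco⟩
  · rw [injective_iff_map_eq_zero]
    intro f hf
    obtain ⟨n, x, hx⟩ := hF f
    have h1 : x = 0 := by
      apply E.injective
      ext i
      apply inj
      rw [← hco, ← hx, ← map_pow, hlin, hf, map_zero]
      simp
    rw [h1, map_zero] at hx
    exact (mul_eq_zero.mp hx).resolve_left (pow_ne_zero _ (hFne π hπ0))
  · rintro ⟨f, rfl⟩
    obtain ⟨n, x, hx⟩ := hF f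
    rw [← map_pow] at hx
    have h1 : ∀ i, j (π ^ n) * co f i = j (E.coeff x i) := fun i => by
      rw [← hlin, hx, hco]
    refine ⟨⟨π ^ n, pow_ne_zero _ hπ0, fun i => ?_⟩, fun d hd => ?_⟩
    · rw [← hj, h1]; exact isIntegral_algebraMap
    · obtain ⟨m, u, hu⟩ := hcofin d hd
      filter_upwards [E.eventually_mem x (m + n)] with i hi
      rw [hπ, Ideal.span_singleton_pow, Ideal.mem_span_singleton] at hi
      obtain ⟨b, hb⟩ := hi
      rw [memMulIntegers_iff hK]
      refine ⟨u * b, mul_left_cancel₀ (hjne _ (pow_ne_zero n hπ0)) ?_⟩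
      rw [h1, hb, ← hj, ← map_mul]
      congr 1
      rw [pow_add, hu]
      ring
  · rintro ⟨⟨d, hd, h1⟩, h2⟩
    choose b hb using fun i => (isIntegral_iff_exists hK _).mp (h1 i)
    obtain ⟨x, hx⟩ := E.exists_coeff_eq b fun n => by
      filter_upwards [h2 (π ^ n) (pow_ne_zero _ hπ0)] with i hi
      obtain ⟨c, hc⟩ := (memMulIntegers_iff hK _ _).mp hi
      rw [hπ, Ideal.span_singleton_pow, Ideal.mem_span_singleton]
      refine ⟨d * c, inj ?_⟩
      rw [hb, hc, ← map_mul]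
      congr 1
      ring
    refine ⟨(algebraMap O F d)⁻¹ * algebraMap R F x, ?_⟩
    ext1 i
    refine mul_left_cancel₀ (hjne d hd) ?_
    rw [← hlin, mul_inv_cancel_left₀ (hFne d hd), hco, hx]
    exact hb i
  · obtain ⟨m, x, hx⟩ := hF f
    obtain ⟨n, y, hy⟩ := hF g
    obtain ⟨l, u, hu⟩ := hcofin d hd
    obtain ⟨S, hS⟩ := E.coeff_mul x y i (l + (m + n))
    rw [← map_pow] at hx hy
    have h1 : ∀ i, j (π ^ m) * co f i = j (E.coeff x i) := fun i => by rw [← hlin, hx, hco]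
    have h2 : ∀ i, j (π ^ n) * co g i = j (E.coeff y i) := fun i => by rw [← hlin, hy, hco]
    have h3 : j (π ^ (m + n)) * co (f * g) i = j (E.coeff (x * y) i) := by
      rw [← hlin, ← hco, (algebraMap R F).map_mul, ← hx, ← hy, pow_add, (algebraMap O F).map_mul]
      refine congrFun (congrArg co ?_) i
      ring
    refine ⟨S, fun S' hS' => ?_⟩
    have h4 := hS S' hS'
    rw [hπ, Ideal.span_singleton_pow, Ideal.mem_span_singleton] at h4
    obtain ⟨b, hb⟩ := h4
    rw [memMulIntegers_iff hK]
    refine ⟨u * b, mul_left_cancel₀ (hjne _ (pow_ne_zero (m + n) hπ0)) ?_⟩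
    rw [mul_sub, h3, Finset.mul_sum]
    have h5 : ∀ r, j (π ^ (m + n)) * (co f r * co g (i - r)) = j (E.coeff x r * E.coeff y (i - r)) := by
      intro r
      rw [map_mul j (E.coeff x r), ← h1, ← h2, pow_add, map_mul]
      ring
    simp only [h5]
    rw [← map_sum, ← map_sub, hb, ← hj, ← map_mul, pow_add, hu]
    congr 1
    ring
  · ext1 i
    rw [hco, E.coeff_t, Pi.single_apply, Pi.single_apply]
    split_ifs <;> simp

end Conversion

end DoubleExpansion
end Reciprocity

namespace Reciprocity

namespace DoubleExpansion

/-! ### The residue in mixed characteristic. -/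

section Residue

variable {O K R F : Type*} [CommRing O] [IsDomain O] [IsDiscreteValuationRing O] [CharZero O]
  [IsHausdorff (maximalIdeal O) O] [Finite (ResidueField O)]
  [Field K] [Algebra O K] [IsFractionRing O K]
  [CommRing R] [IsDomain R] [IsLocalRing R] [Field F] [Algebra R F] [IsFractionRing R F]
  [Algebra O R] [FaithfulSMul O R] [Algebra O F] [IsScalarTower O R F]
  [Algebra K F] [IsScalarTower O K F] {π : O}

theorem not_charZero_residueField (hπ : maximalIdeal O = Ideal.span {π})
    (hR : maximalIdeal R = Ideal.span {algebraMap O R π}) : ¬ CharZero (ResidueField R) := by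
  intro h
  have h1 := natCast_card_mem (O := O)
  rw [hπ, Ideal.mem_span_singleton] at h1
  have h2 : (Nat.card (ResidueField O) : R) ∈ maximalIdeal R := by
    rw [hR, Ideal.mem_span_singleton]
    simpa using (algebraMap O R).map_dvd h1
  rw [← residue_eq_zero_iff, map_natCast, Nat.cast_eq_zero] at h2
  exact Nat.card_pos.ne' h2

/-- In mixed characteristic, the residue does not depend on the coordinate. -/
theorem isLocalResidue_iff [IsNoetherianRing R] (E : DoubleExpansion O R)
    (hπ : maximalIdeal O = Ideal.span {π})
    (hR : maximalIdeal R = Ideal.span {algebraMap O R π})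
    (hF : ∀ f : F, ∃ (n : ℕ) (x : R), algebraMap O F π ^ n * f = algebraMap R F x)
    {ω : CtsDiff O R F} {n : ℕ} {x : R}
    (hx : algebraMap O F π ^ n * ctsLift F E.derivation ω = algebraMap R F x)
    (r : constField K F) :
    IsLocalResidue O K R F ω r ↔ algebraMap O (constField K F) (π ^ n) * r =
      -algebraMap O (constField K F) (E.coeff x (-1)) := by
  have hπ0 : π ≠ 0 := fun h => IsDiscreteValuationRing.not_a_field O (by rw [hπ, h]; simp)
  have hK : ∀ a : constField K F, ∃ b : K, algebraMap K (constField K F) b = a :=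
    E.exists_algebraMap_eq_constField hπ hR hF
  have inj := algebraMap_constField_injective (O := O) (K := K) (F := F)
  have hsm : ∀ (a : O) (f : F), algebraMap O F a * f = algebraMap O (constField K F) a • f :=
    fun a f => by
      rw [Algebra.smul_def, IsScalarTower.algebraMap_apply O K F,
        IsScalarTower.algebraMap_apply O K (constField K F)]
      rfl
  have hlin : ∀ (c : DoubleCoordinate O K R F) (a : O) (f : F) i,
      c.coeff (algebraMap O F a * f) i = algebraMap O (constField K F) a * c.coeff f i := by
    intro c a f i
    rw [hsm, map_smul]
    rfl
  have main : ∀ (c : DoubleCoordinate O K R F) (f : F), ω = f • ctsD O F c.t →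
      algebraMap O (constField K F) (π ^ n) * c.coeff f (-1) =
        algebraMap O (constField K F) (E.coeff x (-1)) := by
    rintro c f rfl
    obtain ⟨E', hE', hco⟩ := c.exists_doubleExpansion hπ hK
    obtain ⟨k, y, hy⟩ := hF f
    rw [map_smul, ctsLift_ctsD, smul_eq_mul, ← hE'] at hx
    have h1 : π ^ k • x = π ^ n • (y * E.derivation E'.t) := by
      apply IsFractionRing.injective R F
      rw [Algebra.smul_def, Algebra.smul_def, map_mul, map_mul, map_mul, ← hx, ← hy,
        ← IsScalarTower.algebraMap_apply O R F, ← IsScalarTower.algebraMap_apply O R F, map_pow,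
        map_pow]
      ring
    -- This is where invariance under the change from `E'` to `E` is used.
    have h2 : π ^ k * E.coeff x (-1) = π ^ n * E'.coeff y (-1) := by
      rw [E'.coeff_neg_one_eq E hπ hπ0]
      have := congrArg (fun z => E.coeff z (-1)) h1
      simpa using this
    have h3 : algebraMap O (constField K F) (π ^ k) * c.coeff f (-1) =
        algebraMap O (constField K F) (E'.coeff y (-1)) := by
      rw [← hlin, map_pow, hy, hco]
    refine mul_left_cancel₀ ((map_ne_zero_iff _ inj).mpr (pow_ne_zero k hπ0)) ?_
    rw [mul_left_comm, h3, ← map_mul, ← map_mul, h2]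
  constructor
  · rintro (⟨h, -⟩ | ⟨-, c, f, hω, rfl⟩)
    · exact absurd h (not_charZero_residueField hπ hR)
    · rw [mul_neg, main c f hω]
  · intro h
    obtain ⟨c, hc, -⟩ := E.exists_doubleCoordinate (K := K) hπ hK hF
    have hω := eq_ctsLift_smul_ctsD F E.derivation_t (E.kaehlerD_mem_span_sup hπ hR) ω
    rw [← hc] at hω
    refine Or.inr ⟨not_charZero_residueField hπ hR, c, _, hω, ?_⟩
    refine mul_left_cancel₀ ((map_ne_zero_iff _ inj).mpr (pow_ne_zero n hπ0)) ?_
    rw [h, mul_neg, main c _ hω]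

end Residue

end DoubleExpansion
end Reciprocity

namespace Reciprocity

/-! ### Weierstrass division and the primes of O⟦T⟧. -/

section Weierstrass

variable {O B : Type*} [CommRing O] [IsDomain O] [IsDiscreteValuationRing O]
  [IsAdicComplete (maximalIdeal O) O] [CommRing B] [Algebra O B]
  (e : PowerSeries O ≃ₐ[O] B) {π : O}

/-- The parameter of `B` given by an isomorphism with the ring of power series. -/
noncomputable def parameter : B := e PowerSeries.X

theorem aeval_parameter (p : Polynomial O) : Polynomial.aeval (parameter e) p = e p := by
  induction p using Polynomial.induction_on' with
  | add p q hp hq => rw [map_add, hp, hq, Polynomial.coe_add, map_add]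
  | monomial n a =>
    rw [Polynomial.aeval_monomial, Polynomial.coe_monomial, PowerSeries.monomial_eq_C_mul_X_pow,
      map_mul, map_pow, ← e.commutes]
    rfl

theorem coe_map_residue_ne_zero {Q : Polynomial O} (hQ : Q.IsDistinguishedAt (maximalIdeal O)) :
    PowerSeries.map (residue O) (Q : PowerSeries O) ≠ 0 :=
  hQ.map_ne_zero_of_eq_mul (h := 1) _ (by simp) (by simp)

theorem order_toNat_eq_natDegree {Q : Polynomial O} (hQ : Q.IsDistinguishedAt (maximalIdeal O)) :
    (PowerSeries.map (Ideal.Quotient.mk (maximalIdeal O)) (Q : PowerSeries O)).order.toNat =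
      Q.natDegree := by
  have h := hQ.coe_natDegree_eq_order_map (Q : PowerSeries O) 1 (by simp) (by simp)
  rw [← h, ENat.toNat_natCast]

theorem exists_eq_aeval_mul_add {Q : Polynomial O} (hQ : Q.IsDistinguishedAt (maximalIdeal O))
    (b : B) : ∃ (q : B) (r : Polynomial O), r.degree < Q.natDegree ∧
      b = Polynomial.aeval (parameter e) Q * q + Polynomial.aeval (parameter e) r := by
  obtain ⟨q, r, h⟩ := PowerSeries.exists_isWeierstrassDivision (e.symm b) (coe_map_residue_ne_zero hQ)
  refine ⟨e q, r, ?_, ?_⟩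
  · have := h.degree_lt
    rwa [order_toNat_eq_natDegree hQ] at this
  · rw [aeval_parameter, aeval_parameter, ← map_mul, ← map_add, ← h.eq_mul_add,
      AlgEquiv.apply_symm_apply]

/-- Uniqueness of Weierstrass division: a nonzero polynomial of degree less than deg Q is not
divisible by Q in B. -/
theorem eq_zero_of_aeval_mul_eq {Q r : Polynomial O} (hQ : Q.IsDistinguishedAt (maximalIdeal O))
    (hr : r.degree < Q.natDegree) {q : B}
    (h : Polynomial.aeval (parameter e) Q * q = Polynomial.aeval (parameter e) r) :
    q = 0 ∧ r = 0 := by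
  rw [aeval_parameter, aeval_parameter, ← e.apply_symm_apply q, ← map_mul] at h
  have h1 := (hQ.isWeierstrassDivisorAt').eq_zero_of_mul_eq
    (by rwa [order_toNat_eq_natDegree hQ]) (e.injective h)
  exact ⟨by rw [← e.apply_symm_apply q, h1.1, map_zero], h1.2⟩

/-- The derivation `d/dT` of `B`. -/
noncomputable def paramDerivation : Derivation O B B :=
  Derivation.mk' ((e.toLinearMap.comp (PowerSeries.derivative O).toLinearMap).comp
    e.symm.toLinearMap) fun a b => by
      simp

theorem paramDerivation_apply (f : PowerSeries O) :
    paramDerivation e (e f) = e (PowerSeries.derivative O f) := by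
  change e (PowerSeries.derivative O (e.symm (e f))) = _
  rw [AlgEquiv.symm_apply_apply]

theorem paramDerivation_parameter : paramDerivation e (parameter e) = 1 := by
  rw [parameter, paramDerivation_apply, PowerSeries.derivative_X, map_one]

variable [IsDomain B]

/-- Divisibility by π is vanishing of the reduction, and the power series over the residue field
form a domain. -/
theorem prime_algebraMap (e : PowerSeries O ≃ₐ[O] B) (hπ : maximalIdeal O = Ideal.span {π}) : Prime (algebraMap O B π) := by
  have hπ' : Irreducible π := (IsDiscreteValuationRing.irreducible_iff_uniformizer π).mpr hπ
  have h1 : algebraMap O B π = e (PowerSeries.C π) := by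
    rw [← e.commutes]; rfl
  rw [h1, MulEquiv.prime_iff]
  refine ⟨fun h => hπ'.ne_zero ?_, fun h => hπ'.not_isUnit ?_, fun a b hab => ?_⟩
  · simpa using congrArg PowerSeries.constantCoeff h
  · simpa using h.map PowerSeries.constantCoeff
  · rw [C_dvd_iff hπ, map_mul, mul_eq_zero] at hab
    rwa [C_dvd_iff hπ, C_dvd_iff hπ]

/-- A prime that π does not divide has nonzero reduction, and Weierstrass preparation makes it a
distinguished polynomial times a unit. -/
theorem associated_of_prime (e : PowerSeries O ≃ₐ[O] B) (hπ : maximalIdeal O = Ideal.span {π}) {p : B} (hp : Prime p) :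
    Associated p (algebraMap O B π) ∨ ∃ Q : Polynomial O, Q.IsDistinguishedAt (maximalIdeal O) ∧
      Associated p (Polynomial.aeval (parameter e) Q) := by
  have h1 : algebraMap O B π = e (PowerSeries.C π) := by
    rw [← e.commutes]; rfl
  by_cases h : algebraMap O B π ∣ p
  · exact Or.inl ((prime_algebraMap e hπ).associated_of_dvd hp h).symm
  · right
    have h2 : PowerSeries.map (residue O) (e.symm p) ≠ 0 := by
      rw [Ne, ← C_dvd_iff hπ]
      rintro ⟨f, hf⟩
      exact h ⟨e f, by rw [h1, ← map_mul, ← hf, AlgEquiv.apply_symm_apply]⟩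
    obtain ⟨Q, u, hu⟩ := PowerSeries.exists_isWeierstrassFactorization h2
    refine ⟨Q, hu.isDistinguishedAt, Associated.symm ?_⟩
    obtain ⟨u', hu'⟩ := hu.isUnit.map e
    refine ⟨u', ?_⟩
    rw [hu', aeval_parameter, ← map_mul, ← hu.eq_mul, AlgEquiv.apply_symm_apply]

theorem uniqueFactorizationMonoid_of_equiv (e : PowerSeries O ≃ₐ[O] B) : UniqueFactorizationMonoid B :=
  e.toMulEquiv.uniqueFactorizationMonoid inferInstance

/-- Division by Q makes the class of T generate the quotient over O, and T is a root of the monic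
polynomial Q there. -/
theorem isIntegral_quotient {Q : Polynomial O} (hQ : Q.IsDistinguishedAt (maximalIdeal O))
    {P : Ideal B} (hP : Polynomial.aeval (parameter e) Q ∈ P) : Algebra.IsIntegral O (B ⧸ P) := by
  refine ⟨fun x => ?_⟩
  obtain ⟨b, rfl⟩ := Ideal.Quotient.mk_surjective x
  obtain ⟨q, r, -, rfl⟩ := exists_eq_aeval_mul_add e hQ b
  have hT : IsIntegral O (Ideal.Quotient.mk P (parameter e)) := by
    refine ⟨Q, hQ.monic, ?_⟩
    have h : Ideal.Quotient.mkₐ O P (Polynomial.aeval (parameter e) Q) = 0 :=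
      Ideal.Quotient.eq_zero_iff_mem.mpr hP
    rwa [← Polynomial.aeval_algHom_apply] at h
  rw [map_add, map_mul, Ideal.Quotient.eq_zero_iff_mem.mpr hP, zero_mul, zero_add]
  have h : Ideal.Quotient.mk P (Polynomial.aeval (parameter e) r) =
      Polynomial.aeval (Ideal.Quotient.mk P (parameter e)) r :=
    (Polynomial.aeval_algHom_apply (Ideal.Quotient.mkₐ O P) _ r).symm
  rw [h]
  exact IsIntegral.of_mem_of_fg _ hT.fg_adjoin_singleton _ (Polynomial.aeval_mem_adjoin_singleton _ _)

/-- In the domain B/(Q), integral over O, the nonzero ideal generated by b meets O in a nonzero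
ideal. This Bézout identity is the source of partial fractions. -/
theorem exists_mul_add_mul_eq_algebraMap {Q : Polynomial O}
    (hQ : Q.IsDistinguishedAt (maximalIdeal O)) (hp : Prime (Polynomial.aeval (parameter e) Q))
    {b : B} (hb : ¬ Polynomial.aeval (parameter e) Q ∣ b) :
    ∃ (u v : B) (c : O), c ≠ 0 ∧ Polynomial.aeval (parameter e) Q * u + b * v = algebraMap O B c := by
  set P := Ideal.span {Polynomial.aeval (parameter e) Q}
  have hP : P.IsPrime := (Ideal.span_singleton_prime hp.ne_zero).mpr hp
  have := isIntegral_quotient e hQ (P := P) (Ideal.mem_span_singleton_self _)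
  have hb0 : Ideal.Quotient.mk P b ≠ 0 := by
    rwa [Ne, Ideal.Quotient.eq_zero_iff_mem, Ideal.mem_span_singleton]
  have h1 := Ideal.comap_ne_bot_of_integral_mem (R := O) hb0
    (Ideal.mem_span_singleton_self _) (Algebra.IsIntegral.isIntegral (R := O) _)
  obtain ⟨c, hc, hc0⟩ := Submodule.exists_mem_ne_zero_of_ne_bot h1
  rw [Ideal.mem_comap, Ideal.mem_span_singleton] at hc
  obtain ⟨z, hz⟩ := hc
  obtain ⟨v, rfl⟩ := Ideal.Quotient.mk_surjective z
  have h2 : algebraMap O B c - b * v ∈ P := by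
    rw [← Ideal.Quotient.eq, map_mul, ← hz]
    rfl
  rw [Ideal.mem_span_singleton] at h2
  obtain ⟨u, hu⟩ := h2
  exact ⟨u, v, c, hc0, by rw [← hu]; ring⟩

end Weierstrass
end Reciprocity

namespace Reciprocity

/-! ### Derivations and residue fields at the primes (Q). -/

section Abstract

variable {O K B R : Type*} [CommRing O] [IsDomain O] [IsDiscreteValuationRing O]
  [IsAdicComplete (maximalIdeal O) O] [Field K] [Algebra O K] [IsFractionRing O K]
  [CommRing B] [IsDomain B] [Algebra O B] [CommRing R] [IsLocalRing R] [Algebra O R] [Algebra B R]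
  [IsScalarTower O B R]

/-- The two derivations agree on polynomials in T. Dividing b by Qⁿ leaves a polynomial plus a
multiple of Qⁿ, on which their difference lies in 𝔪ⁿ; being in every 𝔪ⁿ, it is zero. -/
theorem derivation_algebraMap_eq [IsHausdorff (maximalIdeal R) R] (e : PowerSeries O ≃ₐ[O] B)
    {Q : Polynomial O} (hQ : Q.IsDistinguishedAt (maximalIdeal O))
    (hm : algebraMap B R (Polynomial.aeval (parameter e) Q) ∈ maximalIdeal R)
    (D : Derivation O R R) (b : B) :
    D (algebraMap B R b) = algebraMap B R (paramDerivation e b) * D (algebraMap B R (parameter e)) := by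
  let δ : Derivation O B R := D.compAlgebraMap B -
    D (algebraMap B R (parameter e)) • (Algebra.linearMap B R).compDer (paramDerivation e)
  have hδ : ∀ b, δ b = D (algebraMap B R b) -
      D (algebraMap B R (parameter e)) * algebraMap B R (paramDerivation e b) := fun b => rfl
  have hT : δ (parameter e) = 0 := by
    rw [hδ, paramDerivation_parameter, map_one, mul_one, sub_self]
  have hp : ∀ p : Polynomial O, δ (Polynomial.aeval (parameter e) p) = 0 := fun p => by
    rw [Derivation.map_aeval, hT, smul_zero]
  have h0 : δ b = 0 := by
    refine eq_of_forall_sub_mem_pow (I := maximalIdeal R) fun n => ?_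
    have hQn : (Q ^ n).IsDistinguishedAt (maximalIdeal O) := by
      induction n with
      | zero => exact ⟨⟨fun h => by simp at h⟩, by simp⟩
      | succ n ih => rw [pow_succ]; exact ih.mul hQ
    obtain ⟨q, r, -, hb⟩ := exists_eq_aeval_mul_add e hQn b
    rw [sub_zero, hb, map_add, Derivation.leibniz, hp, hp, smul_zero, add_zero, add_zero,
      Algebra.smul_def, map_pow, map_pow]
    exact Ideal.mul_mem_right _ _ (Ideal.pow_mem_pow hm n)
  rw [hδ, sub_eq_zero] at h0
  rw [h0, mul_comm]

theorem isIntegral_residue_algebraMap (e : PowerSeries O ≃ₐ[O] B)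
    {Q : Polynomial O} (hQ : Q.IsDistinguishedAt (maximalIdeal O))
    (hm : algebraMap B R (Polynomial.aeval (parameter e) Q) ∈ maximalIdeal R) (b : B) :
    IsIntegral O (residue R (algebraMap B R b)) := by
  obtain ⟨p, hp, h1⟩ := (isIntegral_quotient e hQ
    (P := (maximalIdeal R).comap (algebraMap B R)) hm).isIntegral (Ideal.Quotient.mk _ b)
  let g : B ⧸ (maximalIdeal R).comap (algebraMap B R) →+* ResidueField R :=
    Ideal.Quotient.lift _ ((residue R).comp (algebraMap B R)) fun a ha =>
      (residue_eq_zero_iff _).mpr ha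
  refine ⟨p, hp, ?_⟩
  have h2 := congrArg g h1
  rw [Polynomial.hom_eval₂, map_zero] at h2
  have h3 : g.comp (algebraMap O (B ⧸ (maximalIdeal R).comap (algebraMap B R))) =
      algebraMap O (ResidueField R) := by
    ext a
    change residue R (algebraMap B R (algebraMap O B a)) = residue R (algebraMap O R a)
    rw [← IsScalarTower.algebraMap_apply]
  rwa [h3] at h2

/-- Every residue class is a quotient of classes of elements of B, and these are integral over O. -/
theorem isAlgebraic_residueField [Algebra K R] [IsScalarTower O K R] (e : PowerSeries O ≃ₐ[O] B)
    {Q : Polynomial O} (hQ : Q.IsDistinguishedAt (maximalIdeal O))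
    (hm : algebraMap B R (Polynomial.aeval (parameter e) Q) ∈ maximalIdeal R)
    (h : ∀ x : R, ∃ b s : B, algebraMap B R s ∉ maximalIdeal R ∧
      algebraMap B R s * x - algebraMap B R b ∈ maximalIdeal R) :
    Algebra.IsAlgebraic K (ResidueField R) := by
  refine ⟨fun x => ?_⟩
  obtain ⟨x, rfl⟩ := residue_surjective x
  obtain ⟨b, s, hs, hb⟩ := h x
  have hs0 : residue R (algebraMap B R s) ≠ 0 := by rwa [Ne, residue_eq_zero_iff]
  rw [← residue_eq_zero_iff, map_sub, map_mul, sub_eq_zero] at hb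
  have h1 : residue R x = residue R (algebraMap B R b) * (residue R (algebraMap B R s))⁻¹ := by
    rw [← hb, mul_comm, inv_mul_cancel_left₀ hs0]
  rw [h1]
  have h2 := fun b => ((isIntegral_residue_algebraMap e hQ hm b).tower_top (A := K)).isAlgebraic
  exact (h2 b).mul (h2 s).inv

end Abstract

/-! ### Places of residue characteristic zero. -/

section Places

variable {O K B M : Type*} [CommRing O] [IsDomain O] [IsDiscreteValuationRing O]
  [IsAdicComplete (maximalIdeal O) O] [CharZero O]
  [Field K] [Algebra O K] [IsFractionRing O K]
  [CommRing B] [IsDomain B] [IsLocalRing B] [IsNoetherianRing B] [IsIntegrallyClosed B]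
  [Algebra O B] (e : PowerSeries O ≃ₐ[O] B)
  [Field M] [Algebra B M] [IsFractionRing B M]
  [Algebra O M] [IsScalarTower O B M] [Algebra K M] [IsScalarTower O K M]
  (y : HeightOnePrime B) {π : O}

theorem isUnit_algebraMap_complRing (hπ : maximalIdeal O = Ideal.span {π})
    (hy : algebraMap O B π ∉ y.1.asIdeal) {a : O} (ha : a ≠ 0) :
    IsUnit (algebraMap O (complRing M y) a) := by
  obtain ⟨n, u, rfl⟩ := IsDiscreteValuationRing.eq_unit_mul_pow_irreducible ha
    ((IsDiscreteValuationRing.irreducible_iff_uniformizer π).mpr hπ)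
  rw [map_mul, map_pow]
  refine (u.isUnit.map _).mul (IsUnit.pow _ ?_)
  rw [← notMem_maximalIdeal, IsScalarTower.algebraMap_apply O B,
    algebraMap_complRing_mem_maximalIdeal_iff]
  exact hy

/-- At a place not dividing `p`, the completion contains `K`. -/
theorem exists_algebra_complRing (K : Type*) [Field K] [Algebra O K] [IsFractionRing O K]
    [Algebra K M] [IsScalarTower O K M] (hπ : maximalIdeal O = Ideal.span {π})
    (hy : algebraMap O B π ∉ y.1.asIdeal) : ∃ _ : Algebra K (complRing M y),
      IsScalarTower O K (complRing M y) ∧ IsScalarTower K (complRing M y) (complField M y) := by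
  have hu : ∀ a : nonZeroDivisors O, IsUnit (algebraMap O (complRing M y) a) := fun a =>
    isUnit_algebraMap_complRing y hπ hy (nonZeroDivisors.ne_zero a.2)
  let f : K →+* complRing M y := IsLocalization.lift hu
  let _ : Algebra K (complRing M y) := f.toAlgebra
  refine ⟨inferInstance, .of_algebraMap_eq fun a => (IsLocalization.lift_eq hu a).symm, ?_⟩
  refine .of_algebraMap_eq' (IsLocalization.ringHom_ext (nonZeroDivisors O) ?_)
  ext1 a
  change algebraMap K (complField M y) (algebraMap O K a) =
    algebraMap (complRing M y) (complField M y) (f (algebraMap O K a))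
  rw [← IsScalarTower.algebraMap_apply, IsLocalization.lift_eq, ← IsScalarTower.algebraMap_apply]

theorem exists_prime_generator (e : PowerSeries O ≃ₐ[O] B) :
    ∃ p : B, Prime p ∧ y.1.asIdeal = Ideal.span {p} := by
  have := uniqueFactorizationMonoid_of_equiv e
  have hP := y.1.isPrime
  have hpn := y.1.asIdeal.ne_bot_of_height_eq_one y.2
  obtain ⟨p, hpm, hp⟩ := Ideal.IsPrime.exists_mem_prime_of_ne_bot hP hpn
  exact ⟨p, hp, y.1.asIdeal.eq_span_singleton_of_height_eq_one y.2 hpm hp⟩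

/-- The prime ideals of height one other than `(π)` are generated by distinguished polynomials. -/
theorem exists_distinguished (e : PowerSeries O ≃ₐ[O] B) (hπ : maximalIdeal O = Ideal.span {π})
    (hy : algebraMap O B π ∉ y.1.asIdeal) : ∃ Q : Polynomial O,
      Q.IsDistinguishedAt (maximalIdeal O) ∧
        y.1.asIdeal = Ideal.span {Polynomial.aeval (parameter e) Q} := by
  obtain ⟨p, hp, hpy⟩ := exists_prime_generator y e
  rcases associated_of_prime e hπ hp with h | ⟨Q, hQ, h⟩
  · exact absurd (hpy ▸ Ideal.mem_span_singleton.mpr h.dvd) hy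
  · exact ⟨Q, hQ, by rw [hpy, Ideal.span_singleton_eq_span_singleton]; exact h⟩

theorem charZero_residueField_complRing (hπ : maximalIdeal O = Ideal.span {π})
    (hy : algebraMap O B π ∉ y.1.asIdeal) : CharZero (ResidueField (complRing M y)) := by
  refine ⟨fun m n h => ?_⟩
  by_contra hmn
  have h1 : (m : O) - n ≠ 0 := by
    rw [sub_ne_zero]; exact_mod_cast hmn
  have h2 := (isUnit_algebraMap_complRing (M := M) y hπ hy h1).map (residue (complRing M y))
  simp only [map_sub, map_natCast] at h2
  rw [h, sub_self] at h2
  exact not_isUnit_zero h2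

theorem exists_laurentCoordinate_complRing (e : PowerSeries O ≃ₐ[O] B)
    (hπ : maximalIdeal O = Ideal.span {π})
    (hy : algebraMap O B π ∉ y.1.asIdeal) {q : B} (hq : y.1.asIdeal = Ideal.span {q}) :
    ∃ c : LaurentCoordinate K (complRing M y) (complField M y),
      c.t = algebraMap B (complRing M y) q := by
  obtain ⟨_, _, _⟩ := exists_algebra_complRing (M := M) y K hπ hy
  obtain ⟨Q, hQ, hyQ⟩ := exists_distinguished y e hπ hy
  have : CharZero K := charZero_of_injective_algebraMap (IsFractionRing.injective O K)
  have : Algebra.IsAlgebraic K (ResidueField (complRing M y)) :=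
    isAlgebraic_residueField e hQ ((algebraMap_complRing_mem_maximalIdeal_iff M y _).mpr
      (hyQ ▸ Ideal.mem_span_singleton_self _)) fun x => by
        obtain ⟨b, s, hs, h⟩ := exists_mul_sub_algebraMap_mem_maximalIdeal M y x
        exact ⟨b, s, by rwa [algebraMap_complRing_mem_maximalIdeal_iff], h⟩
  refine exists_laurentCoordinate (maximalIdeal_complRing_eq_span M y hq) ?_
  intro h
  have h1 := maximalIdeal_complRing_eq_span M y hq
  rw [h, Ideal.span_singleton_zero] at h1
  exact IsDiscreteValuationRing.not_a_field _ h1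

/-- The residue at a place of residue characteristic zero, in terms of any coordinate. -/
theorem isResidueAt_iff_of_notMem (e : PowerSeries O ≃ₐ[O] B)
    (hπ : maximalIdeal O = Ideal.span {π}) (hy : algebraMap O B π ∉ y.1.asIdeal)
    (c : LaurentCoordinate K (complRing M y) (complField M y)) (ω : GlobalDiff O B M)
    (r : constField K (complField M y)) :
    IsResidueAt O K B M y ω r ↔ r = c.residue
      (algebraMap M (complField M y) (ctsLift M (paramDerivation e) ω) *
        c.deriv (algebraMap B (complField M y) (parameter e))) := by
  obtain ⟨Q, hQ, hyQ⟩ := exists_distinguished y e hπ hy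
  have : CharZero K := charZero_of_injective_algebraMap (IsFractionRing.injective O K)
  have : CharZero (ResidueField (complRing M y)) := charZero_residueField_complRing y hπ hy
  have h1 : ∀ η : M ⊗[B] Ω[B⁄O], toGlobalDiff O B M η = ω →
      ctsLift (complField M y) c.derivation (toCtsDiff O B M y η) =
        algebraMap M (complField M y) (ctsLift M (paramDerivation e) ω) *
          c.deriv (algebraMap B (complField M y) (parameter e)) := by
    rintro η rfl
    rw [ctsLift_toCtsDiff M y (paramDerivation e) c.derivation
      (c.derivation (algebraMap B (complRing M y) (parameter e)))
      (derivation_algebraMap_eq e hQ ((algebraMap_complRing_mem_maximalIdeal_iff M y _).mpr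
        (hyQ ▸ Ideal.mem_span_singleton_self _)) _)]
    congr 1
    exact c.algebraMap_derivation _
  constructor
  · rintro ⟨η, hη, h⟩
    rwa [c.isLocalResidue_iff, h1 η hη] at h
  · rintro rfl
    obtain ⟨η, hη⟩ := toGlobalDiff_surjective O B M ω
    exact ⟨η, hη, by rw [c.isLocalResidue_iff, h1 η hη]⟩

end Places
end Reciprocity

namespace Reciprocity

/-! ### The place (π). -/

section Places

variable {O K B M : Type*} [CommRing O] [IsDomain O] [IsDiscreteValuationRing O]
  [IsAdicComplete (maximalIdeal O) O] [CharZero O]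
  [Field K] [Algebra O K] [IsFractionRing O K]
  [CommRing B] [IsDomain B] [IsLocalRing B] [IsNoetherianRing B] [IsIntegrallyClosed B]
  [Algebra O B] (e : PowerSeries O ≃ₐ[O] B)
  [Field M] [Algebra B M] [IsFractionRing B M]
  [Algebra O M] [IsScalarTower O B M] [Algebra K M] [IsScalarTower O K M]
  (y : HeightOnePrime B) {π : O}

theorem asIdeal_eq_span_of_mem (e : PowerSeries O ≃ₐ[O] B) (hπ : maximalIdeal O = Ideal.span {π})
    (hy : algebraMap O B π ∈ y.1.asIdeal) : y.1.asIdeal = Ideal.span {algebraMap O B π} :=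
  have := y.1.isPrime
  y.1.asIdeal.eq_span_singleton_of_height_eq_one y.2 hy (prime_algebraMap e hπ)

theorem algebraMap_injective_of_equiv (e : PowerSeries O ≃ₐ[O] B) :
    Function.Injective (algebraMap O B) := by
  intro a b h
  rw [← e.commutes, ← e.commutes] at h
  exact PowerSeries.C_injective (e.injective h)

theorem algebraMap_complRing_injective : Function.Injective (algebraMap B (complRing M y)) := by
  have h : Function.Injective (algebraMap B (complField M y)) := by
    rw [IsScalarTower.algebraMap_eq B M (complField M y)]
    exact (algebraMap M _).injective.comp (IsFractionRing.injective B M)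
  rw [IsScalarTower.algebraMap_eq B (complRing M y) (complField M y)] at h
  exact Function.Injective.of_comp (f := algebraMap (complRing M y) (complField M y)) h

theorem faithfulSMul_complRing (e : PowerSeries O ≃ₐ[O] B) : FaithfulSMul O (complRing M y) := by
  rw [faithfulSMul_iff_algebraMap_injective, IsScalarTower.algebraMap_eq O B (complRing M y)]
  exact (algebraMap_complRing_injective y).comp (algebraMap_injective_of_equiv e)

theorem maximalIdeal_complRing_eq_span_of_mem (e : PowerSeries O ≃ₐ[O] B)
    (hπ : maximalIdeal O = Ideal.span {π}) (hy : algebraMap O B π ∈ y.1.asIdeal) :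
    maximalIdeal (complRing M y) = Ideal.span {algebraMap O (complRing M y) π} := by
  rw [maximalIdeal_complRing_eq_span M y (asIdeal_eq_span_of_mem y e hπ hy),
    ← IsScalarTower.algebraMap_apply]

theorem dvd_algebraMap_complRing_iff (e : PowerSeries O ≃ₐ[O] B)
    (hπ : maximalIdeal O = Ideal.span {π}) (hy : algebraMap O B π ∈ y.1.asIdeal) (f : PowerSeries O) :
    algebraMap O (complRing M y) π ∣ algebraMap B (complRing M y) (e f) ↔ PowerSeries.C π ∣ f := by
  rw [← Ideal.mem_span_singleton, ← maximalIdeal_complRing_eq_span_of_mem y e hπ hy,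
    algebraMap_complRing_mem_maximalIdeal_iff, asIdeal_eq_span_of_mem y e hπ hy,
    Ideal.mem_span_singleton, ← e.commutes]
  exact map_dvd_iff e

/-- A distinguished polynomial is congruent to a power of X modulo π. Hence elements outside (π)
become invertible modulo π once X is inverted. -/
theorem exists_C_dvd_sub_X_pow_mul (hπ : maximalIdeal O = Ideal.span {π}) {s : PowerSeries O}
    (hs : ¬ PowerSeries.C π ∣ s) :
    ∃ (n : ℕ) (u : (PowerSeries O)ˣ), PowerSeries.C π ∣ s - PowerSeries.X ^ n * (u : PowerSeries O) := by
  rw [C_dvd_iff hπ] at hs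
  obtain ⟨Q, u, hu⟩ := PowerSeries.exists_isWeierstrassFactorization hs
  obtain ⟨u, rfl⟩ := hu.isUnit
  refine ⟨Q.natDegree, u, ?_⟩
  rw [hu.eq_mul, ← sub_mul]
  refine Dvd.dvd.mul_right ?_ _
  rw [C_dvd_iff hπ, map_sub, sub_eq_zero, map_pow, PowerSeries.map_X]
  have h := congrArg (fun p : Polynomial (O ⧸ maximalIdeal O) => (p : PowerSeries (O ⧸ maximalIdeal O)))
    hu.isDistinguishedAt.map_eq_X_pow
  rw [Polynomial.coe_pow, Polynomial.coe_X, Polynomial.polynomial_map_coe] at h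
  exact h

/-- At the prime `(π)`, the completion consists of double series. -/
theorem exists_doubleExpansion_complRing (M : Type*) [Field M] [Algebra B M] [IsFractionRing B M]
    [Algebra O M] [IsScalarTower O B M] (e : PowerSeries O ≃ₐ[O] B)
    (hπ : maximalIdeal O = Ideal.span {π}) (hy : algebraMap O B π ∈ y.1.asIdeal) :
    ∃ E : DoubleExpansion O (complRing M y),
      ∀ f, E.ofPowerSeries f = algebraMap B (complRing M y) (e f) := by
  have hπ0 : π ≠ 0 := fun h => IsDiscreteValuationRing.not_a_field O (by rw [hπ, h]; simp)
  have hR := maximalIdeal_complRing_eq_span_of_mem (M := M) y e hπ hy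
  have := faithfulSMul_complRing (M := M) y e
  have hdvd := dvd_algebraMap_complRing_iff (M := M) y e hπ hy
  set ψ : PowerSeries O →+* complRing M y :=
    (algebraMap B (complRing M y)).comp (e : PowerSeries O →+* B) with hψ
  have hψe : ∀ f, ψ f = algebraMap B (complRing M y) (e f) := fun f => rfl
  have hunit : ∀ f, ¬ PowerSeries.C π ∣ f → IsUnit (ψ f) := fun f hf => by
    rwa [← notMem_maximalIdeal, hR, Ideal.mem_span_singleton, hψe, hdvd]
  have hX : IsUnit (ψ PowerSeries.X) := by
    refine hunit _ ?_
    rintro ⟨f, hf⟩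
    have := congrArg (PowerSeries.coeff 1) hf
    rw [PowerSeries.coeff_one_X, PowerSeries.coeff_C_mul] at this
    exact (IsDiscreteValuationRing.irreducible_iff_uniformizer π).mpr hπ |>.not_isUnit
      (IsUnit.of_mul_eq_one _ this.symm)
  have hpow : ∀ z : Submonoid.powers (PowerSeries.X : PowerSeries O), IsUnit (ψ z) := by
    rintro ⟨_, n, rfl⟩
    simpa using hX.pow n
  -- T is a unit at (π), so O⟦T⟧ → R extends to Laurent series, which are the localization at the
  -- powers of T.
  set Ψ : LaurentSeries O →+* complRing M y := IsLocalization.lift hpow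
  have hΨ : ∀ f : PowerSeries O, Ψ (f : LaurentSeries O) = ψ f := fun f => IsLocalization.lift_eq hpow f
  have hC : ∀ a, Ψ (HahnSeries.C a) = algebraMap O (complRing M y) a := by
    intro a
    rw [← PowerSeries.coe_C, hΨ, hψe, IsScalarTower.algebraMap_apply O B, ← e.commutes]
    rfl
  have hXn : ∀ n : ℕ, (HahnSeries.single (-n : ℤ) (1 : O) : LaurentSeries O) *
      (PowerSeries.X ^ n : PowerSeries O) = 1 := by
    intro n
    rw [PowerSeries.coe_pow, PowerSeries.coe_X, HahnSeries.single_pow, HahnSeries.single_mul_single]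
    simp
  obtain ⟨E, hE, -⟩ := DoubleExpansion.exists_doubleExpansion (Ψ := Ψ) hπ hπ0 hR hC
    (fun s hs => by
      obtain ⟨⟨f, ⟨_, n, rfl⟩⟩, hf⟩ := IsLocalization.surj
        (Submonoid.powers (PowerSeries.X : PowerSeries O)) s
      have hf' : s * ((PowerSeries.X ^ n : PowerSeries O) : LaurentSeries O) = f := hf
      have h1 := hs.mul_right (Ψ ((PowerSeries.X ^ n : PowerSeries O) : LaurentSeries O))
      rw [← map_mul, hf', hΨ, hψe, hdvd] at h1
      obtain ⟨f', rfl⟩ := h1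
      refine ⟨HahnSeries.single (-n : ℤ) (1 : O) * (f' : LaurentSeries O), ?_⟩
      calc s = HahnSeries.single (-n : ℤ) (1 : O) *
            (s * ((PowerSeries.X ^ n : PowerSeries O) : LaurentSeries O)) := by
            rw [mul_left_comm, hXn, mul_one]
        _ = _ := by
            rw [hf', PowerSeries.coe_mul, PowerSeries.coe_C]; ring)
    (fun x => by
      obtain ⟨b, s, hs, hb⟩ := exists_mul_sub_algebraMap_mem_maximalIdeal M y x
      obtain ⟨b, rfl⟩ := e.surjective b
      obtain ⟨s, rfl⟩ := e.surjective s
      rw [← algebraMap_complRing_mem_maximalIdeal_iff M, hR, Ideal.mem_span_singleton, hdvd] at hs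
      obtain ⟨n, u, hu⟩ := exists_C_dvd_sub_X_pow_mul hπ hs
      -- Modulo π, x is b/s and s is X^n u, so X^(-n) u⁻¹ b approximates x.
      refine ⟨HahnSeries.single (-n : ℤ) (1 : O) *
        ((↑u⁻¹ * b : PowerSeries O) : LaurentSeries O), ?_⟩
      rw [hR, Ideal.mem_span_singleton] at hb
      have h1 : algebraMap O (complRing M y) π ∣ ψ (PowerSeries.X ^ n * (u : PowerSeries O)) * x - ψ b := by
        have := dvd_sub hb (((hdvd _).mpr hu).mul_right x)
        rw [map_sub, map_sub] at this
        convert this using 1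
        rw [hψe, hψe]; ring
      have h2 : Ψ (HahnSeries.single (-n : ℤ) (1 : O)) * ψ (PowerSeries.X ^ n) = 1 := by
        rw [← hΨ, ← map_mul, hXn, map_one]
      have h3 : ψ (↑u⁻¹ : PowerSeries O) * ψ (u : PowerSeries O) = 1 := by
        rw [← map_mul, Units.inv_mul, map_one]
      convert h1.mul_left (Ψ (HahnSeries.single (-n : ℤ) (1 : O)) * ψ (↑u⁻¹ : PowerSeries O)) using 1
      rw [map_mul Ψ, hΨ, map_mul ψ, map_mul ψ]
      linear_combination (-x) * h2 - Ψ (HahnSeries.single (-n : ℤ) (1 : O)) * ψ (PowerSeries.X ^ n) * x * h3)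
  refine ⟨E, fun f => E.injective ?_⟩
  rw [← hψe, ← hΨ, hE]
  ext i
  rw [E.coeff_ofPowerSeries, PowerSeries.coeff_coe]

theorem exists_pow_mul_eq_algebraMap_complRing (e : PowerSeries O ≃ₐ[O] B)
    (hπ : maximalIdeal O = Ideal.span {π}) (hy : algebraMap O B π ∈ y.1.asIdeal)
    (f : complField M y) : ∃ (n : ℕ) (x : complRing M y),
      algebraMap O (complField M y) π ^ n * f = algebraMap (complRing M y) (complField M y) x := by
  obtain ⟨n, x, h⟩ := DoubleExpansion.exists_pow_mul_eq (O := complRing M y)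
    (maximalIdeal_complRing_eq_span_of_mem (M := M) y e hπ hy) f
  exact ⟨n, x, by rwa [← IsScalarTower.algebraMap_apply] at h⟩

/-- The residue at the prime `(π)`. -/
theorem isResidueAt_iff_of_mem [Finite (ResidueField O)] (e : PowerSeries O ≃ₐ[O] B)
    (hπ : maximalIdeal O = Ideal.span {π}) (hy : algebraMap O B π ∈ y.1.asIdeal)
    (E : DoubleExpansion O (complRing M y))
    (hE : ∀ f, E.ofPowerSeries f = algebraMap B (complRing M y) (e f)) (ω : GlobalDiff O B M)
    {n : ℕ} {x : complRing M y} (hx : algebraMap O (complField M y) π ^ n *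
      algebraMap M (complField M y) (ctsLift M (paramDerivation e) ω) =
        algebraMap (complRing M y) (complField M y) x)
    (r : constField K (complField M y)) :
    IsResidueAt O K B M y ω r ↔ algebraMap O (constField K (complField M y)) (π ^ n) * r =
      -algebraMap O (constField K (complField M y)) (E.coeff x (-1)) := by
  have := faithfulSMul_complRing (M := M) y e
  have hR := maximalIdeal_complRing_eq_span_of_mem (M := M) y e hπ hy
  have hF := exists_pow_mul_eq_algebraMap_complRing (M := M) y e hπ hy
  have hD : ∀ b : B, E.derivation (algebraMap B (complRing M y) b) =
      algebraMap B (complRing M y) (paramDerivation e b) * 1 := by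
    intro b
    obtain ⟨f, rfl⟩ := e.surjective b
    rw [← hE, E.derivation_ofPowerSeries, hE, paramDerivation_apply, mul_one]
  have h1 : ∀ η : M ⊗[B] Ω[B⁄O], toGlobalDiff O B M η = ω →
      algebraMap O (complField M y) π ^ n *
        ctsLift (complField M y) E.derivation (toCtsDiff O B M y η) =
        algebraMap (complRing M y) (complField M y) x := by
    rintro η rfl
    rw [ctsLift_toCtsDiff M y (paramDerivation e) E.derivation 1 hD, ← hx]
    congr 1
    exact mul_one _
  constructor
  · rintro ⟨η, hη, h⟩
    exact (E.isLocalResidue_iff hπ hR hF (h1 η hη) r).mp h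
  · intro h
    obtain ⟨η, hη⟩ := toGlobalDiff_surjective O B M ω
    exact ⟨η, hη, (E.isLocalResidue_iff hπ hR hF (h1 η hη) r).mpr h⟩

end Places
end Reciprocity

/-! ### Euler's trace formula and linear residue maps. -/

namespace Reciprocity

/-- Euler's formula for the trace of `r(x) / f'(x)`, where `f` is the minimal polynomial of `x`. -/
theorem trace_aeval_div_derivative {K L : Type*} [Field K] [Field L] [Algebra K L] [CharZero K]
    {x : L} (hx : IsIntegral K x) (hL : IntermediateField.adjoin K {x} = ⊤) {r : Polynomial K}
    (hr : r.degree < (minpoly K x).natDegree) :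
    Algebra.trace K L (Polynomial.aeval x r / Polynomial.aeval x (minpoly K x).derivative) =
      r.coeff ((minpoly K x).natDegree - 1) := by
  have hL' : Algebra.adjoin K {x} = ⊤ := by
    rw [← IntermediateField.adjoin_simple_toSubalgebra_of_isAlgebraic hx.isAlgebraic, hL,
      IntermediateField.top_toSubalgebra]
  let pb : PowerBasis K L := PowerBasis.ofAdjoinEqTop' hx hL'
  have : FiniteDimensional K L := pb.finite
  have hdim : pb.dim = (minpoly K x).natDegree := rfl
  have hgen : pb.gen = x := PowerBasis.ofAdjoinEqTop'_gen hx hL'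
  have hn : 0 < (minpoly K x).natDegree := minpoly.natDegree_pos hx
  set n := (minpoly K x).natDegree with hn'
  let i : Fin pb.dim := ⟨n - 1, by rw [hdim]; omega⟩
  -- The trace dual of x^i is the i-th coefficient of f(X)/(X - x) divided by f'(x); for i = n - 1
  -- that coefficient is 1, the quotient being monic.
  have h1 := Module.Basis.traceDual_powerBasis_eq pb i
  have h2 : (minpolyDiv K pb.gen).coeff i = 1 := by
    have h3 : (minpolyDiv K pb.gen).natDegree = n - 1 := by rw [natDegree_minpolyDiv, hgen]
    have h4 := minpolyDiv_monic (R := K) (x := pb.gen) (by rwa [hgen])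
    rwa [Polynomial.Monic, Polynomial.leadingCoeff, h3] at h4
  rw [h2, hgen] at h1
  have h3 : ∀ j < n, Algebra.trace K L (x ^ j / Polynomial.aeval x (minpoly K x).derivative) =
      if j = n - 1 then 1 else 0 := by
    intro j hj
    have h4 := (Module.Basis.traceDual_eq_iff (b := pb.basis)).mp rfl i ⟨j, hj⟩
    rw [h1, PowerBasis.coe_basis, hgen, Algebra.traceForm_apply] at h4
    rw [div_eq_mul_one_div, mul_comm, h4]
    simp [i, Fin.ext_iff]
  have hr' : r.natDegree < n := by
    obtain rfl | hr0 := eq_or_ne r 0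
    · simpa using hn
    · exact (Polynomial.natDegree_lt_iff_degree_lt hr0).mpr hr
  rw [Polynomial.aeval_eq_sum_range' hr', Finset.sum_div, map_sum]
  simp only [smul_div_assoc, map_smul]
  rw [Finset.sum_congr rfl fun j hj => by rw [h3 j (Finset.mem_range.mp hj)]]
  simp [hn]

namespace LaurentCoordinate

variable {K R F : Type*} [Field K] [CommRing R] [Field F] [Algebra K F] [Algebra R F]
  [FaithfulSMul R F] [IsLocalRing R]

theorem exists_const_sub_mem (c : LaurentCoordinate K R F) (x : R) :
    ∃ (z : constField K F) (a : R), algebraMap R F a = algebraMap _ F z ∧ x - a ∈ maximalIdeal R := by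
  obtain ⟨e, he, heX⟩ := c.exists_ringEquiv
  obtain ⟨g, rfl⟩ := e.surjective x
  refine ⟨PowerSeries.constantCoeff g, e (PowerSeries.C (PowerSeries.constantCoeff g)), ?_, ?_⟩
  · rw [he, PowerSeries.coe_C, ← LaurentSeries.algebraMap_apply, AlgEquiv.commutes]
  · rw [← map_sub, powerSeries_equiv_mem_maximalIdeal_iff]
    simp

/-- A nonzero constant has its inverse in R, so it is a unit and avoids the maximal ideal. -/
theorem const_eq_zero (c : LaurentCoordinate K R F) {z : constField K F} {a : R}
    (haz : algebraMap R F a = algebraMap _ F z) (ha : a ∈ maximalIdeal R) : z = 0 := by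
  by_contra hz
  obtain ⟨b, hb⟩ := c.exists_algebraMap_eq_const z⁻¹
  have h1 : a * b = 1 := by
    apply FaithfulSMul.algebraMap_injective R F
    rw [map_mul, haz, hb, ← map_mul, mul_inv_cancel₀ hz, map_one, map_one]
  exact (mem_maximalIdeal a).mp ha (IsUnit.of_mul_eq_one _ h1)

/-- The `O`-linear map `f ↦ res (f * h dt)`. -/
theorem exists_residueMap (c : LaurentCoordinate K R F) (O : Type*) [CommRing O] [Algebra O K]
    [Algebra O F] [IsScalarTower O K F] (h : F) :
    ∃ ρ : F →ₗ[O] constField K F, ∀ f, ρ f = c.residue (f * h) := by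
  refine ⟨{ toFun := fun f => c.residue (f * h)
            map_add' := fun f g => by rw [add_mul, c.residue_add]
            map_smul' := fun a f => ?_ }, fun f => rfl⟩
  have h1 : algebraMap O F a = algebraMap (constField K F) F (algebraMap O _ a) := by
    rw [IsScalarTower.algebraMap_apply O K F, IsScalarTower.algebraMap_apply O K (constField K F)]
    rfl
  rw [Algebra.smul_def, mul_assoc, h1, c.residue_algebraMap_mul, RingHom.id_apply, Algebra.smul_def]

end LaurentCoordinate

namespace DoubleExpansion

variable {O K R F : Type*} [CommRing O] [IsDomain O] [IsDiscreteValuationRing O]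
  [IsHausdorff (maximalIdeal O) O]
  [Field K] [Algebra O K] [IsFractionRing O K]
  [CommRing R] [IsDomain R] [Field F] [Algebra R F] [IsFractionRing R F]
  [Algebra O R] [FaithfulSMul O R] [Algebra O F] [IsScalarTower O R F]
  [Algebra K F] [IsScalarTower O K F] {π : O}

/-- The `O`-linear map given by minus the coefficient of `t⁻¹`. -/
theorem exists_residueMap (E : DoubleExpansion O R) (hπ : maximalIdeal O = Ideal.span {π})
    (hK : ∀ a : constField K F, ∃ b : K, algebraMap K (constField K F) b = a)
    (hF : ∀ f : F, ∃ (n : ℕ) (x : R), algebraMap O F π ^ n * f = algebraMap R F x) :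
    ∃ ρ : F →ₗ[O] constField K F, ∀ f n x, algebraMap O F π ^ n * f = algebraMap R F x →
      algebraMap O (constField K F) (π ^ n) * ρ f =
        -algebraMap O (constField K F) (E.coeff x (-1)) := by
  obtain ⟨co, hco⟩ := E.exists_linearMap (K := K) hπ hK hF
  have hlin : ∀ (a : O) (f : F), co (algebraMap O F a * f) (-1) =
      algebraMap O (constField K F) a * co f (-1) := by
    intro a f
    have h1 : algebraMap O F a * f = algebraMap O (constField K F) a • f := by
      rw [Algebra.smul_def, IsScalarTower.algebraMap_apply O K F,
        IsScalarTower.algebraMap_apply O K (constField K F)]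
      rfl
    rw [h1, map_smul]
    rfl
  refine ⟨{ toFun := fun f => -co f (-1)
            map_add' := fun f g => ?_
            map_smul' := fun a f => ?_ }, fun f n x hx => ?_⟩
  · rw [map_add, Pi.add_apply, neg_add]
  · rw [Algebra.smul_def, hlin, RingHom.id_apply, Algebra.smul_def, mul_neg]
  · rw [← hco, ← hx, ← map_pow, hlin, ← mul_neg]
    rfl

end DoubleExpansion

/-! ### The residue as an O-linear functional on M. -/

section Functional

variable {O K B M : Type*} [CommRing O] [IsDomain O] [IsDiscreteValuationRing O]
  [IsAdicComplete (maximalIdeal O) O] [CharZero O]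
  [Field K] [Algebra O K] [IsFractionRing O K]
  [CommRing B] [IsDomain B] [IsLocalRing B] [IsNoetherianRing B] [IsIntegrallyClosed B]
  [Algebra O B] (e : PowerSeries O ≃ₐ[O] B)
  [Field M] [Algebra B M] [IsFractionRing B M]
  [Algebra O M] [IsScalarTower O B M] [Algebra K M] [IsScalarTower O K M]
  (y : HeightOnePrime B) {π : O}

/-- `ρ (g)` is the residue at `y` of the form `g dT`. -/
def IsResidueFunctional (y : HeightOnePrime B) (ρ : M →ₗ[O] constField K (complField M y)) : Prop :=
  ∀ (ω : GlobalDiff O B M) (r : constField K (complField M y)),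
    IsResidueAt O K B M y ω r ↔ r = ρ (ctsLift M (paramDerivation e) ω)

theorem exists_ctsLift_eq (g : M) : ∃ ω : GlobalDiff O B M, ctsLift M (paramDerivation e) ω = g :=
  ⟨g • ctsD O M (parameter e), by
    rw [map_smul, ctsLift_ctsD, paramDerivation_parameter, map_one, smul_eq_mul, mul_one]⟩

variable {e y} {ρ : M →ₗ[O] constField K (complField M y)}

theorem IsResidueFunctional.eq_residue (hρ : IsResidueFunctional e y ρ)
    (hπ : maximalIdeal O = Ideal.span {π}) (hy : algebraMap O B π ∉ y.1.asIdeal)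
    (c : LaurentCoordinate K (complRing M y) (complField M y)) (g : M) :
    ρ g = c.residue (algebraMap M (complField M y) g *
      c.deriv (algebraMap B (complField M y) (parameter e))) := by
  obtain ⟨ω, rfl⟩ := exists_ctsLift_eq e g
  exact (isResidueAt_iff_of_notMem y e hπ hy c ω _).mp ((hρ _ _).mpr rfl)

theorem IsResidueFunctional.pow_mul_eq [Finite (ResidueField O)] (hρ : IsResidueFunctional e y ρ)
    (hπ : maximalIdeal O = Ideal.span {π}) (hy : algebraMap O B π ∈ y.1.asIdeal)
    (E : DoubleExpansion O (complRing M y))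
    (hE : ∀ f, E.ofPowerSeries f = algebraMap B (complRing M y) (e f)) {g : M}
    {n : ℕ} {x : complRing M y} (hx : algebraMap O (complField M y) π ^ n *
      algebraMap M (complField M y) g = algebraMap (complRing M y) (complField M y) x) :
    algebraMap O (constField K (complField M y)) (π ^ n) * ρ g =
      -algebraMap O (constField K (complField M y)) (E.coeff x (-1)) := by
  obtain ⟨ω, rfl⟩ := exists_ctsLift_eq e g
  exact (isResidueAt_iff_of_mem y e hπ hy E hE ω hx _).mp ((hρ _ _).mpr rfl)

/-- This contains the well-definedness of the residue: the value of ρ is characterized by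
`IsResidueAt`, which allows every choice of lift and coordinate. -/
theorem exists_residueFunctional (K : Type*) [Field K] [Algebra O K] [IsFractionRing O K]
    [Algebra K M] [IsScalarTower O K M] [Finite (ResidueField O)] (e : PowerSeries O ≃ₐ[O] B)
    (y : HeightOnePrime B) :
    ∃ ρ : M →ₗ[O] constField K (complField M y), IsResidueFunctional e y ρ := by
  obtain ⟨π, hπ'⟩ := IsDiscreteValuationRing.exists_irreducible O
  have hπ := (IsDiscreteValuationRing.irreducible_iff_uniformizer π).mp hπ'
  have h0 : ∀ n : ℕ, algebraMap O (constField K (complField M y)) (π ^ n) ≠ 0 := fun n =>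
    (map_ne_zero_iff _ DoubleExpansion.algebraMap_constField_injective).mpr
      (pow_ne_zero _ hπ'.ne_zero)
  by_cases hy : algebraMap O B π ∈ y.1.asIdeal
  · obtain ⟨E, hE⟩ := exists_doubleExpansion_complRing y M e hπ hy
    have := faithfulSMul_complRing (M := M) y e
    have hR := maximalIdeal_complRing_eq_span_of_mem (M := M) y e hπ hy
    have hF := exists_pow_mul_eq_algebraMap_complRing (M := M) y e hπ hy
    obtain ⟨ρ, hρ⟩ := E.exists_residueMap hπ (E.exists_algebraMap_eq_constField (K := K) hπ hR hF) hF
    refine ⟨ρ ∘ₗ (IsScalarTower.toAlgHom O M (complField M y)).toLinearMap, fun ω r => ?_⟩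
    obtain ⟨n, x, hx⟩ := hF (algebraMap M (complField M y) (ctsLift M (paramDerivation e) ω))
    rw [isResidueAt_iff_of_mem y e hπ hy E hE ω hx, ← hρ _ _ _ hx]
    exact ⟨fun h => mul_left_cancel₀ (h0 n) h, fun h => congrArg _ h⟩
  · obtain ⟨Q, -, hQ⟩ := exists_distinguished y e hπ hy
    obtain ⟨c, -⟩ := exists_laurentCoordinate_complRing (K := K) (M := M) y e hπ hy hQ
    obtain ⟨ρ, hρ⟩ := c.exists_residueMap O (c.deriv (algebraMap B (complField M y) (parameter e)))
    refine ⟨ρ ∘ₗ (IsScalarTower.toAlgHom O M (complField M y)).toLinearMap, fun ω r => ?_⟩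
    rw [isResidueAt_iff_of_notMem y e hπ hy c ω r, ← hρ]
    rfl

end Functional
end Reciprocity

/-! ### The trace of the residue at a distinguished prime. -/

namespace Reciprocity

theorem aeval_sub_aeval_mem {O R : Type*} [CommRing O] [CommRing R] [Algebra O R] {I : Ideal R}
    {a b : R} (h : a - b ∈ I) (p : Polynomial O) : Polynomial.aeval a p - Polynomial.aeval b p ∈ I := by
  rw [Polynomial.aeval_def, Polynomial.aeval_def, ← Polynomial.eval_map, ← Polynomial.eval_map]
  exact I.mem_of_dvd (Polynomial.sub_dvd_eval_sub a b _) h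

theorem paramDerivation_aeval {O B : Type*} [CommRing O] [IsDomain O] [IsDiscreteValuationRing O]
    [IsAdicComplete (maximalIdeal O) O] [CommRing B] [Algebra O B]
    (e : PowerSeries O ≃ₐ[O] B) (p : Polynomial O) :
    paramDerivation e (Polynomial.aeval (parameter e) p) =
      Polynomial.aeval (parameter e) p.derivative := by
  rw [Derivation.map_aeval, paramDerivation_parameter, smul_eq_mul, mul_one]

namespace LaurentCoordinate

variable {O K B R F : Type*} [CommRing O] [IsDomain O] [IsDiscreteValuationRing O]
  [IsAdicComplete (maximalIdeal O) O] [CharZero O] [Field K] [Algebra O K] [IsFractionRing O K]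
  [CommRing B] [IsDomain B] [Algebra O B] [CommRing R] [IsDomain R] [IsLocalRing R]
  [Field F] [Algebra O R] [Algebra B R] [IsScalarTower O B R] [Algebra K F] [Algebra R F]
  [FaithfulSMul R F] [Algebra O F] [IsScalarTower O K F] [IsScalarTower O R F]
  [Algebra B F] [IsScalarTower B R F]
  (c : LaurentCoordinate K R F) (e : PowerSeries O ≃ₐ[O] B)
  {Q : Polynomial O}

theorem deriv_algebraMap [IsHausdorff (maximalIdeal R) R] (hQ : Q.IsDistinguishedAt (maximalIdeal O))
    (hm : algebraMap B R (Polynomial.aeval (parameter e) Q) ∈ maximalIdeal R) (b : B) :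
    c.deriv (algebraMap B F b) =
      algebraMap B F (paramDerivation e b) * c.deriv (algebraMap B F (parameter e)) := by
  have h := congrArg (algebraMap R F)
    (derivation_algebraMap_eq e hQ hm (c.derivation : Derivation O R R) b)
  rw [map_mul, algebraMap_derivation, algebraMap_derivation, ← IsScalarTower.algebraMap_apply,
    ← IsScalarTower.algebraMap_apply, ← IsScalarTower.algebraMap_apply] at h
  exact h

theorem residue_mul_deriv_eq_zero_of_mul_eq {s b : B} (hs : IsUnit (algebraMap B R s)) {g : F}
    (hg : algebraMap B F s * g = algebraMap B F b) :
    c.residue (g * c.deriv (algebraMap B F (parameter e))) = 0 := by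
  obtain ⟨z, hz⟩ := c.exists_deriv_eq (algebraMap B R (parameter e))
  obtain ⟨u, hu⟩ := hs
  have h1 : algebraMap R F (u : R) * g = algebraMap R F (algebraMap B R b) := by
    rw [hu, ← IsScalarTower.algebraMap_apply, hg, ← IsScalarTower.algebraMap_apply]
  have h2 : algebraMap R F ((u⁻¹ : Rˣ) : R) * algebraMap R F (u : R) = 1 := by
    rw [← map_mul, Units.inv_mul, map_one]
  have h3 : g = algebraMap R F ((u⁻¹ : Rˣ) * algebraMap B R b) := by
    rw [map_mul, ← h1, ← mul_assoc, h2, one_mul]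
  rw [IsScalarTower.algebraMap_apply B R F, ← hz, h3, ← map_mul, c.residue_algebraMap]

theorem residue_mul_deriv_eq_zero_of_exact [IsHausdorff (maximalIdeal R) R]
    (hQ : Q.IsDistinguishedAt (maximalIdeal O))
    (hm : algebraMap B R (Polynomial.aeval (parameter e) Q) ∈ maximalIdeal R) {b d : B} {g : F}
    (hd : algebraMap B F d ≠ 0)
    (hg : algebraMap B F d ^ 2 * g = algebraMap B F (d * paramDerivation e b - b * paramDerivation e d)) :
    c.residue (g * c.deriv (algebraMap B F (parameter e))) = 0 := by
  obtain ⟨f, h1⟩ : ∃ f, f * algebraMap B F d = algebraMap B F b := ⟨_, div_mul_cancel₀ _ hd⟩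
  have h2 := congrArg c.deriv h1
  rw [c.deriv_mul, c.deriv_algebraMap e hQ hm, c.deriv_algebraMap e hQ hm b] at h2
  rw [map_sub, map_mul, map_mul] at hg
  have h3 : g * c.deriv (algebraMap B F (parameter e)) = c.deriv f := by
    apply mul_left_cancel₀ (pow_ne_zero 2 hd)
    linear_combination c.deriv (algebraMap B F (parameter e)) * hg - algebraMap B F d * h2 +
      algebraMap B F (paramDerivation e d) * c.deriv (algebraMap B F (parameter e)) * h1
  rw [h3, c.residue_deriv]

section Trace

theorem eq_zero_of_aeval_mem (hQ : Q.IsDistinguishedAt (maximalIdeal O))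
    (hm : ∀ b : B, algebraMap B R b ∈ maximalIdeal R → Polynomial.aeval (parameter e) Q ∣ b)
    {p : Polynomial O} (hp : p.degree < Q.natDegree)
    (h : algebraMap B R (Polynomial.aeval (parameter e) p) ∈ maximalIdeal R) : p = 0 := by
  obtain ⟨q, hq⟩ := hm _ h
  exact (eq_zero_of_aeval_mul_eq e hQ hp hq.symm).2

theorem algebraMap_aeval_const {a : R} {z : constField K F}
    (haz : algebraMap R F a = algebraMap _ F z) (p : Polynomial O) :
    algebraMap R F (Polynomial.aeval a p) =
      algebraMap (constField K F) F (Polynomial.aeval z p) := by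
  have : IsScalarTower O (constField K F) F := .of_algebraMap_eq fun x => by
    rw [IsScalarTower.algebraMap_apply O K F, IsScalarTower.algebraMap_apply O K (constField K F)]
    rfl
  rw [← Polynomial.aeval_algebraMap_apply, haz, Polynomial.aeval_algebraMap_apply]

variable {c e} {θ : constField K F} {t₀ : R} (ht₀ : algebraMap R F t₀ = algebraMap _ F θ)
  (hθ : algebraMap B R (parameter e) - t₀ ∈ maximalIdeal R)

theorem algebraMap_aeval_sub_mem (hθ : algebraMap B R (parameter e) - t₀ ∈ maximalIdeal R)
    (p : Polynomial O) : algebraMap B R (Polynomial.aeval (parameter e) p) -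
      Polynomial.aeval t₀ p ∈ maximalIdeal R := by
  rw [← Polynomial.aeval_algebraMap_apply]
  exact aeval_sub_aeval_mem hθ p

/-- T is congruent to the constant θ, so p(T) is congruent to the constant p(θ), and a constant in
the maximal ideal is zero. -/
theorem algebraMap_aeval_mem_iff (ht₀ : algebraMap R F t₀ = algebraMap _ F θ)
    (hθ : algebraMap B R (parameter e) - t₀ ∈ maximalIdeal R) (c : LaurentCoordinate K R F)
    (p : Polynomial O) :
    algebraMap B R (Polynomial.aeval (parameter e) p) ∈ maximalIdeal R ↔ Polynomial.aeval θ p = 0 := by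
  have h1 := algebraMap_aeval_sub_mem hθ p
  have h2 := algebraMap_aeval_const ht₀ p
  constructor
  · intro h
    refine c.const_eq_zero h2 ?_
    have := sub_mem h h1
    rwa [sub_sub_cancel] at this
  · intro h
    rw [h, map_zero, map_eq_zero_iff _ (FaithfulSMul.algebraMap_injective R F)] at h2
    rwa [h2, sub_zero] at h1

/-- A polynomial of smaller degree killing θ, with denominators cleared, would be divisible by Q in
B, against uniqueness of Weierstrass division. -/
theorem minpoly_eq_map (ht₀ : algebraMap R F t₀ = algebraMap _ F θ)
    (hθ : algebraMap B R (parameter e) - t₀ ∈ maximalIdeal R) (c : LaurentCoordinate K R F)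
    (hQ : Q.IsDistinguishedAt (maximalIdeal O))
    (hm : ∀ b : B, algebraMap B R b ∈ maximalIdeal R ↔ Polynomial.aeval (parameter e) Q ∣ b) :
    minpoly K θ = Q.map (algebraMap O K) := by
  symm
  apply minpoly.unique K θ (hQ.monic.map _)
  · rw [Polynomial.aeval_map_algebraMap, ← algebraMap_aeval_mem_iff ht₀ hθ c, hm]
  · intro q hq h0
    by_contra hlt
    rw [not_le, hQ.monic.degree_map, Polynomial.degree_eq_natDegree hQ.monic.ne_zero] at hlt
    obtain ⟨b, hbm, hb⟩ := IsLocalization.integerNormalization_spec (nonZeroDivisors O) q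
    set p := IsLocalization.integerNormalization (nonZeroDivisors O) q
    have hb0 : algebraMap O K b ≠ 0 := by
      simpa using nonZeroDivisors.ne_zero hbm
    have h1 : p.map (algebraMap O K) = Polynomial.C (algebraMap O K b) * q := by
      rw [hb, Algebra.smul_def]; rfl
    have h2 : p.degree < Q.natDegree := by
      rw [← Polynomial.degree_map_eq_of_injective (IsFractionRing.injective O K) p, h1,
        Polynomial.degree_C_mul hb0]
      exact hlt
    have h3 : Polynomial.aeval θ p = 0 := by
      rw [← Polynomial.aeval_map_algebraMap K, h1, map_mul, h0, mul_zero]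
    have h4 := eq_zero_of_aeval_mem (R := R) e hQ (fun b => (hm b).mp) h2
      ((algebraMap_aeval_mem_iff ht₀ hθ c p).mpr h3)
    rw [h4, Polynomial.map_zero, eq_comm, mul_eq_zero, Polynomial.C_eq_zero] at h1
    exact h1.elim hb0 hq.ne_zero

/-- Every constant is congruent to a quotient of elements of B, and by division each of these is
congruent to a polynomial in T, hence in θ. -/
theorem adjoin_eq_top (ht₀ : algebraMap R F t₀ = algebraMap _ F θ)
    (hθ : algebraMap B R (parameter e) - t₀ ∈ maximalIdeal R) (c : LaurentCoordinate K R F)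
    (hQ : Q.IsDistinguishedAt (maximalIdeal O))
    (hm : ∀ b : B, algebraMap B R b ∈ maximalIdeal R ↔ Polynomial.aeval (parameter e) Q ∣ b)
    (hsurj : ∀ x : R, ∃ b s : B, algebraMap B R s ∉ maximalIdeal R ∧
      algebraMap B R s * x - algebraMap B R b ∈ maximalIdeal R) :
    IntermediateField.adjoin K {θ} = ⊤ := by
  rw [eq_top_iff]
  rintro z -
  have hmem : ∀ p : Polynomial O, Polynomial.aeval θ p ∈ IntermediateField.adjoin K {θ} := fun p => by
    rw [← Polynomial.aeval_map_algebraMap K]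
    exact IntermediateField.algebra_adjoin_le_adjoin K _ (Polynomial.aeval_mem_adjoin_singleton K θ)
  obtain ⟨w, hw⟩ := c.exists_algebraMap_eq_const z
  obtain ⟨b, s, hs, hsb⟩ := hsurj w
  obtain ⟨q₁, r₁, -, rfl⟩ := exists_eq_aeval_mul_add e hQ s
  obtain ⟨q₂, r₂, -, rfl⟩ := exists_eq_aeval_mul_add e hQ b
  have hQm : ∀ q, algebraMap B R (Polynomial.aeval (parameter e) Q * q) ∈ maximalIdeal R := fun q =>
    (hm _).mpr (dvd_mul_right _ _)
  have h1 : Polynomial.aeval θ r₁ ≠ 0 := by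
    rw [Ne, ← algebraMap_aeval_mem_iff ht₀ hθ c]
    intro h
    rw [map_add] at hs
    exact hs (add_mem (hQm _) h)
  have h2 : Polynomial.aeval t₀ r₁ * w - Polynomial.aeval t₀ r₂ ∈ maximalIdeal R := by
    have h3 := Ideal.mul_mem_right w _ (hQm q₁)
    have h4 := Ideal.mul_mem_right w _ (algebraMap_aeval_sub_mem hθ r₁)
    have h5 := algebraMap_aeval_sub_mem hθ r₂
    convert add_mem (sub_mem (add_mem hsb (hQm q₂)) (add_mem h3 h4)) h5 using 1
    rw [map_add, map_add]
    ring
  have h3 : algebraMap R F (Polynomial.aeval t₀ r₁ * w - Polynomial.aeval t₀ r₂) =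
      algebraMap (constField K F) F (Polynomial.aeval θ r₁ * z - Polynomial.aeval θ r₂) := by
    rw [map_sub, map_mul, hw, algebraMap_aeval_const ht₀, algebraMap_aeval_const ht₀, map_sub, map_mul]
  have h4 := c.const_eq_zero h3 h2
  have h5 : z = Polynomial.aeval θ r₂ / Polynomial.aeval θ r₁ := by
    rw [eq_div_iff h1]
    linear_combination h4
  rw [h5]
  exact div_mem (hmem _) (hmem _)

/-- The trace of the residue at `(Q)` of `r dT / Q`. -/
theorem trace_residue_mul_deriv [IsHausdorff (maximalIdeal R) R] (c : LaurentCoordinate K R F)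
    (e : PowerSeries O ≃ₐ[O] B) (hQ : Q.IsDistinguishedAt (maximalIdeal O))
    (hm : ∀ b : B, algebraMap B R b ∈ maximalIdeal R ↔ Polynomial.aeval (parameter e) Q ∣ b)
    (hq : maximalIdeal R = Ideal.span {algebraMap B R (Polynomial.aeval (parameter e) Q)})
    (hsurj : ∀ x : R, ∃ b s : B, algebraMap B R s ∉ maximalIdeal R ∧
      algebraMap B R s * x - algebraMap B R b ∈ maximalIdeal R)
    (hQ0 : algebraMap B F (Polynomial.aeval (parameter e) Q) ≠ 0)
    {r : Polynomial O} (hr : r.degree < Q.natDegree) {g : F}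
    (hg : algebraMap B F (Polynomial.aeval (parameter e) Q) * g =
      algebraMap B F (Polynomial.aeval (parameter e) r)) :
    Algebra.trace K (constField K F) (c.residue (g * c.deriv (algebraMap B F (parameter e)))) =
      algebraMap O K (r.coeff (Q.natDegree - 1)) := by
  have : CharZero K := charZero_of_injective_algebraMap (IsFractionRing.injective O K)
  have hQm := (hm (Polynomial.aeval (parameter e) Q)).mpr dvd_rfl
  obtain ⟨θ, t₀, ht₀, hθ⟩ := c.exists_const_sub_mem (algebraMap B R (parameter e))
  have hmin := minpoly_eq_map ht₀ hθ c hQ hm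
  have htop := adjoin_eq_top ht₀ hθ c hQ hm hsurj
  have hint : IsIntegral K θ := by
    by_contra h
    rw [minpoly.eq_zero h] at hmin
    exact (hQ.monic.map (algebraMap O K)).ne_zero hmin.symm
  have hn : (minpoly K θ).natDegree = Q.natDegree := by rw [hmin, hQ.monic.natDegree_map]
  have hn0 : 0 < Q.natDegree := hn ▸ minpoly.natDegree_pos hint
  have hQ' : algebraMap B R (Polynomial.aeval (parameter e) Q.derivative) ∉ maximalIdeal R := by
    intro h
    have h1 : Q.derivative.degree < Q.natDegree :=
      Polynomial.degree_eq_natDegree hQ.monic.ne_zero ▸ Polynomial.degree_derivative_lt hQ.monic.ne_zero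
    have h2 := eq_zero_of_aeval_mem e hQ (fun b => (hm b).mp) h1 h
    exact hn0.ne' (Polynomial.derivative_eq_zero.mp h2)
  have hθ' : Polynomial.aeval θ Q.derivative ≠ 0 := by
    rwa [Ne, ← algebraMap_aeval_mem_iff ht₀ hθ c]
  obtain ⟨u, hu⟩ := notMem_maximalIdeal.mp hQ'
  -- With a = r/Q', regular at (Q) because Q' does not vanish there, the form r dT/Q becomes a dQ/Q,
  -- whose residue is r(θ)/Q'(θ).
  set a : R := (u⁻¹ : Rˣ) * algebraMap B R (Polynomial.aeval (parameter e) r) with ha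
  have hua : algebraMap B R (Polynomial.aeval (parameter e) Q.derivative) * a =
      algebraMap B R (Polynomial.aeval (parameter e) r) := by
    rw [ha, ← hu, Units.mul_inv_cancel_left]
  obtain ⟨w, hw⟩ := c.exists_algebraMap_eq_const
    (Polynomial.aeval θ r / Polynomial.aeval θ Q.derivative)
  have hw' : Polynomial.aeval t₀ Q.derivative * w = Polynomial.aeval t₀ r := by
    apply FaithfulSMul.algebraMap_injective R F
    rw [map_mul, hw, algebraMap_aeval_const ht₀, algebraMap_aeval_const ht₀, ← map_mul,
      mul_div_cancel₀ _ hθ']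
  have haw : a - w ∈ maximalIdeal R := by
    have h1 := algebraMap_aeval_sub_mem hθ r
    have h2 := Ideal.mul_mem_right w _ (algebraMap_aeval_sub_mem hθ Q.derivative)
    have h3 : (u : R) * (a - w) ∈ maximalIdeal R := by
      convert sub_mem h1 h2 using 1
      rw [hu]
      linear_combination hua - hw'
    exact (Ideal.unit_mul_mem_iff_mem _ u.isUnit).mp h3
  have h1 := c.residue_mul_dlog hq a w _ hw haw
  rw [← IsScalarTower.algebraMap_apply, c.deriv_algebraMap e hQ hQm, paramDerivation_aeval] at h1
  have h2 : g * c.deriv (algebraMap B F (parameter e)) = algebraMap R F a *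
      (algebraMap B F (Polynomial.aeval (parameter e) Q.derivative) *
        c.deriv (algebraMap B F (parameter e))) *
          (algebraMap B F (Polynomial.aeval (parameter e) Q))⁻¹ := by
    rw [eq_mul_inv_iff_mul_eq₀ hQ0]
    have h3 := congrArg (algebraMap R F) hua
    rw [map_mul, ← IsScalarTower.algebraMap_apply, ← IsScalarTower.algebraMap_apply, ← hg] at h3
    linear_combination -c.deriv (algebraMap B F (parameter e)) * h3
  rw [h2, h1, ← Polynomial.aeval_map_algebraMap K θ r, ← Polynomial.aeval_map_algebraMap K θ Q.derivative,
    ← Polynomial.derivative_map, ← hmin, trace_aeval_div_derivative hint htop, hn, Polynomial.coeff_map]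
  rw [hn]
  exact Polynomial.degree_map_le.trans_lt hr

end Trace

end LaurentCoordinate
end Reciprocity

/-! ### Expansion of fractions in double series. -/

namespace Reciprocity

namespace DoubleExpansion

variable {O R : Type*} [CommRing O] [IsDomain O] [IsDiscreteValuationRing O]
  [IsAdicComplete (maximalIdeal O) O] [CommRing R] [Algebra O R] (E : DoubleExpansion O R)

theorem coeff_ofPowerSeries_coe_mul {p : Polynomial O} {n : ℕ} (hp : p.natDegree ≤ n) (x : R) (i : ℤ) :
    E.coeff (E.ofPowerSeries p * x) i =
      ∑ j ∈ Finset.range (n + 1), p.coeff j * E.coeff x (i - j) := by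
  rw [E.coeff_mul_eq_sum ((Finset.range (n + 1)).map Nat.castEmbedding), Finset.sum_map]
  · refine Finset.sum_congr rfl fun j _ => ?_
    rw [Nat.castEmbedding_apply, E.coeff_ofPowerSeries, if_neg (by simp), Int.natAbs_natCast,
      Polynomial.coeff_coe]
  · intro j hj
    rw [E.coeff_ofPowerSeries]
    split_ifs with h0
    · rw [zero_mul]
    · obtain ⟨m, rfl⟩ := Int.eq_ofNat_of_zero_le (not_lt.mp h0)
      rw [Int.natAbs_natCast, Polynomial.coeff_coe, Polynomial.coeff_eq_zero_of_natDegree_lt, zero_mul]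
      by_contra hm
      exact hj (Finset.mem_map.mpr ⟨m, Finset.mem_range.mpr (by omega), rfl⟩)

/-- The coefficient of `t⁻¹` in `r / Q`. -/
theorem coeff_neg_one_eq_coeff {Q r : Polynomial O} (hQ : Q.IsDistinguishedAt (maximalIdeal O))
    (hr : r.degree < Q.natDegree) (hn : 0 < Q.natDegree) {x : R}
    (hx : E.ofPowerSeries Q * x = E.ofPowerSeries r) :
    E.coeff x (-1) = r.coeff (Q.natDegree - 1) := by
  -- Split x into its part f of nonnegative index and its part x' of negative index. Then Q x' = r -
  -- Q f is a polynomial of degree less than deg Q, so uniqueness of division gives f = 0.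
  set f : PowerSeries O := PowerSeries.mk fun i => E.coeff x i
  set x' := x - E.ofPowerSeries f with hx'
  have h1 : ∀ i : ℤ, 0 ≤ i → E.coeff x' i = 0 := by
    intro i hi
    obtain ⟨m, rfl⟩ := Int.eq_ofNat_of_zero_le hi
    rw [hx', map_sub, Pi.sub_apply, E.coeff_ofPowerSeries, if_neg (by simp), Int.natAbs_natCast,
      PowerSeries.coeff_mk, sub_self]
  have h2 : ∀ i : ℤ, i < 0 → E.coeff x' i = E.coeff x i := by
    intro i hi
    rw [hx', map_sub, Pi.sub_apply, E.coeff_ofPowerSeries, if_pos hi, sub_zero]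
  have h3 : E.ofPowerSeries Q * x' = E.ofPowerSeries ((r : PowerSeries O) - (Q : PowerSeries O) * f) := by
    rw [hx', map_sub, map_mul, mul_sub, hx]
  have h4 : ∀ i : ℕ, PowerSeries.coeff i ((r : PowerSeries O) - (Q : PowerSeries O) * f) =
      ∑ j ∈ Finset.range (Q.natDegree + 1), Q.coeff j * E.coeff x' (i - j) := by
    intro i
    rw [← E.coeff_ofPowerSeries_coe_mul le_rfl, h3, E.coeff_ofPowerSeries, if_neg (by simp),
      Int.natAbs_natCast]
  have h5 : ∀ i : ℕ, Q.natDegree ≤ i → PowerSeries.coeff i ((r : PowerSeries O) - (Q : PowerSeries O) * f) = 0 := by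
    intro i hi
    rw [h4]
    refine Finset.sum_eq_zero fun j hj => ?_
    rw [h1, mul_zero]
    have := Finset.mem_range.mp hj
    omega
  have h6 : f = 0 := by
    set h := PowerSeries.trunc Q.natDegree ((r : PowerSeries O) - (Q : PowerSeries O) * f)
    have h7 : (h : PowerSeries O) = (r : PowerSeries O) - (Q : PowerSeries O) * f := by
      ext i
      rw [Polynomial.coeff_coe, PowerSeries.coeff_trunc]
      split_ifs with hi
      · rfl
      · rw [h5 i (not_lt.mp hi)]
    refine (eq_zero_of_aeval_mul_eq (AlgEquiv.refl : PowerSeries O ≃ₐ[O] PowerSeries O) hQ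
      (r := r - h) ?_ ?_).1
    · exact (Polynomial.degree_sub_le _ _).trans_lt (max_lt hr (PowerSeries.degree_trunc_lt _ _))
    · rw [aeval_parameter, aeval_parameter]
      simp [h7]
  -- As f = 0, the coefficient of index n - 1 in Q x = r receives only the term of the leading
  -- coefficient of Q with the coefficient of x of index -1.
  have h7 := h4 (Q.natDegree - 1)
  rw [h6, mul_zero, sub_zero, Polynomial.coeff_coe, Finset.sum_range_succ, Finset.sum_eq_zero,
    zero_add, hQ.monic.coeff_natDegree, one_mul] at h7
  · rw [h7, ← h2 (-1) (by norm_num), show ((Q.natDegree - 1 : ℕ) : ℤ) - Q.natDegree = -1 by omega]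
  · intro j hj
    rw [h1, mul_zero]
    have := Finset.mem_range.mp hj
    omega

theorem derivation_algebraMap {B : Type*} [CommRing B] [Algebra O B] [Algebra B R]
    (e : PowerSeries O ≃ₐ[O] B) (hE : ∀ f, E.ofPowerSeries f = algebraMap B R (e f)) (b : B) :
    E.derivation (algebraMap B R b) = algebraMap B R (paramDerivation e b) := by
  obtain ⟨f, rfl⟩ := e.surjective b
  rw [← hE, E.derivation_ofPowerSeries, hE, paramDerivation_apply]

/-- The derivative of `b / d`. -/
theorem exists_pow_mul_eq_algebraMap_derivation {B F : Type*} [CommRing B] [Algebra O B] [Algebra B R]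
    [Field F] [Algebra R F] [FaithfulSMul R F] [Algebra O F] [Algebra B F] [IsScalarTower O R F]
    [IsScalarTower B R F] {π : O} (e : PowerSeries O ≃ₐ[O] B)
    (hE : ∀ f, E.ofPowerSeries f = algebraMap B R (e f))
    (hF : ∀ f : F, ∃ (n : ℕ) (x : R), algebraMap O F π ^ n * f = algebraMap R F x)
    {b d : B} {g : F} (hd : algebraMap B F d ≠ 0)
    (hg : algebraMap B F d ^ 2 * g = algebraMap B F (d * paramDerivation e b - b * paramDerivation e d)) :
    ∃ (n : ℕ) (x : R), algebraMap O F π ^ n * g = algebraMap R F (E.derivation x) := by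
  obtain ⟨n, x, hx⟩ := hF (algebraMap B F b / algebraMap B F d)
  have h1 : algebraMap B R d * x = π ^ n • algebraMap B R b := by
    apply FaithfulSMul.algebraMap_injective R F
    rw [Algebra.smul_def, map_mul, map_mul, ← hx, ← IsScalarTower.algebraMap_apply,
      ← IsScalarTower.algebraMap_apply, ← IsScalarTower.algebraMap_apply, map_pow]
    field_simp
  have h2 := congrArg E.derivation h1
  rw [Derivation.leibniz, Derivation.map_smul, E.derivation_algebraMap e hE, E.derivation_algebraMap e hE,
    smul_eq_mul, smul_eq_mul] at h2
  refine ⟨n, x, mul_left_cancel₀ (pow_ne_zero 2 hd) ?_⟩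
  have h4 := congrArg (algebraMap R F) h1
  have h5 := congrArg (algebraMap R F) h2
  rw [Algebra.smul_def, map_mul, map_mul, ← IsScalarTower.algebraMap_apply,
    ← IsScalarTower.algebraMap_apply, ← IsScalarTower.algebraMap_apply, map_pow] at h4
  rw [Algebra.smul_def, map_mul, map_add, map_mul, map_mul, ← IsScalarTower.algebraMap_apply,
    ← IsScalarTower.algebraMap_apply, ← IsScalarTower.algebraMap_apply,
    ← IsScalarTower.algebraMap_apply, map_pow] at h5
  rw [map_sub, map_mul, map_mul] at hg
  linear_combination algebraMap O F π ^ n * hg - algebraMap B F d * h5 +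
    algebraMap B F (paramDerivation e d) * h4

end DoubleExpansion

/-! ### Values of the residue functionals. -/

namespace IsResidueFunctional

variable {O K B M : Type*} [CommRing O] [IsDomain O] [IsDiscreteValuationRing O]
  [IsAdicComplete (maximalIdeal O) O] [CharZero O] [Finite (ResidueField O)]
  [Field K] [Algebra O K] [IsFractionRing O K]
  [CommRing B] [IsDomain B] [IsLocalRing B] [IsNoetherianRing B] [IsIntegrallyClosed B]
  [Algebra O B] {e : PowerSeries O ≃ₐ[O] B}
  [Field M] [Algebra B M] [IsFractionRing B M]
  [Algebra O M] [IsScalarTower O B M] [Algebra K M] [IsScalarTower O K M]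
  {y : HeightOnePrime B} {π : O} {ρ : M →ₗ[O] constField K (complField M y)}

theorem algebraMap_complField_ne_zero {b : B} (hb : b ≠ 0) : algebraMap B (complField M y) b ≠ 0 := by
  rw [IsScalarTower.algebraMap_apply B M (complField M y)]
  simpa using hb

theorem isHausdorff_complRing : IsHausdorff (maximalIdeal (complRing M y)) (complRing M y) := by
  infer_instance

theorem algebraMap_complField_mul_eq {s b : B} {g : M} (hg : algebraMap B M s * g = algebraMap B M b) :
    algebraMap B (complField M y) s * algebraMap M (complField M y) g =
      algebraMap B (complField M y) b := by
  rw [IsScalarTower.algebraMap_apply B M (complField M y), ← map_mul, hg,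
    ← IsScalarTower.algebraMap_apply]

/-- A form which is regular at `y` has no residue, when `y` is not above `π`. -/
theorem apply_eq_zero_of_mul_eq (hρ : IsResidueFunctional e y ρ)
    (hπ : maximalIdeal O = Ideal.span {π}) (hy : algebraMap O B π ∉ y.1.asIdeal) {s b : B}
    (hs : s ∉ y.1.asIdeal) {g : M} (hg : algebraMap B M s * g = algebraMap B M b) : ρ g = 0 := by
  obtain ⟨Q, -, hQ⟩ := exists_distinguished y e hπ hy
  obtain ⟨c, -⟩ := exists_laurentCoordinate_complRing (K := K) (M := M) y e hπ hy hQ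
  have := isHausdorff_complRing (M := M) (y := y)
  rw [hρ.eq_residue hπ hy c]
  refine c.residue_mul_deriv_eq_zero_of_mul_eq e ?_ (algebraMap_complField_mul_eq hg)
  rwa [← notMem_maximalIdeal, algebraMap_complRing_mem_maximalIdeal_iff]

theorem apply_algebraMap (hρ : IsResidueFunctional e y ρ) (b : B) : ρ (algebraMap B M b) = 0 := by
  obtain ⟨π, hπ'⟩ := IsDiscreteValuationRing.exists_irreducible O
  have hπ := (IsDiscreteValuationRing.irreducible_iff_uniformizer π).mp hπ'
  by_cases hy : algebraMap O B π ∈ y.1.asIdeal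
  · obtain ⟨E, hE⟩ := exists_doubleExpansion_complRing y M e hπ hy
    obtain ⟨f, rfl⟩ := e.surjective b
    have h := hρ.pow_mul_eq hπ hy E hE (g := algebraMap B M (e f)) (n := 0) (x := E.ofPowerSeries f)
      (by rw [pow_zero, one_mul, hE, ← IsScalarTower.algebraMap_apply, ← IsScalarTower.algebraMap_apply])
    rwa [pow_zero, map_one, one_mul, E.coeff_ofPowerSeries, if_pos (by norm_num), map_zero, neg_zero] at h
  · have := y.1.isPrime
    exact hρ.apply_eq_zero_of_mul_eq hπ hy (s := 1) (b := b)
      (fun h => this.ne_top ((Ideal.eq_top_iff_one _).mpr h)) (by rw [map_one, one_mul])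

theorem algebraMap_pow_ne_zero (hπ : Irreducible π) (n : ℕ) :
    algebraMap O (constField K (complField M y)) (π ^ n) ≠ 0 :=
  (map_ne_zero_iff _ DoubleExpansion.algebraMap_constField_injective).mpr (pow_ne_zero _ hπ.ne_zero)

/-- Exact forms have no residues. -/
theorem apply_eq_zero_of_exact (hρ : IsResidueFunctional e y ρ) {b d : B} (hd : d ≠ 0) {g : M}
    (hg : algebraMap B M (d ^ 2) * g =
      algebraMap B M (d * paramDerivation e b - b * paramDerivation e d)) : ρ g = 0 := by
  obtain ⟨π, hπ'⟩ := IsDiscreteValuationRing.exists_irreducible O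
  have hπ := (IsDiscreteValuationRing.irreducible_iff_uniformizer π).mp hπ'
  have hd' := algebraMap_complField_ne_zero (M := M) (y := y) hd
  have hg' := algebraMap_complField_mul_eq (y := y) hg
  rw [map_pow] at hg'
  by_cases hy : algebraMap O B π ∈ y.1.asIdeal
  · obtain ⟨E, hE⟩ := exists_doubleExpansion_complRing y M e hπ hy
    obtain ⟨n, x, h3⟩ := E.exists_pow_mul_eq_algebraMap_derivation e hE
      (exists_pow_mul_eq_algebraMap_complRing (M := M) y e hπ hy) hd' hg'
    have h := hρ.pow_mul_eq hπ hy E hE h3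
    rw [E.coeff_neg_one_derivation, map_zero, neg_zero] at h
    exact (mul_eq_zero.mp h).resolve_left (algebraMap_pow_ne_zero hπ' n)
  · obtain ⟨Q, hQ, hQy⟩ := exists_distinguished y e hπ hy
    obtain ⟨c, -⟩ := exists_laurentCoordinate_complRing (K := K) (M := M) y e hπ hy hQy
    have := isHausdorff_complRing (M := M) (y := y)
    rw [hρ.eq_residue hπ hy c]
    refine c.residue_mul_deriv_eq_zero_of_exact e hQ ?_ hd' hg'
    rw [algebraMap_complRing_mem_maximalIdeal_iff, hQy]
    exact Ideal.mem_span_singleton_self _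

variable {Q r : Polynomial O}

theorem trace_apply_of_notMem (hρ : IsResidueFunctional e y ρ)
    (hπ : maximalIdeal O = Ideal.span {π}) (hy : algebraMap O B π ∉ y.1.asIdeal)
    (hQ : Q.IsDistinguishedAt (maximalIdeal O))
    (hQy : y.1.asIdeal = Ideal.span {Polynomial.aeval (parameter e) Q})
    (hr : r.degree < Q.natDegree) {g : M}
    (hg : algebraMap B M (Polynomial.aeval (parameter e) Q) * g =
      algebraMap B M (Polynomial.aeval (parameter e) r)) :
    Algebra.trace K _ (ρ g) = algebraMap O K (r.coeff (Q.natDegree - 1)) := by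
  obtain ⟨c, -⟩ := exists_laurentCoordinate_complRing (K := K) (M := M) y e hπ hy hQy
  have := isHausdorff_complRing (M := M) (y := y)
  have hQ0 : Polynomial.aeval (parameter e) Q ≠ 0 := fun h => by
    have := y.2
    rw [hQy, h] at this
    simp at this
  rw [hρ.eq_residue hπ hy c]
  refine c.trace_residue_mul_deriv e hQ (fun b => ?_) (maximalIdeal_complRing_eq_span M y hQy)
    (fun x => ?_) (algebraMap_complField_ne_zero hQ0) hr (algebraMap_complField_mul_eq hg)
  · rw [algebraMap_complRing_mem_maximalIdeal_iff, hQy, Ideal.mem_span_singleton]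
  · obtain ⟨b, s, hs, h⟩ := exists_mul_sub_algebraMap_mem_maximalIdeal M y x
    exact ⟨b, s, by rwa [algebraMap_complRing_mem_maximalIdeal_iff], h⟩

theorem trace_apply_of_mem (hρ : IsResidueFunctional e y ρ)
    (hπ : maximalIdeal O = Ideal.span {π}) (hy : algebraMap O B π ∈ y.1.asIdeal)
    (hQ : Q.IsDistinguishedAt (maximalIdeal O)) (hn : 0 < Q.natDegree)
    (hr : r.degree < Q.natDegree) {g : M}
    (hg : algebraMap B M (Polynomial.aeval (parameter e) Q) * g =
      algebraMap B M (Polynomial.aeval (parameter e) r)) :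
    Algebra.trace K _ (ρ g) = -algebraMap O K (r.coeff (Q.natDegree - 1)) := by
  obtain ⟨E, hE⟩ := exists_doubleExpansion_complRing y M e hπ hy
  have := faithfulSMul_complRing (M := M) y e
  have hR := maximalIdeal_complRing_eq_span_of_mem (M := M) y e hπ hy
  have hF := exists_pow_mul_eq_algebraMap_complRing (M := M) y e hπ hy
  have hK : Function.Surjective (algebraMap K (constField K (complField M y))) :=
    E.exists_algebraMap_eq_constField (K := K) hπ hR hF
  -- Q is nonzero modulo π, hence a unit at (π), so r/Q is integral there.
  have hQu : IsUnit (E.ofPowerSeries Q) := by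
    rw [hE, ← notMem_maximalIdeal, hR, Ideal.mem_span_singleton,
      dvd_algebraMap_complRing_iff y e hπ hy, C_dvd_iff hπ]
    exact coe_map_residue_ne_zero hQ
  obtain ⟨u, hu⟩ := hQu
  have hx : E.ofPowerSeries Q * ((u⁻¹ : (complRing M y)ˣ) * E.ofPowerSeries r) = E.ofPowerSeries r := by
    rw [← hu, Units.mul_inv_cancel_left]
  set x := ((u⁻¹ : (complRing M y)ˣ) : complRing M y) * E.ofPowerSeries r
  have hxg : algebraMap O (complField M y) π ^ 0 * algebraMap M (complField M y) g =
      algebraMap (complRing M y) (complField M y) x := by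
    have h1 : algebraMap (complRing M y) (complField M y) (E.ofPowerSeries Q) ≠ 0 := by
      rw [← hu]
      exact (u.isUnit.map (algebraMap (complRing M y) (complField M y))).ne_zero
    apply mul_left_cancel₀ h1
    rw [← map_mul, hx, pow_zero, one_mul, hE, hE, ← aeval_parameter, ← aeval_parameter,
      ← IsScalarTower.algebraMap_apply, ← IsScalarTower.algebraMap_apply, algebraMap_complField_mul_eq hg]
  have h := hρ.pow_mul_eq hπ hy E hE hxg
  rw [pow_zero, map_one, one_mul, E.coeff_neg_one_eq_coeff hQ hr hn hx] at h
  -- The constant field at (π) is K, so the trace is the identity.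
  have hrank : Module.finrank K (constField K (complField M y)) = 1 :=
    finrank_eq_one_iff_of_nonzero' 1 one_ne_zero |>.mpr fun w => by
      obtain ⟨b, rfl⟩ := hK w
      exact ⟨b, by rw [Algebra.smul_def, mul_one]⟩
  rw [h, IsScalarTower.algebraMap_apply O K (constField K (complField M y)), ← map_neg,
    Algebra.trace_algebraMap, hrank, one_smul]

end IsResidueFunctional
end Reciprocity

/-! ### Partial fractions and the sum formula. -/

namespace Reciprocity

/-- The height one prime generated by a prime element. -/
noncomputable def heightOnePrimeOfPrime {B : Type*} [CommRing B] [IsDomain B] [IsNoetherianRing B]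
    {p : B} (hp : Prime p) : HeightOnePrime B :=
  have hP : (Ideal.span {p}).IsPrime := (Ideal.span_singleton_prime hp.ne_zero).mpr hp
  ⟨⟨Ideal.span {p}, hP⟩, le_antisymm
    (Ideal.height_le_one_of_isPrincipal_of_mem_minimalPrimes (Ideal.span {p}) _
      (by rw [Ideal.minimalPrimes_eq_subsingleton_self]; rfl))
    (Order.one_le_iff_ne_zero.mpr fun h => hp.ne_zero
      (Ideal.span_singleton_eq_bot.mp (Ideal.height_eq_zero_iff_eq_bot.mp h)))⟩

theorem eq_heightOnePrimeOfPrime {B : Type*} [CommRing B] [IsDomain B] [IsNoetherianRing B]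
    {p : B} (hp : Prime p) {y : HeightOnePrime B} (hy : p ∈ y.1.asIdeal) :
    y = heightOnePrimeOfPrime hp :=
  have := y.1.isPrime
  Subtype.ext (PrimeSpectrum.ext (y.1.asIdeal.eq_span_singleton_of_height_eq_one y.2 hy hp))

section Sum

variable {O K B M : Type*} [CommRing O] [IsDomain O] [IsDiscreteValuationRing O]
  [IsAdicComplete (maximalIdeal O) O] [CharZero O] [Finite (ResidueField O)]
  [Field K] [Algebra O K] [IsFractionRing O K]
  [CommRing B] [IsDomain B] [IsLocalRing B] [IsNoetherianRing B] [IsIntegrallyClosed B]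
  [Algebra O B] {e : PowerSeries O ≃ₐ[O] B}
  [Field M] [Algebra B M] [IsFractionRing B M]
  [Algebra O M] [IsScalarTower O B M] [Algebra K M] [IsScalarTower O K M]
  {π : O} {ρ : ∀ y : HeightOnePrime B, M →ₗ[O] constField K (complField M y)}
  {Q Q' : Polynomial O}

theorem not_algebraMap_dvd_aeval (e : PowerSeries O ≃ₐ[O] B) (hπ : maximalIdeal O = Ideal.span {π})
    (hQ : Q.IsDistinguishedAt (maximalIdeal O)) :
    ¬ algebraMap O B π ∣ Polynomial.aeval (parameter e) Q := by
  rw [aeval_parameter, ← e.commutes, map_dvd_iff e]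
  exact fun h => coe_map_residue_ne_zero hQ ((C_dvd_iff hπ _).mp h)

/-- Associated distinguished polynomials have equal degree by uniqueness of division; both being
monic, their difference has smaller degree and is divisible by Q, so it vanishes. -/
theorem eq_of_aeval_dvd (e : PowerSeries O ≃ₐ[O] B) (hQ : Q.IsDistinguishedAt (maximalIdeal O))
    (hQ' : Q'.IsDistinguishedAt (maximalIdeal O)) (hp : Prime (Polynomial.aeval (parameter e) Q))
    (hp' : Prime (Polynomial.aeval (parameter e) Q'))
    (h : Polynomial.aeval (parameter e) Q ∣ Polynomial.aeval (parameter e) Q') : Q = Q' := by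
  have h' := ((hp.dvd_prime_iff_associated hp').mp h).symm.dvd
  have key : ∀ {P P' : Polynomial O}, P.IsDistinguishedAt (maximalIdeal O) → P'.Monic →
      Polynomial.aeval (parameter e) P ∣ Polynomial.aeval (parameter e) P' →
      P.natDegree ≤ P'.natDegree := by
    intro P P' hP hP' ⟨q, hq⟩
    by_contra hlt
    have h1 := (eq_zero_of_aeval_mul_eq e hP (r := P')
      (by rw [Polynomial.degree_eq_natDegree hP'.ne_zero]; exact_mod_cast not_le.mp hlt) hq.symm).2
    exact hP'.ne_zero h1
  have hdeg := le_antisymm (key hQ hQ'.monic h) (key hQ' hQ.monic h')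
  obtain ⟨q, hq⟩ := dvd_sub h (dvd_refl (Polynomial.aeval (parameter e) Q))
  rw [← map_sub] at hq
  have h1 := (eq_zero_of_aeval_mul_eq e hQ (r := Q' - Q) ?_ hq.symm).2
  · exact (sub_eq_zero.mp h1).symm
  · rw [hdeg, ← Polynomial.degree_eq_natDegree hQ'.monic.ne_zero]
    refine Polynomial.degree_sub_lt_left ?_ hQ'.monic.ne_zero
      (hQ'.monic.leadingCoeff.trans hQ.monic.leadingCoeff.symm)
    rw [Polynomial.degree_eq_natDegree hQ'.monic.ne_zero, Polynomial.degree_eq_natDegree hQ.monic.ne_zero,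
      hdeg]

/-- Every nonzero element of `B` is, up to a unit, a product of a power of `π` and of
distinguished polynomials. -/
theorem exists_mul_eq_pow_mul_prod (e : PowerSeries O ≃ₐ[O] B) (hπ : maximalIdeal O = Ideal.span {π})
    {d : B} (hd : d ≠ 0) : ∃ (u : B) (n : ℕ) (s : Multiset (Polynomial O)),
      (∀ Q ∈ s, Q.IsDistinguishedAt (maximalIdeal O) ∧ Prime (Polynomial.aeval (parameter e) Q)) ∧
      d * u = algebraMap O B π ^ n * (s.map (Polynomial.aeval (parameter e))).prod := by
  have := uniqueFactorizationMonoid_of_equiv e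
  induction d using UniqueFactorizationMonoid.induction_on_prime with
  | h₁ => exact absurd rfl hd
  | h₂ x hx =>
    obtain ⟨u, hu⟩ := hx.exists_right_inv
    exact ⟨u, 0, 0, by simp, by simpa using hu⟩
  | h₃ a p ha hp ih =>
    obtain ⟨u, n, s, hs, h⟩ := ih ha
    rcases associated_of_prime e hπ hp with ⟨v, hv⟩ | ⟨Q, hQ, hQp⟩
    · refine ⟨v * u, n + 1, s, hs, ?_⟩
      rw [pow_succ]
      linear_combination p * v * h +
        algebraMap O B π ^ n * (s.map (Polynomial.aeval (parameter e))).prod * hv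
    · have hQ' := hQp.prime hp
      obtain ⟨v, hv⟩ := hQp
      refine ⟨v * u, n, Q ::ₘ s, ?_, ?_⟩
      · intro P hP
        rcases Multiset.mem_cons.mp hP with rfl | hP
        · exact ⟨hQ, hQ'⟩
        · exact hs P hP
      · rw [Multiset.map_cons, Multiset.prod_cons, ← hv]
        linear_combination p * v * h

/-- The reciprocity law for the form `g dT`. -/
def SumFormula (ρ : ∀ y : HeightOnePrime B, M →ₗ[O] constField K (complField M y)) (g : M) : Prop :=
  {y | ρ y g ≠ 0}.Finite ∧ ∑ᶠ y, Algebra.trace K (constField K (complField M y)) (ρ y g) = 0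

namespace SumFormula

theorem support_trace_subset (g : M) :
    (Function.support fun y => Algebra.trace K (constField K (complField M y)) (ρ y g)) ⊆
      {y | ρ y g ≠ 0} := by
  intro y hy h
  exact hy (by simp only [h, map_zero])

theorem of_forall_eq_zero {g : M} (h : ∀ y, ρ y g = 0) : SumFormula ρ g := by
  refine ⟨?_, ?_⟩
  · simp [h]
  · simp [h]

theorem add {g h : M} (hg : SumFormula ρ g) (hh : SumFormula ρ h) : SumFormula ρ (g + h) := by
  refine ⟨(hg.1.union hh.1).subset fun y hy => ?_, ?_⟩
  · by_contra hn
    simp only [Set.mem_union, Set.mem_ofPred_eq, not_or, not_not] at hn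
    exact hy (by rw [map_add, hn.1, hn.2, add_zero])
  · simp only [map_add]
    rw [finsum_add_distrib (hg.1.subset (support_trace_subset g))
      (hh.1.subset (support_trace_subset h)), hg.2, hh.2, add_zero]

/-- Nonzero scalars of O act invertibly on K; this is what makes Bézout identities with value c ∈ O
as good as identities with value 1. -/
theorem smul_iff {c : O} (hc : c ≠ 0) {g : M} : SumFormula ρ (c • g) ↔ SumFormula ρ g := by
  have hc' : algebraMap O K c ≠ 0 := by simpa using hc
  have h : ∀ y, ρ y (c • g) = algebraMap O K c • ρ y g := fun y => by
    rw [map_smul, algebraMap_smul]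
  simp only [SumFormula, h, map_smul, smul_eq_mul]
  rw [← mul_finsum]
  simp only [ne_eq, smul_eq_zero, hc', false_or, mul_eq_zero]

theorem sub {g h : M} (hg : SumFormula ρ g) (hh : SumFormula ρ h) : SumFormula ρ (g - h) := by
  rw [sub_eq_add_neg, ← neg_one_smul O h]
  exact hg.add ((smul_iff (neg_ne_zero.mpr one_ne_zero)).mpr hh)

theorem of_algebraMap (hρ : ∀ y, IsResidueFunctional e y (ρ y)) (b : B) :
    SumFormula ρ (algebraMap B M b) :=
  of_forall_eq_zero fun y => (hρ y).apply_algebraMap b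

theorem natDegree_pos_of_prime (e : PowerSeries O ≃ₐ[O] B)
    (hQ : Q.IsDistinguishedAt (maximalIdeal O))
    (hp : Prime (Polynomial.aeval (parameter e) Q)) : 0 < Q.natDegree := by
  by_contra h
  rw [hQ.monic.natDegree_eq_zero.mp (by omega), map_one] at hp
  exact hp.not_isUnit isUnit_one

/-- The core of the reciprocity law. Division by Q splits off an element of B, without residues; the
rest r/Q has poles only at (Q) and (π), where the two traces are opposite. -/
theorem of_aeval_mul_eq (hρ : ∀ y, IsResidueFunctional e y (ρ y))
    (hQ : Q.IsDistinguishedAt (maximalIdeal O)) (hp : Prime (Polynomial.aeval (parameter e) Q))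
    {h : B} {g : M} (hg : algebraMap B M (Polynomial.aeval (parameter e) Q) * g = algebraMap B M h) :
    SumFormula ρ g := by
  classical
  obtain ⟨π, hπ'⟩ := IsDiscreteValuationRing.exists_irreducible O
  have hπ := (IsDiscreteValuationRing.irreducible_iff_uniformizer π).mp hπ'
  obtain ⟨q, r, hr, rfl⟩ := exists_eq_aeval_mul_add e hQ h
  have hn := natDegree_pos_of_prime e hQ hp
  have hpπ := prime_algebraMap e hπ
  obtain ⟨g', rfl⟩ : ∃ g', g = algebraMap B M q + g' := ⟨g - algebraMap B M q, by ring⟩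
  have hg' : algebraMap B M (Polynomial.aeval (parameter e) Q) * g' =
      algebraMap B M (Polynomial.aeval (parameter e) r) := by
    rw [map_add, map_mul] at hg
    linear_combination hg
  refine (of_algebraMap hρ q).add ?_
  set y₀ := heightOnePrimeOfPrime hpπ with hy₀
  set y₁ := heightOnePrimeOfPrime hp with hy₁
  have hm₀ : algebraMap O B π ∈ y₀.1.asIdeal := Ideal.mem_span_singleton_self _
  have hm₁ : algebraMap O B π ∉ y₁.1.asIdeal := by
    intro hmem
    have h1 := Ideal.mem_span_singleton.mp hmem
    exact not_algebraMap_dvd_aeval e hπ hQ ((hp.dvd_prime_iff_associated hpπ).mp h1).symm.dvd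
  have hne : y₀ ≠ y₁ := fun h => hm₁ (h ▸ hm₀)
  have hsupp : {y | ρ y g' ≠ 0} ⊆ ({y₀, y₁} : Finset (HeightOnePrime B)) := by
    intro y hy
    by_contra hn
    simp only [Finset.coe_insert, Finset.coe_singleton, Set.mem_insert_iff, Set.mem_singleton_iff,
      not_or] at hn
    exact hy ((hρ y).apply_eq_zero_of_mul_eq hπ (fun h => hn.1 (eq_heightOnePrimeOfPrime hpπ h))
      (fun h => hn.2 (eq_heightOnePrimeOfPrime hp h)) hg')
  refine ⟨(Finset.finite_toSet _).subset hsupp, ?_⟩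
  rw [finsum_eq_sum_of_support_subset _ ((support_trace_subset g').trans hsupp),
    Finset.sum_pair hne, (hρ y₀).trace_apply_of_mem hπ hm₀ hQ hn hr hg',
    (hρ y₁).trace_apply_of_notMem hπ hm₁ hQ rfl hr hg', neg_add_cancel]

/-- Hermite reduction. With F = Q(T), F' = dF/dT and F u + F' v = c, one has c g = F u g + F' v g.
The first term has a smaller denominator; for the second, d(v h / Fⁿ) trades F' v h / Fⁿ⁺¹ for (v
h)' / Fⁿ, up to the factor n. -/
theorem of_aeval_pow_mul_eq (hρ : ∀ y, IsResidueFunctional e y (ρ y))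
    (hQ : Q.IsDistinguishedAt (maximalIdeal O)) (hp : Prime (Polynomial.aeval (parameter e) Q))
    (n : ℕ) {h : B} {g : M}
    (hg : algebraMap B M (Polynomial.aeval (parameter e) Q) ^ n * g = algebraMap B M h) :
    SumFormula ρ g := by
  have hn := natDegree_pos_of_prime e hQ hp
  have hQ0 : algebraMap B M (Polynomial.aeval (parameter e) Q) ≠ 0 := by simpa using hp.ne_zero
  have hQ' : ¬ Polynomial.aeval (parameter e) Q ∣ Polynomial.aeval (parameter e) Q.derivative := by
    rintro ⟨q, hq⟩
    have h1 : Q.derivative.degree < Q.natDegree :=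
      Polynomial.degree_eq_natDegree hQ.monic.ne_zero ▸ Polynomial.degree_derivative_lt hQ.monic.ne_zero
    exact hn.ne' (Polynomial.derivative_eq_zero.mp (eq_zero_of_aeval_mul_eq e hQ h1 hq.symm).2)
  obtain ⟨u, v, c, hc, huv⟩ := exists_mul_add_mul_eq_algebraMap e hQ hp hQ'
  induction n generalizing h g with
  | zero =>
    rw [pow_zero, one_mul] at hg
    exact hg ▸ of_algebraMap hρ h
  | succ n ih =>
    obtain rfl | hn0 := Nat.eq_zero_or_pos n
    · exact of_aeval_mul_eq hρ hQ hp (by rwa [zero_add, pow_one] at hg)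
    set F := Polynomial.aeval (parameter e) Q with hF
    set F' := Polynomial.aeval (parameter e) Q.derivative with hF'
    have hDF : paramDerivation e (F ^ n) = n * F ^ (n - 1) * F' := by
      rw [Derivation.leibniz_pow, paramDerivation_aeval, nsmul_eq_mul, smul_eq_mul, mul_assoc]
    have h1 : SumFormula ρ (algebraMap B M (F * u) * g) := by
      refine ih (h := u * h) ?_
      rw [map_mul, map_mul, ← hg]; ring
    set g₂ := algebraMap B M (F' * v) * g with hg₂
    set w := v * h with hw
    set g₃ := algebraMap B M (paramDerivation e w) / algebraMap B M F ^ n with hg₃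
    have hF3 : algebraMap B M F ^ n * g₃ = algebraMap B M (paramDerivation e w) :=
      mul_div_cancel₀ _ (pow_ne_zero n hQ0)
    have h3 : SumFormula ρ g₃ := ih hF3
    -- This difference is the derivative of w / Fⁿ.
    have h4 : SumFormula ρ (g₃ - (n : O) • g₂) := by
      refine of_forall_eq_zero fun y => (hρ y).apply_eq_zero_of_exact (b := w) (d := F ^ n)
        (pow_ne_zero n hp.ne_zero) ?_
      obtain ⟨m, rfl⟩ := Nat.exists_eq_succ_of_ne_zero hn0.ne'
      rw [hDF, Algebra.smul_def, map_natCast, hg₂, hw]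
      rw [hw] at hF3
      simp only [map_sub, map_mul, map_pow, map_natCast, Nat.succ_eq_add_one, Nat.add_sub_cancel]
        at hg hF3 ⊢
      linear_combination algebraMap B M F ^ (m + 1) * hF3 - ((m + 1 : ℕ) : M) *
        algebraMap B M F ^ m * algebraMap B M F' * algebraMap B M v * hg
    have h5 : SumFormula ρ g₂ := by
      have h6 := h3.sub h4
      rw [sub_sub_cancel] at h6
      exact (smul_iff (by exact_mod_cast hn0.ne')).mp h6
    rw [← smul_iff hc]
    convert h1.add h5 using 1
    rw [hg₂, ← add_mul, ← map_add, huv, Algebra.smul_def, IsScalarTower.algebraMap_apply O B M]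

/-- Induction on the number of factors: two distinct factors P and Q satisfy Q u + P v = c, which
writes c g as a sum of two elements, each lacking one factor in its denominator. If all factors
coincide, the denominator is a power. -/
theorem of_prod_mul_eq (hρ : ∀ y, IsResidueFunctional e y (ρ y)) (s : Multiset (Polynomial O))
    (hs : ∀ Q ∈ s, Q.IsDistinguishedAt (maximalIdeal O) ∧ Prime (Polynomial.aeval (parameter e) Q))
    {h : B} {g : M}
    (hg : algebraMap B M (s.map (Polynomial.aeval (parameter e))).prod * g = algebraMap B M h) :
    SumFormula ρ g := by
  induction hn : s.card generalizing s h g with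
  | zero =>
    rw [Multiset.card_eq_zero.mp hn, Multiset.map_zero, Multiset.prod_zero, map_one, one_mul] at hg
    exact hg ▸ of_algebraMap hρ h
  | succ n ih =>
    obtain ⟨Q, hQs⟩ := Multiset.card_pos_iff_exists_mem.mp (show 0 < s.card by omega)
    by_cases hall : ∀ P ∈ s, P = Q
    · rw [Multiset.eq_replicate_card.mpr hall, Multiset.map_replicate, Multiset.prod_replicate,
        map_pow] at hg
      exact of_aeval_pow_mul_eq hρ (hs Q hQs).1 (hs Q hQs).2 _ hg
    · push Not at hall
      obtain ⟨P, hPs, hPQ⟩ := hall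
      obtain ⟨s', rfl⟩ := Multiset.exists_cons_of_mem hQs
      obtain ⟨s'', rfl⟩ := Multiset.exists_cons_of_mem ((Multiset.mem_cons.mp hPs).resolve_left hPQ)
      obtain ⟨u, v, c, hc, huv⟩ := exists_mul_add_mul_eq_algebraMap e (hs Q hQs).1 (hs Q hQs).2
        fun hdvd => hPQ (eq_of_aeval_dvd e (hs Q hQs).1 (hs P hPs).1 (hs Q hQs).2 (hs P hPs).2 hdvd).symm
      rw [Multiset.map_cons, Multiset.map_cons, Multiset.prod_cons, Multiset.prod_cons, map_mul,
        map_mul] at hg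
      have h1 : SumFormula ρ (algebraMap B M (Polynomial.aeval (parameter e) Q * u) * g) := by
        refine ih (P ::ₘ s'') (fun R hR => hs R (by simp_all)) (h := u * h) ?_ (by simpa using hn)
        rw [Multiset.map_cons, Multiset.prod_cons, map_mul, map_mul, map_mul, ← hg]
        ring
      have h2 : SumFormula ρ (algebraMap B M (Polynomial.aeval (parameter e) P * v) * g) := by
        refine ih (Q ::ₘ s'') (fun R hR => hs R ?_) (h := v * h) ?_ (by simpa using hn)
        · rcases Multiset.mem_cons.mp hR with rfl | hR
          · exact hQs
          · exact Multiset.mem_cons_of_mem (Multiset.mem_cons_of_mem hR)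
        · rw [Multiset.map_cons, Multiset.prod_cons, map_mul, map_mul, map_mul, ← hg]
          ring
      rw [← smul_iff hc]
      convert h1.add h2 using 1
      rw [← add_mul, ← map_add, huv, Algebra.smul_def, IsScalarTower.algebraMap_apply O B M]

end SumFormula

/-- Up to a unit the denominator is a power of π times distinguished primes; scaling g removes the
power of π. -/
theorem sumFormula (hρ : ∀ y, IsResidueFunctional e y (ρ y)) (g : M) : SumFormula ρ g := by
  obtain ⟨π, hπ'⟩ := IsDiscreteValuationRing.exists_irreducible O
  have hπ := (IsDiscreteValuationRing.irreducible_iff_uniformizer π).mp hπ'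
  obtain ⟨b, d, hd, rfl⟩ := IsFractionRing.div_surjective (A := B) g
  have hd0 := nonZeroDivisors.ne_zero hd
  obtain ⟨u, n, s, hs, h⟩ := exists_mul_eq_pow_mul_prod e hπ hd0
  rw [← SumFormula.smul_iff (pow_ne_zero n hπ'.ne_zero)]
  refine SumFormula.of_prod_mul_eq hρ s hs (h := b * u) ?_
  have hd' : algebraMap B M d ≠ 0 := by simpa using hd0
  rw [Algebra.smul_def, IsScalarTower.algebraMap_apply O B M, map_pow (algebraMap O B)]
  have h1 := congrArg (algebraMap B M) h
  rw [map_mul, map_mul] at h1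
  rw [map_mul]
  field_simp
  linear_combination -algebraMap B M b * h1

end Sum
end Reciprocity

/-- Existence and uniqueness come from the functionals ρ, which therefore compute the chosen residue
`res`; the rest is the sum formula for the coefficient of ω. -/
theorem mainTheorem4
    {O K B M : Type*}
    [CommRing O] [IsDomain O] [IsDiscreteValuationRing O]
    [IsAdicComplete (IsLocalRing.maximalIdeal O) O] [Finite (IsLocalRing.ResidueField O)]
    [CharZero O]
    [Field K] [Algebra O K] [IsFractionRing O K]
    [CommRing B] [IsDomain B] [IsLocalRing B] [IsNoetherianRing B] [IsIntegrallyClosed B]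
    [Algebra O B] (hB : Nonempty (PowerSeries O ≃ₐ[O] B))
    [Field M] [Algebra B M] [IsFractionRing B M]
    [Algebra O M] [IsScalarTower O B M] [Algebra K M] [IsScalarTower O K M] :
    (∀ (y : Reciprocity.HeightOnePrime B) (ω : Reciprocity.GlobalDiff O B M),
      ∃! r, Reciprocity.IsResidueAt O K B M y ω r) ∧
    ∀ ω : Reciprocity.GlobalDiff O B M,
      {y : Reciprocity.HeightOnePrime B | Reciprocity.res O K B M y ω ≠ 0}.Finite ∧
      ∑ᶠ y : Reciprocity.HeightOnePrime B, Reciprocity.traceRes O K B M y ω = 0 := by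
  obtain ⟨e⟩ := hB
  choose ρ hρ using fun y : Reciprocity.HeightOnePrime B =>
    Reciprocity.exists_residueFunctional (M := M) K e y
  refine ⟨fun y ω => ⟨_, (hρ y ω _).mpr rfl, fun r hr => (hρ y ω r).mp hr⟩, fun ω => ?_⟩
  have hres : ∀ y, Reciprocity.res O K B M y ω =
      ρ y (Reciprocity.ctsLift M (Reciprocity.paramDerivation e) ω) := fun y =>
    (hρ y ω _).mp (Classical.epsilon_spec ⟨_, (hρ y ω _).mpr rfl⟩)
  have h := Reciprocity.sumFormula hρ (Reciprocity.ctsLift M (Reciprocity.paramDerivation e) ω)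
  simp only [Reciprocity.traceRes, hres]
  exact h
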